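/- Let $\mathcal C$ be a semi-abelian category satisfying "Huq = Smith" (two equivalence relations on the same object commute as soon as their normalizations cooperate). Composites are written in diagrammatic order. A crossed module $\mathbb G$ is a morphism $\partial\colon G\to G_0$ with an internal action $\xi\colon G_0\flat G\to G$ satisfying the Peiffer condition $(\partial\flat 1)\xi=\chi_G$ and the precrossed condition $\xi\partial=(1\flat\partial)\chi_{G_0}$, where $\chi$ denotes conjugation. The reflexive graph $d,c\colon G_1=G\rtimes_\xi G_0\rightrightarrows G_0$ (with $g\colon G\to G_1$, $gc=0$, $gd=\partial$) carries a unique internal groupoid structure, with composition $m$ and inversion $i$; put $g^\bullet=g\,i$. Natural transformations $\alpha\colon P\Rightarrow P'\colon\mathbb H\to\mathbb G$ are arrows $\alpha\colon H_0\to G_1$ with $\alpha d=p_0$, $\alpha c=p'_0$ and $\langle\partial\alpha,p'g\rangle m=pg$. A butterfly $E\colon\mathbb H\to\mathbb G$ is an object $E$ with morphisms $\kappa\colon H\to E$, $\iota\colon G\to E$, $\sigma\colon E\to H_0$, $\rho\colon E\to G_0$ such that $\kappa\sigma=\partial$, $\iota\rho=\partial$, $\kappa\rho=0$, $\iota=\ker\sigma$,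 $\sigma=\operatorname{coker}\iota$, $(\sigma\flat1)\,\xi\,\kappa=(1\flat\kappa)\chi_E$ and $(\rho\flat1)\,\xi\,\iota=(1\flat\iota)\chi_E$. Morphisms of butterflies are morphisms $E\to E'$ commuting with all four structure maps. The composite $EF$ of $E\colon\mathbb H\to\mathbb G$ and $F\colon\mathbb G\to\mathbb K$ is the cokernel of $\langle\iota,\kappa'\rangle\colon G\to E\times_{\rho,\sigma'}F$ with the induced maps; we write $[x,y]$ for the class of $(x,y)$. The identity butterfly $I_{\mathbb G}$ is $G_1$ with $\kappa=g^\bullet$, $\iota=g$, $\sigma=c$, $\rho=d$. For a butterfly $E\colon\mathbb H\to\mathbb G$ there are canonical groupoid actions $H_1\times_{d,\sigma}E\to E$ and $E\times_{\rho,c}G_1\to E$, the first determined by $\langle\sigma e,1\rangle\mapsto 1_E$, $\langle h^\bullet,0\rangle\mapsto\kappa$, and the second by $\langle1,\rho e\rangle\mapsto1_E$, $\langle0,g\rangle\mapsto\iota$; they induce the unit isomorphisms $IE\cong E$ and $EI\cong E$, while associativity $(EF)F'\cong E(FF')$ is $[[x,y],z]\mapsto[x,[y,z]]$. For a morphism $Q=(q,q_0)\colon\mathbb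 K\to\mathbb H$ of crossed modules, the split butterfly $E_Q\colon\mathbb K\to\mathbb H$ is the pullback $K_0\times_{q_0,c}H_1$ with $\kappa=\langle\partial,q\,h\,i\rangle$, $\iota=\langle0,h\rangle$, $\sigma$ the first projection, and $\rho$ the second projection followed by $d$. For a butterfly $E\colon\mathbb H\to\mathbb G$ the reduced composition $Q\cdot_{rc}E$ is the pullback $K_0\times_{q_0,\sigma}E$ with structure maps $\langle\partial,q\kappa\rangle$, $\langle0,\iota\rangle$, the first projection, and the second projection followed by $\rho$. Then identities, composites, split butterflies and reduced compositions are butterflies, the structural isomorphisms just described exist, and: (a) $Q\cdot_{rc}I_{\mathbb H}=E_Q$, and $[(k,a),x]\mapsto(k,a\cdot x)$ defines an isomorphism of butterflies $E_QE\cong Q\cdot_{rc}E$, natural in $Q$ and $E$. (b) Reduced composition is a functor on hom-categories: it is functorial in morphisms of butterflies and in natural transformations $\alpha\colon P\Rightarrow Q$, which act by $(k,x)\mapsto(k,\alpha(k)\cdot x)$, and the two functorialities are compatible. (c) There are isomorphisms of butterflies, natural in all variables (morphisms of butterflies and natural transformations), whenever the composites make sense: (A1) $Q\cdot_{rc}EF\cong(Q\cdot_{rc}E)F$,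 $(k,[x,y])\mapsto[(k,x),y]$; (A2) $PQ\cdot_{rc}E\cong P\cdot_{rc}(Q\cdot_{rc}E)$, $(l,x)\mapsto(l,(p_0l,x))$; (A3) $I\cdot_{rc}E\cong E$, $(h,x)\mapsto x$, where $I$ is the identity morphism of the crossed module. (d) These isomorphisms are coherent: the associativity diagram for A2 on $PQR\cdot_{rc}E$ and the two unit diagrams relating A2 and A3 (for $IQ$ and $QI$) commute; A1 is compatible with A2 on $PQ\cdot_{rc}EF$, with A3 on $I\cdot_{rc}EF$, with the associativity of butterfly composition on $Q\cdot_{rc}(EF)F'$, with the right unit isomorphism on $Q\cdot_{rc}EI$, and, through $E_QE\cong Q\cdot_{rc}E$, with the left unit isomorphism on $Q\cdot_{rc}IE$. -/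

import Mathlib

open CategoryTheory CategoryTheory.Limits

universe v u

namespace InternalButterfly

/-! ### Semi-abelian categories and the condition "Huq = Smith"

Composites are written in diagrammatic order throughout. -/

/-- A semi-abelian category: pointed, Barr exact, protomodular (split short five lemma), with
finite coproducts. `Regular` already contains the existence of finite limits. -/
class SemiAbelian (C : Type u) [Category.{v} C] [HasZeroMorphisms C] : Prop where
  regular : Regular C
  zeroObject : HasZeroObject C
  finiteCoproducts : HasFiniteCoproducts C
  /-- Equivalence relations are effective. -/
  effective : ∀ {R X : C} (p₁ p₂ : R ⟶ X), IsEquivalenceRelation p₁ p₂ →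
    ∃ (Y : C) (f : X ⟶ Y), IsKernelPair f p₁ p₂
  /-- The split short five lemma. -/
  splitShortFive : ∀ {K A B K' A' B' : C} (k : K ⟶ A) (p : A ⟶ B) (s : B ⟶ A)
    (k' : K' ⟶ A') (p' : A' ⟶ B') (s' : B' ⟶ A') (h : K ⟶ K') (f : A ⟶ A') (g : B ⟶ B')
    (w : k ≫ p = 0) (w' : k' ≫ p' = 0),
    Nonempty (IsLimit (KernelFork.ofι k w)) → Nonempty (IsLimit (KernelFork.ofι k' w')) →
    s ≫ p = 𝟙 B → s' ≫ p' = 𝟙 B' →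
    k ≫ f = h ≫ k' → p ≫ g = f ≫ p' → s ≫ f = g ≫ s' →
    IsIso h → IsIso g → IsIso f

attribute [instance] SemiAbelian.regular SemiAbelian.zeroObject SemiAbelian.finiteCoproducts

attribute [local simp] pullback.lift_fst pullback.lift_snd pullback.lift_fst_assoc
  pullback.lift_snd_assoc prod.lift_fst prod.lift_snd prod.lift_fst_assoc prod.lift_snd_assoc
  coprod.inl_desc coprod.inr_desc coprod.inl_desc_assoc coprod.inr_desc_assoc

section SemiAbelianFacts

variable {C : Type u} [Category.{v} C] [HasZeroMorphisms C] [SemiAbelian C]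

/-- The kernel and the section of a split epimorphism are jointly extremally epic. -/
theorem isIso_of_factors {A B N : C} (p : A ⟶ B) (s : B ⟶ A) (hs : s ≫ p = 𝟙 B)
    (n : N ⟶ A) [Mono n] (a : kernel p ⟶ N) (ha : a ≫ n = kernel.ι p)
    (b : B ⟶ N) (hb : b ≫ n = s) : IsIso n := by
  have w : a ≫ (n ≫ p) = 0 := by rw [← Category.assoc, ha, kernel.condition]
  have : Mono (a ≫ n) := by rw [ha]; infer_instance
  have : Mono a := mono_of_mono a n
  have hlim : IsLimit (KernelFork.ofι a w) := by
    refine KernelFork.IsLimit.ofι' a w (fun {T} x hx => ?_)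
    refine ⟨kernel.lift p (x ≫ n) (by simpa using hx), ?_⟩
    rw [← cancel_mono n, Category.assoc, ha, kernel.lift_ι]
  refine SemiAbelian.splitShortFive a (n ≫ p) b (kernel.ι p) p s (𝟙 _) n (𝟙 _) w
    (kernel.condition p) ⟨hlim⟩ ⟨kernelIsKernel p⟩ ?_ hs ?_ ?_ ?_ inferInstance inferInstance
  · rw [← Category.assoc, hb, hs]
  · rw [ha, Category.id_comp]
  · rw [Category.comp_id]
  · rw [hb, Category.id_comp]

theorem hom_ext_of_kernel_section {A B T : C} (p : A ⟶ B) (s : B ⟶ A) (hs : s ≫ p = 𝟙 B)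
    (x y : A ⟶ T) (h₁ : kernel.ι p ≫ x = kernel.ι p ≫ y) (h₂ : s ≫ x = s ≫ y) : x = y := by
  have : IsIso (equalizer.ι x y) :=
    isIso_of_factors p s hs (equalizer.ι x y) (equalizer.lift _ h₁) (equalizer.lift_ι _ _)
      (equalizer.lift _ h₂) (equalizer.lift_ι _ _)
  exact (cancel_epi (equalizer.ι x y)).1 (equalizer.condition x y)

/-- Reflexive relations are difunctional. -/
theorem difunctional {R X : C} (r₁ r₂ : R ⟶ X)
    (hm : ∀ {T : C} (f g : T ⟶ R), f ≫ r₁ = g ≫ r₁ → f ≫ r₂ = g ≫ r₂ → f = g)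
    {T : C} (x y z : T ⟶ R) (hxy : x ≫ r₂ = y ≫ r₂) (hyz : y ≫ r₁ = z ≫ r₁) :
    ∃ t : T ⟶ R, t ≫ r₁ = x ≫ r₁ ∧ t ≫ r₂ = z ≫ r₂ := by
  let P := pullback (pullback.snd r₂ r₂) (pullback.fst r₁ r₁)
  let pa : P ⟶ pullback r₂ r₂ := pullback.fst _ _
  let pc : P ⟶ pullback r₁ r₁ := pullback.snd _ _
  have hP : pa ≫ pullback.snd r₂ r₂ = pc ≫ pullback.fst r₁ r₁ := pullback.condition
  let m : R ⟶ X ⨯ X := prod.lift r₁ r₂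
  have : Mono m := ⟨fun f g h => hm f g
    (by simpa [m] using congrArg (· ≫ prod.fst) h)
    (by simpa [m] using congrArg (· ≫ prod.snd) h)⟩
  let t : P ⟶ X ⨯ X := prod.lift (pa ≫ pullback.fst r₂ r₂ ≫ r₁) (pc ≫ pullback.snd r₁ r₁ ≫ r₂)
  let u : pullback r₂ r₂ ⟶ P := pullback.lift (𝟙 _)
    (pullback.lift (pullback.snd r₂ r₂) (pullback.snd r₂ r₂) rfl) (by simp)
  have hupa : u ≫ pa = 𝟙 _ := pullback.lift_fst _ _ _
  have hupc : u ≫ pc = pullback.lift (pullback.snd r₂ r₂) (pullback.snd r₂ r₂) rfl :=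
    pullback.lift_snd _ _ _
  have hkpa : kernel.ι pa ≫ pa = 0 := kernel.condition pa
  have hk : kernel.ι pa ≫ pc ≫ pullback.fst r₁ r₁ = 0 := by
    rw [← hP, ← Category.assoc, hkpa, zero_comp]
  have hk' : kernel.ι pa ≫ pc ≫ pullback.snd r₁ r₁ ≫ r₁ = 0 := by
    rw [← pullback.condition, ← Category.assoc pc, ← Category.assoc, hk, zero_comp]
  have : IsIso (pullback.fst t m) := by
    refine isIso_of_factors pa u hupa _
      (pullback.lift (kernel.ι pa) (kernel.ι pa ≫ pc ≫ pullback.snd r₁ r₁) ?_)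
      (pullback.lift_fst _ _ _)
      (pullback.lift u (pullback.fst r₂ r₂) ?_) (pullback.lift_fst _ _ _)
    · apply prod.hom_ext
      · simp only [t, m, Category.assoc, prod.lift_fst, hk']
        rw [← Category.assoc, hkpa, zero_comp]
      · simp [t, m]
    · apply prod.hom_ext
      · simp only [t, m, Category.assoc, prod.lift_fst]
        rw [← Category.assoc, hupa, Category.id_comp]
      · simp only [t, m, Category.assoc, prod.lift_snd]
        rw [← Category.assoc, hupc, ← Category.assoc, pullback.lift_snd, pullback.condition]
  let a : T ⟶ P := pullback.lift (pullback.lift x y hxy) (pullback.lift y z hyz) (by simp)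
  refine ⟨a ≫ inv (pullback.fst t m) ≫ pullback.snd t m, ?_⟩
  have key : (a ≫ inv (pullback.fst t m) ≫ pullback.snd t m) ≫ m = a ≫ t := by
    rw [Category.assoc, Category.assoc, ← pullback.condition, IsIso.inv_hom_id_assoc]
  constructor
  · have := congrArg (· ≫ prod.fst) key
    simpa [m, t, a, pa, pc] using this
  · have := congrArg (· ≫ prod.snd) key
    simpa [m, t, a, pa, pc] using this

theorem isEquivalenceRelation_of_reflexive {R X : C} (r₁ r₂ : R ⟶ X)
    (hm : ∀ {T : C} (f g : T ⟶ R), f ≫ r₁ = g ≫ r₁ → f ≫ r₂ = g ≫ r₂ → f = g)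
    (e : X ⟶ R) (h₁ : e ≫ r₁ = 𝟙 X) (h₂ : e ≫ r₂ = 𝟙 X) : IsEquivalenceRelation r₁ r₂ := by
  obtain ⟨s, hs₁, hs₂⟩ := difunctional r₁ r₂ hm (r₂ ≫ e) (𝟙 R) (r₁ ≫ e) (by simp [h₂])
    (by simp [h₁])
  obtain ⟨t, ht₁, ht₂⟩ := difunctional r₁ r₂ hm (pullback.fst r₂ r₁)
    (pullback.fst r₂ r₁ ≫ r₂ ≫ e) (pullback.snd r₂ r₁) (by simp [h₂])
    (by simp [h₁, pullback.condition])
  exact ⟨⟨{ right_cancellation := fun _ f g => hm f g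
            r := e, reflexivity₁ := h₁, reflexivity₂ := h₂
            s := s, symmetry₁ := by simp [hs₁, h₁], symmetry₂ := by simp [hs₂, h₂]
            c := PullbackCone.mk (pullback.fst r₂ r₁) (pullback.snd r₂ r₁) pullback.condition
            isLimit := pullbackIsPullback r₂ r₁
            t := t, transitivity₁ := ht₁, transitivity₂ := ht₂ }⟩⟩

/-- A semi-abelian category has coequalizers. -/
instance : HasCoequalizers C := by
  have main : ∀ {X Y : C} (f g : X ⟶ Y), HasCoequalizer f g := by
    intro X Y f g
    let F := Regular.strongEpiMonoFactorisation
      (prod.lift (coprod.desc f (𝟙 Y)) (coprod.desc g (𝟙 Y)))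
    let r₁ := F.m ≫ prod.fst
    let r₂ := F.m ≫ prod.snd
    have hr₁ : F.e ≫ r₁ = coprod.desc f (𝟙 Y) := by
      rw [← Category.assoc, F.fac, prod.lift_fst]
    have hr₂ : F.e ≫ r₂ = coprod.desc g (𝟙 Y) := by
      rw [← Category.assoc, F.fac, prod.lift_snd]
    have hF : StrongEpi F.e := F.e_strong_epi
    have : Epi F.e := hF.epi
    have heq : IsEquivalenceRelation r₁ r₂ := by
      refine isEquivalenceRelation_of_reflexive r₁ r₂ ?_ (coprod.inr ≫ F.e) ?_ ?_
      · intro T a b ha hb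
        rw [← cancel_mono F.m]
        ext
        · simpa [r₁] using ha
        · simpa [r₂] using hb
      · rw [Category.assoc, hr₁, coprod.inr_desc]
      · rw [Category.assoc, hr₂, coprod.inr_desc]
    obtain ⟨Z, q, hq⟩ := SemiAbelian.effective r₁ r₂ heq
    have : HasCoequalizer r₁ r₂ := Regular.hasCoequalizer_of_isKernelPair hq
    have hw : f ≫ coequalizer.π r₁ r₂ = g ≫ coequalizer.π r₁ r₂ := by
      have h := congrArg (fun x => coprod.inl ≫ F.e ≫ x) (coequalizer.condition r₁ r₂)
      simp only [← Category.assoc F.e, hr₁, hr₂] at h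
      simpa using h
    refine ⟨⟨⟨Cofork.ofπ (coequalizer.π r₁ r₂) hw, ?_⟩⟩⟩
    refine Cofork.IsColimit.mk' _ (fun s => ?_)
    have hs : r₁ ≫ s.π = r₂ ≫ s.π := by
      rw [← cancel_epi F.e, ← Category.assoc F.e r₁, ← Category.assoc F.e r₂, hr₁, hr₂]
      ext
      · simpa using s.condition
      · simp
    refine ⟨coequalizer.desc s.π hs, coequalizer.π_desc _ _, fun {m} hm => ?_⟩
    have hm' : coequalizer.π r₁ r₂ ≫ m = s.π := hm
    refine coequalizer.hom_ext (hm'.trans ?_)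
    exact (coequalizer.π_desc _ _).symm
  exact hasCoequalizers_of_hasColimit_parallelPair C

end SemiAbelianFacts

section Commute

variable {C : Type u} [Category.{v} C] [HasZeroMorphisms C] [SemiAbelian C]

/-- Two morphisms with the same codomain cooperate (commute in the sense of Huq). -/
def Cooperate {A B X : C} (f : A ⟶ X) (g : B ⟶ X) : Prop :=
  ∃ φ : A ⨯ B ⟶ X, prod.lift (𝟙 A) 0 ≫ φ = f ∧ prod.lift 0 (𝟙 B) ≫ φ = g

/-- Two relations on `X` commute in the sense of Smith: there is a connector `Φ` on
`R ×_X S = {(x, y, z) | x R y S z}` with `Φ (x, y, y) = x` and `Φ (y, y, z) = z`. -/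
def SmithCommute {R S X : C} (r₁ r₂ : R ⟶ X) (s₁ s₂ : S ⟶ X) : Prop :=
  ∃ Φ : pullback r₂ s₁ ⟶ X,
    (∀ {T : C} (a : T ⟶ R) (b : T ⟶ S) (h : a ≫ r₂ = b ≫ s₁), b ≫ s₁ = b ≫ s₂ →
      pullback.lift a b h ≫ Φ = a ≫ r₁) ∧
    (∀ {T : C} (a : T ⟶ R) (b : T ⟶ S) (h : a ≫ r₂ = b ≫ s₁), a ≫ r₁ = a ≫ r₂ →
      pullback.lift a b h ≫ Φ = b ≫ s₂)

/-- The normalization of a relation: its class of zero. -/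
noncomputable def normalization {R X : C} (r₁ r₂ : R ⟶ X) : kernel r₂ ⟶ X :=
  kernel.ι r₂ ≫ r₁

variable (C) in
/-- "Huq = Smith": equivalence relations commute as soon as their normalizations do. -/
class HuqSmith : Prop where
  smith_of_huq : ∀ {R S X : C} (r₁ r₂ : R ⟶ X) (s₁ s₂ : S ⟶ X),
    IsEquivalenceRelation r₁ r₂ → IsEquivalenceRelation s₁ s₂ →
    Cooperate (normalization r₁ r₂) (normalization s₁ s₂) → SmithCommute r₁ r₂ s₁ s₂

/-! ### Internal actions -/

/-- `B ♭ A`, the kernel of `[1, 0] : B + A ⟶ B`. -/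
noncomputable def bflat (B A : C) : C := kernel (coprod.desc (𝟙 B) (0 : A ⟶ B))

/-- The inclusion `B ♭ A ⟶ B + A`. -/
noncomputable def bflatι (B A : C) : bflat B A ⟶ B ⨿ A := kernel.ι _

theorem bflatι_desc (B A : C) : bflatι B A ≫ coprod.desc (𝟙 B) (0 : A ⟶ B) = 0 :=
  kernel.condition _

noncomputable def bflatLift {T B A : C} (f : T ⟶ B ⨿ A)
    (h : f ≫ coprod.desc (𝟙 B) (0 : A ⟶ B) = 0) : T ⟶ bflat B A :=
  kernel.lift _ f h

@[simp] theorem bflatLift_ι {T B A : C} (f : T ⟶ B ⨿ A)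
    (h : f ≫ coprod.desc (𝟙 B) (0 : A ⟶ B) = 0) : bflatLift f h ≫ bflatι B A = f :=
  kernel.lift_ι _ _ _

theorem bflat_hom_ext {T B A : C} {f g : T ⟶ bflat B A}
    (h : f ≫ bflatι B A = g ≫ bflatι B A) : f = g :=
  equalizer.hom_ext h

/-- `f ♭ g : B ♭ A ⟶ B' ♭ A'`. -/
noncomputable def bflatMap {B A B' A' : C} (f : B ⟶ B') (g : A ⟶ A') : bflat B A ⟶ bflat B' A' :=
  bflatLift (bflatι B A ≫ coprod.map f g) (by
    have h : coprod.map f g ≫ coprod.desc (𝟙 B') (0 : A' ⟶ B') =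
        coprod.desc (𝟙 B) (0 : A ⟶ B) ≫ f := by ext <;> simp
    rw [Category.assoc, h, ← Category.assoc, bflatι_desc, zero_comp])

@[simp] theorem bflatMap_ι {B A B' A' : C} (f : B ⟶ B') (g : A ⟶ A') :
    bflatMap f g ≫ bflatι B' A' = bflatι B A ≫ coprod.map f g := bflatLift_ι _ _

@[simp] theorem bflatMap_id (B A : C) : bflatMap (𝟙 B) (𝟙 A) = 𝟙 (bflat B A) :=
  bflat_hom_ext (by simp)

theorem bflatMap_comp {B A B' A' B'' A'' : C} (f : B ⟶ B') (g : A ⟶ A') (f' : B' ⟶ B'')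
    (g' : A' ⟶ A'') : bflatMap (f ≫ f') (g ≫ g') = bflatMap f g ≫ bflatMap f' g' :=
  bflat_hom_ext (by
    rw [bflatMap_ι, Category.assoc, bflatMap_ι, ← Category.assoc, bflatMap_ι, Category.assoc,
      coprod.map_map])

/-- The unit `A ⟶ B ♭ A` of the monad `B ♭ (-)`. -/
noncomputable def bflatUnit (B A : C) : A ⟶ bflat B A := bflatLift coprod.inr (by simp)

/-- The multiplication `B ♭ (B ♭ A) ⟶ B ♭ A` of the monad `B ♭ (-)`. -/
noncomputable def bflatMult (B A : C) : bflat B (bflat B A) ⟶ bflat B A :=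
  bflatLift (bflatι B (bflat B A) ≫ coprod.desc coprod.inl (bflatι B A)) (by
    have h : coprod.desc coprod.inl (bflatι B A) ≫ coprod.desc (𝟙 B) (0 : A ⟶ B) =
        coprod.desc (𝟙 B) (0 : bflat B A ⟶ B) := by
      ext
      · simp
      · simp [bflatι_desc]
    rw [Category.assoc, h, bflatι_desc])

/-- The conjugation action `χ_A : A ♭ A ⟶ A`. -/
noncomputable def conj (A : C) : bflat A A ⟶ A := bflatι A A ≫ coprod.desc (𝟙 A) (𝟙 A)

end Commute

/-! ### Crossed modules -/

/-- An internal crossed module `∂ : top ⟶ base` with its action `ξ : base ♭ top ⟶ top`. -/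
structure XMod (C : Type u) [Category.{v} C] [HasZeroMorphisms C] [SemiAbelian C] where
  top : C
  base : C
  del : top ⟶ base
  act : bflat base top ⟶ top
  act_unit : bflatUnit base top ≫ act = 𝟙 top
  act_mult : bflatMult base top ≫ act = bflatMap (𝟙 base) act ≫ act
  peiffer : bflatMap del (𝟙 top) ≫ act = conj top
  precrossed : act ≫ del = bflatMap (𝟙 base) del ≫ conj base

variable {C : Type u} [Category.{v} C] [HasZeroMorphisms C] [SemiAbelian C]

/-- A morphism of crossed modules. -/
@[ext] structure XModHom (H G : XMod C) where
  top : H.top ⟶ G.top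
  base : H.base ⟶ G.base
  comm : H.del ≫ base = top ≫ G.del
  equivariant : H.act ≫ top = bflatMap base top ≫ G.act

instance : Category (XMod C) where
  Hom := XModHom
  id G := { top := 𝟙 _, base := 𝟙 _, comm := by simp, equivariant := by simp }
  comp P Q :=
    { top := P.top ≫ Q.top
      base := P.base ≫ Q.base
      comm := by rw [← Category.assoc, P.comm, Category.assoc, Q.comm, Category.assoc]
      equivariant := by
        rw [← Category.assoc, P.equivariant, Category.assoc, Q.equivariant, bflatMap_comp,
          Category.assoc] }
  id_comp _ := XModHom.ext (Category.id_comp _) (Category.id_comp _)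
  comp_id _ := XModHom.ext (Category.comp_id _) (Category.comp_id _)
  assoc _ _ _ := XModHom.ext (Category.assoc _ _ _) (Category.assoc _ _ _)

namespace XModHom

@[simp] theorem id_top (G : XMod C) : XModHom.top (𝟙 G) = 𝟙 G.top := rfl
@[simp] theorem id_base (G : XMod C) : XModHom.base (𝟙 G) = 𝟙 G.base := rfl
@[simp] theorem comp_top {K H G : XMod C} (P : K ⟶ H) (Q : H ⟶ G) :
    XModHom.top (P ≫ Q) = XModHom.top P ≫ XModHom.top Q := rfl
@[simp] theorem comp_base {K H G : XMod C} (P : K ⟶ H) (Q : H ⟶ G) :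
    XModHom.base (P ≫ Q) = XModHom.base P ≫ XModHom.base Q := rfl

end XModHom

namespace XMod

/-- The semi-direct product `G₁ = G ⋊ G₀`, the object of arrows of the associated groupoid. -/
noncomputable def arrows (G : XMod C) : C :=
  coequalizer (bflatι G.base G.top) (G.act ≫ coprod.inr)

noncomputable def arrowsπ (G : XMod C) : G.base ⨿ G.top ⟶ G.arrows := coequalizer.π _ _

theorem arrows_condition (G : XMod C) :
    bflatι G.base G.top ≫ G.arrowsπ = (G.act ≫ coprod.inr) ≫ G.arrowsπ :=
  coequalizer.condition _ _

noncomputable def arrowsDesc (G : XMod C) {T : C} (b : G.base ⟶ T) (t : G.top ⟶ T)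
    (h : bflatι G.base G.top ≫ coprod.desc b t = G.act ≫ t) : G.arrows ⟶ T :=
  coequalizer.desc (coprod.desc b t) (by rw [h, Category.assoc, coprod.inr_desc])

/-- The canonical injection `g : G ⟶ G₁`. -/
noncomputable def g (G : XMod C) : G.top ⟶ G.arrows := coprod.inr ≫ G.arrowsπ

/-- The identities `e : G₀ ⟶ G₁`. -/
noncomputable def e (G : XMod C) : G.base ⟶ G.arrows := coprod.inl ≫ G.arrowsπ

/-- The codomain `c : G₁ ⟶ G₀`, equal to `[1, 0]` on `G₀ + G`. -/
noncomputable def c (G : XMod C) : G.arrows ⟶ G.base :=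
  G.arrowsDesc (𝟙 _) 0 (by rw [bflatι_desc, comp_zero])

/-- The domain `d : G₁ ⟶ G₀`, equal to `[1, ∂]` on `G₀ + G`. -/
noncomputable def d (G : XMod C) : G.arrows ⟶ G.base :=
  G.arrowsDesc (𝟙 _) G.del (by
    rw [G.precrossed, conj, ← Category.assoc, bflatMap_ι, Category.assoc]
    congr 1
    ext <;> simp)

@[simp] theorem g_desc (G : XMod C) {T : C} (b : G.base ⟶ T) (t : G.top ⟶ T)
    (h : bflatι G.base G.top ≫ coprod.desc b t = G.act ≫ t) : G.g ≫ G.arrowsDesc b t h = t := by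
  simp [g, arrowsDesc, arrowsπ, arrows]

@[simp] theorem e_desc (G : XMod C) {T : C} (b : G.base ⟶ T) (t : G.top ⟶ T)
    (h : bflatι G.base G.top ≫ coprod.desc b t = G.act ≫ t) : G.e ≫ G.arrowsDesc b t h = b := by
  simp [e, arrowsDesc, arrowsπ, arrows]

theorem arrows_hom_ext (G : XMod C) {T : C} {x y : G.arrows ⟶ T} (hg : G.g ≫ x = G.g ≫ y)
    (he : G.e ≫ x = G.e ≫ y) : x = y := by
  apply coequalizer.hom_ext
  apply coprod.hom_ext
  · exact (Category.assoc _ _ _).symm.trans (he.trans (Category.assoc _ _ _))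
  · exact (Category.assoc _ _ _).symm.trans (hg.trans (Category.assoc _ _ _))

@[simp] theorem g_c (G : XMod C) : G.g ≫ G.c = 0 := g_desc _ _ _ _
@[simp] theorem g_d (G : XMod C) : G.g ≫ G.d = G.del := g_desc _ _ _ _
@[simp] theorem e_c (G : XMod C) : G.e ≫ G.c = 𝟙 _ := e_desc _ _ _ _
@[simp] theorem e_d (G : XMod C) : G.e ≫ G.d = 𝟙 _ := e_desc _ _ _ _

end XMod

namespace XModHom

/-- The morphism `q₁ : H₁ ⟶ G₁` induced by a morphism of crossed modules. -/
noncomputable def arrows {H G : XMod C} (Q : H ⟶ G) : H.arrows ⟶ G.arrows :=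
  H.arrowsDesc (XModHom.base Q ≫ G.e) (XModHom.top Q ≫ G.g) (by
    have h : coprod.desc (XModHom.base Q ≫ G.e) (XModHom.top Q ≫ G.g) =
        coprod.map (XModHom.base Q) (XModHom.top Q) ≫ G.arrowsπ := by
      ext <;> simp [XMod.e, XMod.g]
    rw [h, ← Category.assoc, ← bflatMap_ι, Category.assoc, G.arrows_condition,
      ← Category.assoc H.act, XModHom.equivariant Q]
    simp [XMod.g])

@[simp] theorem g_arrows {H G : XMod C} (Q : H ⟶ G) :
    H.g ≫ arrows Q = XModHom.top Q ≫ G.g := XMod.g_desc _ _ _ _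

@[simp] theorem e_arrows {H G : XMod C} (Q : H ⟶ G) :
    H.e ≫ arrows Q = XModHom.base Q ≫ G.e := XMod.e_desc _ _ _ _

theorem arrows_d {H G : XMod C} (Q : H ⟶ G) : arrows Q ≫ G.d = H.d ≫ XModHom.base Q := by
  apply H.arrows_hom_ext
  · rw [← Category.assoc, g_arrows, Category.assoc, XMod.g_d, ← Category.assoc, XMod.g_d,
      XModHom.comm Q]
  · rw [← Category.assoc, e_arrows, Category.assoc, XMod.e_d, ← Category.assoc, XMod.e_d,
      Category.comp_id, Category.id_comp]

theorem arrows_c {H G : XMod C} (Q : H ⟶ G) : arrows Q ≫ G.c = H.c ≫ XModHom.base Q := by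
  apply H.arrows_hom_ext
  · rw [← Category.assoc, g_arrows, Category.assoc, XMod.g_c, ← Category.assoc, XMod.g_c,
      comp_zero, zero_comp]
  · rw [← Category.assoc, e_arrows, Category.assoc, XMod.e_c, ← Category.assoc, XMod.e_c,
      Category.comp_id, Category.id_comp]

end XModHom

/-- An internal groupoid structure on the reflexive graph `d, c : G₁ ⇉ G₀`, `e : G₀ ⟶ G₁` of a
crossed module: composition `m` of composable pairs (`c` of the first is `d` of the second) and
inverses `i`. -/
@[ext] structure GroupoidStr (G : XMod C) where
  m : pullback G.c G.d ⟶ G.arrows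
  i : G.arrows ⟶ G.arrows
  m_d : m ≫ G.d = pullback.fst G.c G.d ≫ G.d
  m_c : m ≫ G.c = pullback.snd G.c G.d ≫ G.c
  e_m : ∀ {T : C} (x : T ⟶ G.arrows) (h : (x ≫ G.d ≫ G.e) ≫ G.c = x ≫ G.d),
    pullback.lift (x ≫ G.d ≫ G.e) x h ≫ m = x
  m_e : ∀ {T : C} (x : T ⟶ G.arrows) (h : x ≫ G.c = (x ≫ G.c ≫ G.e) ≫ G.d),
    pullback.lift x (x ≫ G.c ≫ G.e) h ≫ m = x
  m_assoc : ∀ {T : C} (x y z : T ⟶ G.arrows) (hxy : x ≫ G.c = y ≫ G.d) (hyz : y ≫ G.c = z ≫ G.d)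
    (h₁ : (pullback.lift x y hxy ≫ m) ≫ G.c = z ≫ G.d)
    (h₂ : x ≫ G.c = (pullback.lift y z hyz ≫ m) ≫ G.d),
    pullback.lift (pullback.lift x y hxy ≫ m) z h₁ ≫ m =
      pullback.lift x (pullback.lift y z hyz ≫ m) h₂ ≫ m
  i_d : i ≫ G.d = G.c
  i_c : i ≫ G.c = G.d
  m_i : ∀ {T : C} (x : T ⟶ G.arrows) (h : x ≫ G.c = (x ≫ i) ≫ G.d),
    pullback.lift x (x ≫ i) h ≫ m = x ≫ G.d ≫ G.e
  i_m : ∀ {T : C} (x : T ⟶ G.arrows) (h : (x ≫ i) ≫ G.c = x ≫ G.d),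
    pullback.lift (x ≫ i) x h ≫ m = x ≫ G.c ≫ G.e

namespace GroupoidStr

variable {G : XMod C} (S : GroupoidStr G)

/-- Composition of generalized arrows. -/
noncomputable def mul {T : C} (x y : T ⟶ G.arrows) (h : x ≫ G.c = y ≫ G.d) : T ⟶ G.arrows :=
  pullback.lift x y h ≫ S.m

/-- `g• = g ≫ i`. -/
noncomputable def gb : G.top ⟶ G.arrows := G.g ≫ S.i

@[simp] theorem gb_d : S.gb ≫ G.d = 0 := by rw [gb, Category.assoc, S.i_d, G.g_c]
@[simp] theorem gb_c : S.gb ≫ G.c = G.del := by rw [gb, Category.assoc, S.i_c, G.g_d]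

@[simp] theorem mul_d {T : C} (x y : T ⟶ G.arrows) (h : x ≫ G.c = y ≫ G.d) :
    S.mul x y h ≫ G.d = x ≫ G.d := by
  rw [mul, Category.assoc, S.m_d, ← Category.assoc, pullback.lift_fst]

@[simp] theorem mul_c {T : C} (x y : T ⟶ G.arrows) (h : x ≫ G.c = y ≫ G.d) :
    S.mul x y h ≫ G.c = y ≫ G.c := by
  rw [mul, Category.assoc, S.m_c, ← Category.assoc, pullback.lift_snd]

theorem comp_mul {T T' : C} (t : T' ⟶ T) (x y : T ⟶ G.arrows) (h : x ≫ G.c = y ≫ G.d) :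
    t ≫ S.mul x y h = S.mul (t ≫ x) (t ≫ y) (by simp [h]) := by
  rw [mul, mul, ← Category.assoc]
  congr 1
  apply pullback.hom_ext <;> simp

theorem mul_congr {T : C} {x x' y y' : T ⟶ G.arrows} (hx : x = x') (hy : y = y')
    (h : x ≫ G.c = y ≫ G.d) : S.mul x y h = S.mul x' y' (by rw [← hx, ← hy, h]) := by
  subst hx hy; rfl

/-- The morphism `q₁` induced by a morphism of crossed modules preserves composition. -/
theorem mul_arrows {H : XMod C} (S' : GroupoidStr H) (Q : H ⟶ G) {T : C} (x y : T ⟶ H.arrows)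
    (h : x ≫ H.c = y ≫ H.d) :
    S'.mul x y h ≫ XModHom.arrows Q = S.mul (x ≫ XModHom.arrows Q) (y ≫ XModHom.arrows Q)
      (by rw [Category.assoc, Category.assoc, XModHom.arrows_c, XModHom.arrows_d,
        ← Category.assoc, ← Category.assoc, h]) := by
  have hq : (pullback.fst H.c H.d ≫ XModHom.arrows Q) ≫ G.c =
      (pullback.snd H.c H.d ≫ XModHom.arrows Q) ≫ G.d := by
    rw [Category.assoc, Category.assoc, XModHom.arrows_c, XModHom.arrows_d,
        ← Category.assoc, ← Category.assoc, pullback.condition]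
  have key : S'.m ≫ XModHom.arrows Q =
      S.mul (pullback.fst H.c H.d ≫ XModHom.arrows Q) (pullback.snd H.c H.d ≫ XModHom.arrows Q)
        hq := by
    let s : H.arrows ⟶ pullback H.c H.d := pullback.lift (H.d ≫ H.e) (𝟙 _) (by simp)
    refine hom_ext_of_kernel_section (pullback.snd H.c H.d) s (pullback.lift_snd _ _ _) _ _ ?_ ?_
    · have hk : kernel.ι (pullback.snd H.c H.d) =
          pullback.lift (kernel.ι (pullback.snd H.c H.d) ≫ pullback.fst H.c H.d)
            ((kernel.ι (pullback.snd H.c H.d) ≫ pullback.fst H.c H.d) ≫ H.c ≫ H.e) (by simp) := by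
        apply pullback.hom_ext
        · simp
        · rw [pullback.lift_snd, kernel.condition, Category.assoc, ← Category.assoc _ H.c,
            pullback.condition, ← Category.assoc, ← Category.assoc, kernel.condition, zero_comp,
            zero_comp]
      obtain ⟨k, hk0⟩ : ∃ k, k = kernel.ι (pullback.snd H.c H.d) := ⟨_, rfl⟩
      obtain ⟨z, hz⟩ : ∃ z, z = k ≫ pullback.fst H.c H.d := ⟨_, rfl⟩
      have hk' : k = pullback.lift z (z ≫ H.c ≫ H.e) (by simp) := by
        rw [hk0]; refine hk.trans ?_; congr 1 <;> simp [hz, hk0]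
      rw [← hk0, hk', ← Category.assoc, S'.m_e, S.comp_mul]
      have h2 := S.m_e (z ≫ XModHom.arrows Q) (by simp)
      rw [← h2, mul]
      congr 1
      apply pullback.hom_ext
      · simp
      · simp only [pullback.lift_snd, pullback.lift_snd_assoc, Category.assoc, XModHom.e_arrows]
        rw [← Category.assoc (XModHom.arrows Q), XModHom.arrows_c, Category.assoc]
    · have h1 : s ≫ S'.m = 𝟙 _ := by
        refine Eq.trans ?_ (S'.e_m (𝟙 H.arrows) (by simp))
        congr 1
        apply pullback.hom_ext <;> simp [s]
      rw [← Category.assoc, h1, S.comp_mul]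
      have h2 := S.e_m (XModHom.arrows Q) (by simp)
      rw [Category.id_comp]
      refine h2.symm.trans ?_
      rw [mul]
      congr 1
      apply pullback.hom_ext
      · simp only [s, pullback.lift_fst, pullback.lift_fst_assoc, Category.assoc,
          XModHom.e_arrows]
        rw [← Category.assoc, XModHom.arrows_d, Category.assoc]
      · simp [s]
  rw [mul, Category.assoc, key, S.comp_mul]
  exact S.mul_congr (by simp) (by simp) _

end GroupoidStr

/-! ### The 2-cells of crossed modules -/

/-- A natural transformation between parallel morphisms of crossed modules. -/
@[ext] structure TwoCell {H G : XMod C} (S : GroupoidStr G) (P Q : H ⟶ G) where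
  app : H.base ⟶ G.arrows
  app_d : app ≫ G.d = XModHom.base P
  app_c : app ≫ G.c = XModHom.base Q
  nat : S.mul (H.del ≫ app) (XModHom.top Q ≫ G.g)
      (by rw [Category.assoc, app_c, XModHom.comm, Category.assoc, G.g_d]) =
    XModHom.top P ≫ G.g

namespace TwoCell

variable {K H G : XMod C} {S : GroupoidStr G}

/-- The identity natural transformation. -/
noncomputable def id (S : GroupoidStr G) (P : H ⟶ G) : TwoCell S P P where
  app := XModHom.base P ≫ G.e
  app_d := by simp
  app_c := by simp
  nat := by
    have h := S.e_m (XModHom.top P ≫ G.g) (by simp)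
    refine Eq.trans ?_ h
    rw [GroupoidStr.mul]
    congr 1
    apply pullback.hom_ext
    · simp only [pullback.lift_fst, Category.assoc]
      rw [← Category.assoc, XModHom.comm, ← Category.assoc G.g, G.g_d, Category.assoc]
    · simp

/-- Vertical composition of natural transformations. -/
noncomputable def vcomp {P Q R : H ⟶ G} (α : TwoCell S P Q) (β : TwoCell S Q R) :
    TwoCell S P R where
  app := S.mul α.app β.app (by rw [α.app_c, β.app_d])
  app_d := by rw [S.mul_d, α.app_d]
  app_c := by rw [S.mul_c, β.app_c]
  nat := by
    have hβ : (H.del ≫ β.app) ≫ G.c = (XModHom.top R ≫ G.g) ≫ G.d := by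
      rw [Category.assoc, β.app_c, XModHom.comm, Category.assoc, G.g_d]
    have hαβ : (H.del ≫ α.app) ≫ G.c = (H.del ≫ β.app) ≫ G.d := by
      rw [Category.assoc, Category.assoc, α.app_c, β.app_d]
    have h := S.m_assoc (H.del ≫ α.app) (H.del ≫ β.app) (XModHom.top R ≫ G.g) hαβ hβ
      ((S.mul_c _ _ _).trans hβ) (hαβ.trans (S.mul_d _ _ _).symm)
    refine Eq.trans (S.mul_congr (S.comp_mul _ _ _ _) rfl _) (h.trans ?_)
    exact (S.mul_congr rfl β.nat _).trans α.nat

/-- Whiskering `α : P ⟹ P'` with `Q` on the right: `PQ ⟹ P'Q`. -/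
noncomputable def whiskerRight {S' : GroupoidStr H} {P P' : K ⟶ H} (α : TwoCell S' P P')
    (S : GroupoidStr G) (Q : H ⟶ G) : TwoCell S (P ≫ Q) (P' ≫ Q) where
  app := α.app ≫ XModHom.arrows Q
  app_d := by rw [Category.assoc, XModHom.arrows_d, ← Category.assoc, α.app_d]; rfl
  app_c := by rw [Category.assoc, XModHom.arrows_c, ← Category.assoc, α.app_c]; rfl
  nat := by
    have h := α.nat =≫ XModHom.arrows Q
    rw [S.mul_arrows] at h
    refine Eq.trans (S.mul_congr ?_ ?_ _) (h.trans ?_)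
    · simp
    · simp
    · simp

/-- Whiskering `β : Q ⟹ Q'` with `P` on the left: `PQ ⟹ PQ'`. -/
noncomputable def whiskerLeft (P : K ⟶ H) {Q Q' : H ⟶ G} (β : TwoCell S Q Q') :
    TwoCell S (P ≫ Q) (P ≫ Q') where
  app := XModHom.base P ≫ β.app
  app_d := by rw [Category.assoc, β.app_d]; rfl
  app_c := by rw [Category.assoc, β.app_c]; rfl
  nat := by
    have h := XModHom.top P ≫= β.nat
    rw [S.comp_mul] at h
    refine Eq.trans (S.mul_congr ?_ ?_ _) (h.trans ?_)
    · rw [← Category.assoc, XModHom.comm, Category.assoc]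
    · simp
    · simp

end TwoCell

/-! ### Butterflies -/

/-- The diagram underlying a butterfly: a commutative diagram whose two diagonals are complexes.
The remaining conditions are in `IsButterfly`. -/
structure ButterflyDiagram (H G : XMod C) where
  X : C
  κ : H.top ⟶ X
  ι : G.top ⟶ X
  σ : X ⟶ H.base
  ρ : X ⟶ G.base
  κ_σ : κ ≫ σ = H.del
  ι_ρ : ι ≫ ρ = G.del
  κ_ρ : κ ≫ ρ = 0
  ι_σ : ι ≫ σ = 0

attribute [simp] ButterflyDiagram.κ_σ ButterflyDiagram.ι_ρ ButterflyDiagram.κ_ρ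
  ButterflyDiagram.ι_σ

/-- A butterfly from `H` to `G`. -/
structure IsButterfly {H G : XMod C} (E : ButterflyDiagram H G) : Prop where
  ι_kernel : Nonempty (IsLimit (KernelFork.ofι E.ι E.ι_σ))
  σ_cokernel : Nonempty (IsColimit (CokernelCofork.ofπ E.σ E.ι_σ))
  κ_precrossed : bflatMap E.σ (𝟙 H.top) ≫ H.act ≫ E.κ = bflatMap (𝟙 E.X) E.κ ≫ conj E.X
  ι_precrossed : bflatMap E.ρ (𝟙 G.top) ≫ G.act ≫ E.ι = bflatMap (𝟙 E.X) E.ι ≫ conj E.X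

/-- A morphism of butterflies. -/
@[ext] structure ButterflyHom {H G : XMod C} (E E' : ButterflyDiagram H G) where
  hom : E.X ⟶ E'.X
  κ_hom : E.κ ≫ hom = E'.κ
  ι_hom : E.ι ≫ hom = E'.ι
  hom_σ : hom ≫ E'.σ = E.σ
  hom_ρ : hom ≫ E'.ρ = E.ρ

attribute [simp] ButterflyHom.κ_hom ButterflyHom.ι_hom ButterflyHom.hom_σ ButterflyHom.hom_ρ

instance (H G : XMod C) : Category (ButterflyDiagram H G) where
  Hom := ButterflyHom
  id E := { hom := 𝟙 _, κ_hom := by simp, ι_hom := by simp, hom_σ := by simp, hom_ρ := by simp }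
  comp f g :=
    { hom := f.hom ≫ g.hom
      κ_hom := by rw [← Category.assoc, f.κ_hom, g.κ_hom]
      ι_hom := by rw [← Category.assoc, f.ι_hom, g.ι_hom]
      hom_σ := by rw [Category.assoc, g.hom_σ, f.hom_σ]
      hom_ρ := by rw [Category.assoc, g.hom_ρ, f.hom_ρ] }
  id_comp _ := ButterflyHom.ext (Category.id_comp _)
  comp_id _ := ButterflyHom.ext (Category.comp_id _)
  assoc _ _ _ := ButterflyHom.ext (Category.assoc _ _ _)

/-- The underlying morphism of a morphism of butterflies. -/
def und {H G : XMod C} {E E' : ButterflyDiagram H G} (f : E ⟶ E') : E.X ⟶ E'.X :=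
  ButterflyHom.hom f

namespace ButterflyDiagram

variable {L K H G : XMod C}

@[simp] theorem und_id (E : ButterflyDiagram H G) : und (𝟙 E) = 𝟙 E.X := rfl
@[simp] theorem und_comp {E E' E'' : ButterflyDiagram H G} (f : E ⟶ E') (g : E' ⟶ E'') :
    und (f ≫ g) = und f ≫ und g := rfl
@[simp] theorem κ_und {E E' : ButterflyDiagram H G} (f : E ⟶ E') : E.κ ≫ und f = E'.κ :=
  ButterflyHom.κ_hom f
@[simp] theorem ι_und {E E' : ButterflyDiagram H G} (f : E ⟶ E') : E.ι ≫ und f = E'.ι :=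
  ButterflyHom.ι_hom f
@[simp] theorem und_σ {E E' : ButterflyDiagram H G} (f : E ⟶ E') : und f ≫ E'.σ = E.σ :=
  ButterflyHom.hom_σ f
@[simp] theorem und_ρ {E E' : ButterflyDiagram H G} (f : E ⟶ E') : und f ≫ E'.ρ = E.ρ :=
  ButterflyHom.hom_ρ f
theorem und_ext {E E' : ButterflyDiagram H G} {f g : E ⟶ E'} (h : und f = und g) : f = g :=
  ButterflyHom.ext h

/-! #### Composition -/

/-- `⟨ι, κ'⟩ : G ⟶ E ×_{G₀} E'`. -/
noncomputable def mid (E : ButterflyDiagram H G) (F : ButterflyDiagram G K) :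
    G.top ⟶ pullback E.ρ F.σ :=
  pullback.lift E.ι F.κ (by simp)

/-- The composite `EF`, on the cokernel of `⟨ι, κ'⟩`. -/
noncomputable def comp (E : ButterflyDiagram H G) (F : ButterflyDiagram G K) :
    ButterflyDiagram H K where
  X := cokernel (mid E F)
  κ := pullback.lift E.κ 0 (by simp) ≫ cokernel.π (mid E F)
  ι := pullback.lift 0 F.ι (by simp) ≫ cokernel.π (mid E F)
  σ := cokernel.desc _ (pullback.fst E.ρ F.σ ≫ E.σ) (by simp [mid])
  ρ := cokernel.desc _ (pullback.snd E.ρ F.σ ≫ F.ρ) (by simp [mid])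
  κ_σ := by simp
  ι_ρ := by simp
  κ_ρ := by simp
  ι_σ := by simp

/-- The quotient morphism `q : E ×_{G₀} F ⟶ EF`. -/
noncomputable def quot (E : ButterflyDiagram H G) (F : ButterflyDiagram G K) :
    pullback E.ρ F.σ ⟶ (comp E F).X := cokernel.π (mid E F)

instance (E : ButterflyDiagram H G) (F : ButterflyDiagram G K) : Epi (quot E F) :=
  inferInstanceAs (Epi (cokernel.π (mid E F)))

@[simp] theorem quot_σ (E : ButterflyDiagram H G) (F : ButterflyDiagram G K) :
    quot E F ≫ (comp E F).σ = pullback.fst E.ρ F.σ ≫ E.σ := cokernel.π_desc _ _ _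

@[simp] theorem quot_ρ (E : ButterflyDiagram H G) (F : ButterflyDiagram G K) :
    quot E F ≫ (comp E F).ρ = pullback.snd E.ρ F.σ ≫ F.ρ := cokernel.π_desc _ _ _

theorem mid_quot (E : ButterflyDiagram H G) (F : ButterflyDiagram G K) :
    mid E F ≫ quot E F = 0 := cokernel.condition (mid E F)

noncomputable def quotDesc (E : ButterflyDiagram H G) (F : ButterflyDiagram G K) {Z : C}
    (f : pullback E.ρ F.σ ⟶ Z) (h : mid E F ≫ f = 0) : (comp E F).X ⟶ Z :=
  cokernel.desc _ f h

@[simp] theorem quot_desc (E : ButterflyDiagram H G) (F : ButterflyDiagram G K) {Z : C}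
    (f : pullback E.ρ F.σ ⟶ Z) (h : mid E F ≫ f = 0) : quot E F ≫ quotDesc E F f h = f :=
  cokernel.π_desc _ _ _

/-- The class `[x, y]` in the composite of a pair of generalized elements with `ρ x = σ' y`. -/
noncomputable def cpair (E : ButterflyDiagram H G) (F : ButterflyDiagram G K) {T : C}
    (x : T ⟶ E.X) (y : T ⟶ F.X) (h : x ≫ E.ρ = y ≫ F.σ) : T ⟶ (comp E F).X :=
  pullback.lift x y h ≫ quot E F

theorem comp_κ (E : ButterflyDiagram H G) (F : ButterflyDiagram G K) :
    (comp E F).κ = cpair E F E.κ 0 (by simp) := rfl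

theorem comp_ι (E : ButterflyDiagram H G) (F : ButterflyDiagram G K) :
    (comp E F).ι = cpair E F 0 F.ι (by simp) := rfl

@[simp] theorem cpair_σ (E : ButterflyDiagram H G) (F : ButterflyDiagram G K) {T : C}
    (x : T ⟶ E.X) (y : T ⟶ F.X) (h : x ≫ E.ρ = y ≫ F.σ) :
    cpair E F x y h ≫ (comp E F).σ = x ≫ E.σ := by
  rw [cpair, Category.assoc, quot_σ, ← Category.assoc, pullback.lift_fst]

@[simp] theorem cpair_ρ (E : ButterflyDiagram H G) (F : ButterflyDiagram G K) {T : C}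
    (x : T ⟶ E.X) (y : T ⟶ F.X) (h : x ≫ E.ρ = y ≫ F.σ) :
    cpair E F x y h ≫ (comp E F).ρ = y ≫ F.ρ := by
  rw [cpair, Category.assoc, quot_ρ, ← Category.assoc, pullback.lift_snd]

theorem cpair_congr (E : ButterflyDiagram H G) (F : ButterflyDiagram G K) {T : C}
    {x x' : T ⟶ E.X} {y y' : T ⟶ F.X} (hx : x = x') (hy : y = y') (h : x ≫ E.ρ = y ≫ F.σ) :
    cpair E F x y h = cpair E F x' y' (by rw [← hx, ← hy, h]) := by
  subst hx hy; rfl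

theorem comp_cpair (E : ButterflyDiagram H G) (F : ButterflyDiagram G K) {T T' : C} (t : T' ⟶ T)
    (x : T ⟶ E.X) (y : T ⟶ F.X) (h : x ≫ E.ρ = y ≫ F.σ) :
    t ≫ cpair E F x y h = cpair E F (t ≫ x) (t ≫ y) (by simp [h]) := by
  unfold cpair
  rw [← Category.assoc]
  congr 1
  apply pullback.hom_ext <;> simp

noncomputable def compMapX {E E' : ButterflyDiagram H G} {F F' : ButterflyDiagram G K}
    (f : E ⟶ E') (g : F ⟶ F') : (comp E F).X ⟶ (comp E' F').X :=
  quotDesc E F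
    (cpair E' F' (pullback.fst E.ρ F.σ ≫ und f) (pullback.snd E.ρ F.σ ≫ und g)
      (by simp [pullback.condition]))
    (by
      rw [comp_cpair, ← mid_quot E' F']
      refine cpair_congr E' F' ?_ ?_ _
      · simp [mid]
      · simp [mid])

theorem cpair_compMapX {E E' : ButterflyDiagram H G} {F F' : ButterflyDiagram G K}
    (f : E ⟶ E') (g : F ⟶ F') {T : C} (x : T ⟶ E.X) (y : T ⟶ F.X) (h : x ≫ E.ρ = y ≫ F.σ) :
    cpair E F x y h ≫ compMapX f g = cpair E' F' (x ≫ und f) (y ≫ und g) (by simp [h]) := by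
  rw [cpair, compMapX, Category.assoc, quot_desc, comp_cpair]
  exact cpair_congr E' F' (by simp) (by simp) _

theorem comp_hom_ext {E : ButterflyDiagram H G} {F : ButterflyDiagram G K} {Z : C}
    {f g : (comp E F).X ⟶ Z}
    (h : ∀ {T : C} (x : T ⟶ E.X) (y : T ⟶ F.X) (hxy : x ≫ E.ρ = y ≫ F.σ),
      cpair E F x y hxy ≫ f = cpair E F x y hxy ≫ g) : f = g := by
  have h0 := h (pullback.fst E.ρ F.σ) (pullback.snd E.ρ F.σ) pullback.condition
  have h1 : pullback.lift (pullback.fst E.ρ F.σ) (pullback.snd E.ρ F.σ) pullback.condition =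
      𝟙 _ := by
    apply pullback.hom_ext <;> simp
  rw [cpair, h1, Category.id_comp] at h0
  exact (cancel_epi (quot E F)).1 h0

/-- Horizontal composition of morphisms of butterflies: `[x, y] ↦ [f x, g y]`. -/
noncomputable def compMap {E E' : ButterflyDiagram H G} {F F' : ButterflyDiagram G K}
    (f : E ⟶ E') (g : F ⟶ F') : comp E F ⟶ comp E' F' :=
  ButterflyHom.mk (compMapX f g)
    (by
      rw [comp_κ, cpair_compMapX, comp_κ]
      exact cpair_congr E' F' (by simp) (by simp) _)
    (by
      rw [comp_ι, cpair_compMapX, comp_ι]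
      exact cpair_congr E' F' (by simp) (by simp) _)
    (by
      apply comp_hom_ext
      intro T x y h
      rw [← Category.assoc, cpair_compMapX]
      simp)
    (by
      apply comp_hom_ext
      intro T x y h
      rw [← Category.assoc, cpair_compMapX]
      simp)

@[simp] theorem cpair_compMap {E E' : ButterflyDiagram H G} {F F' : ButterflyDiagram G K}
    (f : E ⟶ E') (g : F ⟶ F') {T : C} (x : T ⟶ E.X) (y : T ⟶ F.X) (h : x ≫ E.ρ = y ≫ F.σ) :
    cpair E F x y h ≫ und (compMap f g) = cpair E' F' (x ≫ und f) (y ≫ und g) (by simp [h]) :=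
  cpair_compMapX ..

/-- Composition of butterflies as a functor on hom-categories. -/
noncomputable def compFunctor (H G K : XMod C) :
    ButterflyDiagram H G × ButterflyDiagram G K ⥤ ButterflyDiagram H K where
  obj EF := comp EF.1 EF.2
  map f := compMap f.1 f.2
  map_id EF := by
    apply und_ext
    apply comp_hom_ext
    intro T x y h
    refine (cpair_compMap ..).trans ?_
    rw [und_id, Category.comp_id]
    exact cpair_congr _ _ (Category.comp_id _) (Category.comp_id _) _
  map_comp f g := by
    apply und_ext
    apply comp_hom_ext
    intro T x y h
    rw [und_comp, ← Category.assoc, cpair_compMap, cpair_compMap, cpair_compMap]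
    exact cpair_congr _ _ (Category.assoc _ _ _).symm (Category.assoc _ _ _).symm _

/-! #### Identity butterfly, split butterflies, reduced composition -/

/-- The identity butterfly `I_G`, with `κ = g•`, `ι = g`, `σ = c`, `ρ = d`. -/
noncomputable abbrev idB (S : GroupoidStr G) : ButterflyDiagram G G where
  X := G.arrows
  κ := S.gb
  ι := G.g
  σ := G.c
  ρ := G.d
  κ_σ := S.gb_c
  ι_ρ := G.g_d
  κ_ρ := S.gb_d
  ι_σ := G.g_c

/-- The split butterfly `E_P` of a morphism `P : H ⟶ G`, on the pullback of `p₀` and `c`. -/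
noncomputable def split (S : GroupoidStr G) (P : H ⟶ G) : ButterflyDiagram H G where
  X := pullback (XModHom.base P) G.c
  κ := pullback.lift H.del (XModHom.top P ≫ G.g ≫ S.i)
    (by rw [Category.assoc, Category.assoc, S.i_c, G.g_d, XModHom.comm])
  ι := pullback.lift 0 G.g (by simp)
  σ := pullback.fst _ _
  ρ := pullback.snd _ _ ≫ G.d
  κ_σ := by simp
  ι_ρ := by simp
  κ_ρ := by
    rw [← Category.assoc, pullback.lift_snd, Category.assoc, Category.assoc, S.i_d, G.g_c,
      comp_zero]
  ι_σ := by simp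

/-- The generalized element `(h, a)` of `E_P`, where `p₀ h = c a`. -/
noncomputable def spair (S : GroupoidStr G) (P : H ⟶ G) {T : C} (h : T ⟶ H.base)
    (a : T ⟶ G.arrows) (w : h ≫ XModHom.base P = a ≫ G.c) : T ⟶ (split S P).X :=
  pullback.lift h a w

@[simp] theorem spair_ρ (S : GroupoidStr G) (P : H ⟶ G) {T : C} (h : T ⟶ H.base)
    (a : T ⟶ G.arrows) (w : h ≫ XModHom.base P = a ≫ G.c) :
    spair S P h a w ≫ (split S P).ρ = a ≫ G.d := by
  simp [spair, split]

/-- Reduced composition `Q ·_rc E`, on the pullback of `q₀` and `σ`. -/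
noncomputable def rc (Q : K ⟶ H) (E : ButterflyDiagram H G) : ButterflyDiagram K G where
  X := pullback (XModHom.base Q) E.σ
  κ := pullback.lift K.del (XModHom.top Q ≫ E.κ) (by rw [Category.assoc, E.κ_σ, XModHom.comm])
  ι := pullback.lift 0 E.ι (by simp)
  σ := pullback.fst _ _
  ρ := pullback.snd _ _ ≫ E.ρ
  κ_σ := by simp
  ι_ρ := by simp
  κ_ρ := by simp
  ι_σ := by simp

/-- The generalized element `(k, x)` of `Q ·_rc E`, where `q₀ k = σ x`. -/
noncomputable def rpair (Q : K ⟶ H) (E : ButterflyDiagram H G) {T : C} (k : T ⟶ K.base)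
    (x : T ⟶ E.X) (h : k ≫ XModHom.base Q = x ≫ E.σ) : T ⟶ (rc Q E).X :=
  pullback.lift k x h

/-- The projection `q' : Q ·_rc E ⟶ E`. -/
noncomputable def rcSnd (Q : K ⟶ H) (E : ButterflyDiagram H G) : (rc Q E).X ⟶ E.X :=
  pullback.snd _ _

theorem rc_condition (Q : K ⟶ H) (E : ButterflyDiagram H G) :
    (rc Q E).σ ≫ XModHom.base Q = rcSnd Q E ≫ E.σ := pullback.condition

@[simp] theorem rpair_σ (Q : K ⟶ H) (E : ButterflyDiagram H G) {T : C} (k : T ⟶ K.base)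
    (x : T ⟶ E.X) (h : k ≫ XModHom.base Q = x ≫ E.σ) : rpair Q E k x h ≫ (rc Q E).σ = k :=
  pullback.lift_fst _ _ _

@[simp] theorem rpair_snd (Q : K ⟶ H) (E : ButterflyDiagram H G) {T : C} (k : T ⟶ K.base)
    (x : T ⟶ E.X) (h : k ≫ XModHom.base Q = x ≫ E.σ) : rpair Q E k x h ≫ rcSnd Q E = x :=
  pullback.lift_snd _ _ _

theorem rc_ρ (Q : K ⟶ H) (E : ButterflyDiagram H G) : (rc Q E).ρ = rcSnd Q E ≫ E.ρ := rfl

@[simp] theorem rpair_ρ (Q : K ⟶ H) (E : ButterflyDiagram H G) {T : C} (k : T ⟶ K.base)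
    (x : T ⟶ E.X) (h : k ≫ XModHom.base Q = x ≫ E.σ) :
    rpair Q E k x h ≫ (rc Q E).ρ = x ≫ E.ρ := by
  rw [rc_ρ, ← Category.assoc, rpair_snd]

@[simp] theorem rc_κ_snd (Q : K ⟶ H) (E : ButterflyDiagram H G) :
    (rc Q E).κ ≫ rcSnd Q E = XModHom.top Q ≫ E.κ := pullback.lift_snd _ _ _

@[simp] theorem rc_ι_snd (Q : K ⟶ H) (E : ButterflyDiagram H G) :
    (rc Q E).ι ≫ rcSnd Q E = E.ι := pullback.lift_snd _ _ _

theorem rc_hom_ext {Q : K ⟶ H} {E : ButterflyDiagram H G} {T : C} {f g : T ⟶ (rc Q E).X}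
    (h₁ : f ≫ (rc Q E).σ = g ≫ (rc Q E).σ) (h₂ : f ≫ rcSnd Q E = g ≫ rcSnd Q E) : f = g :=
  pullback.hom_ext h₁ h₂

/-- The reduced composition of `Q` with the identity butterfly is the split butterfly. -/
theorem rc_idB (S : GroupoidStr H) (Q : K ⟶ H) : rc Q (idB S) = split S Q := rfl

/-- Reduced composition with `Q` on morphisms of butterflies: `(k, x) ↦ (k, f x)`. -/
noncomputable def rcMap (Q : K ⟶ H) {E E' : ButterflyDiagram H G} (f : E ⟶ E') :
    rc Q E ⟶ rc Q E' :=
  ButterflyHom.mk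
    (rpair Q E' (rc Q E).σ (rcSnd Q E ≫ und f) (by rw [Category.assoc, und_σ, rc_condition]))
    (by
      apply rc_hom_ext
      · rw [Category.assoc, rpair_σ, κ_σ, κ_σ]
      · rw [Category.assoc, rpair_snd, ← Category.assoc, rc_κ_snd, Category.assoc, κ_und,
          rc_κ_snd])
    (by
      apply rc_hom_ext
      · rw [Category.assoc, rpair_σ, ι_σ, ι_σ]
      · rw [Category.assoc, rpair_snd, ← Category.assoc, rc_ι_snd, ι_und, rc_ι_snd])
    (rpair_σ ..)
    (by rw [rpair_ρ, Category.assoc, und_ρ, rc_ρ])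

@[simp] theorem rcMap_snd (Q : K ⟶ H) {E E' : ButterflyDiagram H G} (f : E ⟶ E') :
    und (rcMap Q f) ≫ rcSnd Q E' = rcSnd Q E ≫ und f := rpair_snd ..

/-- Reduced composition with `Q` as a functor on hom-categories. -/
noncomputable def rcFunctor (Q : K ⟶ H) (G : XMod C) :
    ButterflyDiagram H G ⥤ ButterflyDiagram K G where
  obj E := rc Q E
  map f := rcMap Q f
  map_id E := by
    apply und_ext
    apply rc_hom_ext
    · simp
    · simp
  map_comp f g := by
    apply und_ext
    apply rc_hom_ext
    · simp
    · rw [rcMap_snd, und_comp, und_comp, Category.assoc, rcMap_snd, ← Category.assoc,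
        ← Category.assoc, rcMap_snd]

end ButterflyDiagram

open ButterflyDiagram

/-! ### Reduced composition as a coherent action

In the following structures `T` is an arbitrary domain of generalized elements. The displayed
values on generalized elements determine every one of the morphisms involved. -/

/-- The structural data of the bicategory of butterflies: well-definedness of its composition and
identities, its associativity isomorphism, and its unit isomorphisms. The latter are described
through the two canonical (groupoid) actions on a butterfly `E : H ⟶ G`,
`H₁ ×_{d, σ} E ⟶ E` and `E ×_{ρ, c} G₁ ⟶ E`. -/
structure ButterflyConstraints (S : ∀ G : XMod C, GroupoidStr G) where
  idB_isButterfly : ∀ G : XMod C, IsButterfly (idB (S G))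
  comp_isButterfly : ∀ {H G K : XMod C} {E : ButterflyDiagram H G} {F : ButterflyDiagram G K},
    IsButterfly E → IsButterfly F → IsButterfly (comp E F)
  /-- `(EF)F' ≅ E(FF')`, given by `[[x, y], z] ↦ [x, [y, z]]`. -/
  assoc {H G K L : XMod C} {E : ButterflyDiagram H G} {F : ButterflyDiagram G K}
    {F' : ButterflyDiagram K L} (hE : IsButterfly E) (hF : IsButterfly F)
    (hF' : IsButterfly F') : comp (comp E F) F' ≅ comp E (comp F F')
  assoc_spec : ∀ {H G K L : XMod C} {E : ButterflyDiagram H G} {F : ButterflyDiagram G K}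
    {F' : ButterflyDiagram K L} (hE : IsButterfly E) (hF : IsButterfly F) (hF' : IsButterfly F')
    {T : C} (x : T ⟶ E.X) (y : T ⟶ F.X) (z : T ⟶ F'.X)
    (hxy : x ≫ E.ρ = y ≫ F.σ) (hyz : y ≫ F.ρ = z ≫ F'.σ),
    cpair (comp E F) F' (cpair E F x y hxy) z (by simp [hyz]) ≫ und (assoc hE hF hF').hom =
      cpair E (comp F F') x (cpair F F' y z hyz) (by simp [hxy])
  /-- The action of `H₁` on `E`. -/
  lact {H G : XMod C} {E : ButterflyDiagram H G} (hE : IsButterfly E) : pullback H.d E.σ ⟶ E.X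
  lact_e : ∀ {H G : XMod C} {E : ButterflyDiagram H G} (hE : IsButterfly E),
    pullback.lift (E.σ ≫ H.e) (𝟙 E.X) (by simp) ≫ lact hE = 𝟙 E.X
  lact_κ : ∀ {H G : XMod C} {E : ButterflyDiagram H G} (hE : IsButterfly E),
    pullback.lift (S H).gb 0 (by simp) ≫ lact hE = E.κ
  /-- The action of `G₁` on `E`. -/
  ract {H G : XMod C} {E : ButterflyDiagram H G} (hE : IsButterfly E) : pullback E.ρ G.c ⟶ E.X
  ract_e : ∀ {H G : XMod C} {E : ButterflyDiagram H G} (hE : IsButterfly E),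
    pullback.lift (𝟙 E.X) (E.ρ ≫ G.e) (by simp) ≫ ract hE = 𝟙 E.X
  ract_ι : ∀ {H G : XMod C} {E : ButterflyDiagram H G} (hE : IsButterfly E),
    pullback.lift 0 G.g (by simp) ≫ ract hE = E.ι
  /-- `IE ≅ E`, given by the action of `H₁`. -/
  lunit {H G : XMod C} {E : ButterflyDiagram H G} (hE : IsButterfly E) : comp (idB (S H)) E ≅ E
  lunit_spec : ∀ {H G : XMod C} {E : ButterflyDiagram H G} (hE : IsButterfly E)
    {T : C} (a : T ⟶ H.arrows) (x : T ⟶ E.X) (h : a ≫ H.d = x ≫ E.σ),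
    cpair (idB (S H)) E a x h ≫ und (lunit hE).hom = pullback.lift a x h ≫ lact hE
  /-- `EI ≅ E`, given by the action of `G₁`. -/
  runit {H G : XMod C} {E : ButterflyDiagram H G} (hE : IsButterfly E) : comp E (idB (S G)) ≅ E
  runit_spec : ∀ {H G : XMod C} {E : ButterflyDiagram H G} (hE : IsButterfly E)
    {T : C} (x : T ⟶ E.X) (a : T ⟶ G.arrows) (h : x ≫ E.ρ = a ≫ G.c),
    cpair E (idB (S G)) x a h ≫ und (runit hE).hom = pullback.lift x a h ≫ ract hE

/-- Reduced composition is well defined on butterflies, is functorial in both variables on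
hom-categories, agrees with composition with split butterflies, and is a coherent left action. -/
structure ReducedCompositionAction (S : ∀ G : XMod C, GroupoidStr G)
    extends ButterflyConstraints S where
  rc_isButterfly : ∀ {K H G : XMod C} (Q : K ⟶ H) {E : ButterflyDiagram H G},
    IsButterfly E → IsButterfly (rc Q E)
  split_isButterfly : ∀ {K H : XMod C} (Q : K ⟶ H), IsButterfly (split (S H) Q)
  /-- The action on natural transformations `α : P ⟹ Q`, given by `(k, x) ↦ (k, α(k) · x)`. -/
  rcTwoCell {K H G : XMod C} {P Q : K ⟶ H} (α : TwoCell (S H) P Q) {E : ButterflyDiagram H G}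
    (hE : IsButterfly E) : rc P E ⟶ rc Q E
  rcTwoCell_spec : ∀ {K H G : XMod C} {P Q : K ⟶ H} (α : TwoCell (S H) P Q)
    {E : ButterflyDiagram H G} (hE : IsButterfly E),
    und (rcTwoCell α hE) ≫ rcSnd Q E =
      pullback.lift ((rc P E).σ ≫ α.app) (rcSnd P E)
        (by rw [Category.assoc, α.app_d, rc_condition]) ≫ lact hE
  rcTwoCell_id : ∀ {K H G : XMod C} (Q : K ⟶ H) {E : ButterflyDiagram H G} (hE : IsButterfly E),
    rcTwoCell (TwoCell.id (S H) Q) hE = 𝟙 (rc Q E)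
  rcTwoCell_vcomp : ∀ {K H G : XMod C} {P Q R : K ⟶ H} (α : TwoCell (S H) P Q)
    (β : TwoCell (S H) Q R) {E : ButterflyDiagram H G} (hE : IsButterfly E),
    rcTwoCell (α.vcomp β) hE = rcTwoCell α hE ≫ rcTwoCell β hE
  rcTwoCell_naturality : ∀ {K H G : XMod C} {P Q : K ⟶ H} (α : TwoCell (S H) P Q)
    {E E' : ButterflyDiagram H G} (hE : IsButterfly E) (hE' : IsButterfly E') (f : E ⟶ E'),
    rcTwoCell α hE ≫ rcMap Q f = rcMap P f ≫ rcTwoCell α hE'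
  /-- A1: `Q ·_rc EF ≅ (Q ·_rc E)F`, given by `(k, [x, y]) ↦ [(k, x), y]`. -/
  a1 {K H G L : XMod C} (Q : K ⟶ H) {E : ButterflyDiagram H G} {F : ButterflyDiagram G L}
    (hE : IsButterfly E) (hF : IsButterfly F) : rc Q (comp E F) ≅ comp (rc Q E) F
  a1_spec : ∀ {K H G L : XMod C} (Q : K ⟶ H) {E : ButterflyDiagram H G}
    {F : ButterflyDiagram G L} (hE : IsButterfly E) (hF : IsButterfly F)
    {T : C} (k : T ⟶ K.base) (x : T ⟶ E.X) (y : T ⟶ F.X)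
    (hkx : k ≫ XModHom.base Q = x ≫ E.σ) (hxy : x ≫ E.ρ = y ≫ F.σ),
    rpair Q (comp E F) k (cpair E F x y hxy) (by simp [hkx]) ≫ und (a1 Q hE hF).hom =
      cpair (rc Q E) F (rpair Q E k x hkx) y (by simp [hxy])
  /-- A2: `PQ ·_rc E ≅ P ·_rc (Q ·_rc E)`, given by `(l, x) ↦ (l, (p₀ l, x))`. -/
  a2 {L K H G : XMod C} (P : L ⟶ K) (Q : K ⟶ H) {E : ButterflyDiagram H G}
    (hE : IsButterfly E) : rc (P ≫ Q) E ≅ rc P (rc Q E)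
  a2_spec : ∀ {L K H G : XMod C} (P : L ⟶ K) (Q : K ⟶ H) {E : ButterflyDiagram H G}
    (hE : IsButterfly E) {T : C} (l : T ⟶ L.base) (x : T ⟶ E.X)
    (h : l ≫ XModHom.base (P ≫ Q) = x ≫ E.σ),
    rpair (P ≫ Q) E l x h ≫ und (a2 P Q hE).hom =
      rpair P (rc Q E) l (rpair Q E (l ≫ XModHom.base P) x (by simpa using h)) (by simp)
  /-- A3: `I ·_rc E ≅ E`, given by `(h, x) ↦ x`. -/
  a3 {H G : XMod C} {E : ButterflyDiagram H G} (hE : IsButterfly E) : rc (𝟙 H) E ≅ E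
  a3_spec : ∀ {H G : XMod C} {E : ButterflyDiagram H G} (hE : IsButterfly E),
    und (a3 hE).hom = rcSnd (𝟙 H) E
  a1_naturality : ∀ {K H G L : XMod C} {Q Q' : K ⟶ H} (α : TwoCell (S H) Q Q')
    {E E' : ButterflyDiagram H G} {F F' : ButterflyDiagram G L}
    (hE : IsButterfly E) (hE' : IsButterfly E') (hF : IsButterfly F) (hF' : IsButterfly F')
    (f : E ⟶ E') (g : F ⟶ F'),
    (rcTwoCell α (comp_isButterfly hE hF) ≫ rcMap Q' (compMap f g)) ≫ (a1 Q' hE' hF').hom =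
      (a1 Q hE hF).hom ≫ compMap (rcTwoCell α hE ≫ rcMap Q' f) g
  a2_naturality : ∀ {L K H G : XMod C} {P P' : L ⟶ K} (α : TwoCell (S K) P P')
    {Q Q' : K ⟶ H} (β : TwoCell (S H) Q Q') {E E' : ButterflyDiagram H G}
    (hE : IsButterfly E) (hE' : IsButterfly E') (f : E ⟶ E'),
    (rcTwoCell ((α.whiskerRight (S H) Q).vcomp (TwoCell.whiskerLeft P' β)) hE ≫
        rcMap (P' ≫ Q') f) ≫ (a2 P' Q' hE').hom =
      (a2 P Q hE).hom ≫ rcTwoCell α (rc_isButterfly Q hE) ≫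
        rcMap P' (rcTwoCell β hE ≫ rcMap Q' f)
  a3_naturality : ∀ {H G : XMod C} {E E' : ButterflyDiagram H G} (hE : IsButterfly E)
    (hE' : IsButterfly E') (f : E ⟶ E'), rcMap (𝟙 H) f ≫ (a3 hE').hom = (a3 hE).hom ≫ f
  /-- Coherence of A2 with itself. -/
  a2_a2 : ∀ {M L K H G : XMod C} (P : M ⟶ L) (Q : L ⟶ K) (R : K ⟶ H) {E : ButterflyDiagram H G}
    (hE : IsButterfly E),
    (a2 (P ≫ Q) R hE).hom ≫ (a2 P Q (rc_isButterfly R hE)).hom =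
      eqToHom (congrArg (fun N => rc N E) (Category.assoc P Q R)) ≫
        (a2 P (Q ≫ R) hE).hom ≫ rcMap P (a2 Q R hE).hom
  /-- Coherence of A2 with A3. -/
  a2_a3 : ∀ {K H G : XMod C} (Q : K ⟶ H) {E : ButterflyDiagram H G} (hE : IsButterfly E),
    (a2 (𝟙 K) Q hE).hom ≫ (a3 (rc_isButterfly Q hE)).hom =
      eqToHom (congrArg (fun N => rc N E) (Category.id_comp Q))
  a3_a2 : ∀ {K H G : XMod C} (Q : K ⟶ H) {E : ButterflyDiagram H G} (hE : IsButterfly E),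
    (a2 Q (𝟙 H) hE).hom ≫ rcMap Q (a3 hE).hom =
      eqToHom (congrArg (fun N => rc N E) (Category.comp_id Q))
  /-- Coherence of A1 with A2. -/
  a1_a2 : ∀ {L K H G M : XMod C} (P : L ⟶ K) (Q : K ⟶ H) {E : ButterflyDiagram H G}
    {F : ButterflyDiagram G M} (hE : IsButterfly E) (hF : IsButterfly F),
    (a2 P Q (comp_isButterfly hE hF)).hom ≫ rcMap P (a1 Q hE hF).hom ≫
        (a1 P (rc_isButterfly Q hE) hF).hom =
      (a1 (P ≫ Q) hE hF).hom ≫ compMap (a2 P Q hE).hom (𝟙 F)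
  /-- Coherence of A1 with A3. -/
  a1_a3 : ∀ {H G L : XMod C} {E : ButterflyDiagram H G} {F : ButterflyDiagram G L}
    (hE : IsButterfly E) (hF : IsButterfly F),
    (a1 (𝟙 H) hE hF).hom ≫ compMap (a3 hE).hom (𝟙 F) = (a3 (comp_isButterfly hE hF)).hom
  /-- Coherence of A1 with the associativity of butterflies. -/
  a1_assoc : ∀ {K H G L M : XMod C} (Q : K ⟶ H) {E : ButterflyDiagram H G}
    {F : ButterflyDiagram G L} {F' : ButterflyDiagram L M} (hE : IsButterfly E)
    (hF : IsButterfly F) (hF' : IsButterfly F'),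
    rcMap Q (assoc hE hF hF').hom ≫ (a1 Q hE (comp_isButterfly hF hF')).hom =
      (a1 Q (comp_isButterfly hE hF) hF').hom ≫ compMap (a1 Q hE hF).hom (𝟙 F') ≫
        (assoc (rc_isButterfly Q hE) hF hF').hom
  /-- Coherence of A1 with the right unit of butterflies. -/
  a1_runit : ∀ {K H G : XMod C} (Q : K ⟶ H) {E : ButterflyDiagram H G} (hE : IsButterfly E),
    (a1 Q hE (idB_isButterfly G)).hom ≫ (runit (rc_isButterfly Q hE)).hom =
      rcMap Q (runit hE).hom
  /-- Agreement with composition: `E_Q E ≅ Q ·_rc E`, given by `[(k, a), x] ↦ (k, a · x)`. -/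
  agree {K H G : XMod C} (Q : K ⟶ H) {E : ButterflyDiagram H G} (hE : IsButterfly E) :
    comp (split (S H) Q) E ≅ rc Q E
  agree_spec : ∀ {K H G : XMod C} (Q : K ⟶ H) {E : ButterflyDiagram H G} (hE : IsButterfly E)
    {T : C} (k : T ⟶ K.base) (a : T ⟶ H.arrows) (x : T ⟶ E.X)
    (hka : k ≫ XModHom.base Q = a ≫ H.c) (hax : a ≫ H.d = x ≫ E.σ),
    cpair (split (S H) Q) E (spair (S H) Q k a hka) x (by rw [spair_ρ, hax]) ≫
      und (agree Q hE).hom ≫ rcSnd Q E = pullback.lift a x hax ≫ lact hE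
  agree_naturality : ∀ {K H G : XMod C} {Q Q' : K ⟶ H} (α : TwoCell (S H) Q Q')
    {E E' : ButterflyDiagram H G} (hE : IsButterfly E) (hE' : IsButterfly E') (f : E ⟶ E'),
    (agree Q hE).hom ≫ rcTwoCell α hE ≫ rcMap Q' f =
      compMap (eqToHom (rc_idB (S H) Q).symm ≫ rcTwoCell α (idB_isButterfly H) ≫
        eqToHom (rc_idB (S H) Q')) f ≫ (agree Q' hE').hom
  /-- Coherence of the agreement with A1 and the left unit of butterflies. -/
  a1_agree : ∀ {K H G : XMod C} (Q : K ⟶ H) {E : ButterflyDiagram H G} (hE : IsButterfly E),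
    (a1 Q (idB_isButterfly H) hE).hom ≫ compMap (eqToHom (rc_idB (S H) Q)) (𝟙 E) ≫
      (agree Q hE).hom = rcMap Q (lunit hE).hom

end InternalButterfly

open InternalButterfly

/-!
The proof is a calculus of generalized elements in a semi-abelian category. Three facts make it
work: a morphism out of a split epimorphism is determined by its restrictions to the section and to
the kernel, a generalized element lifts through a monomorphism as soon as it does so on a regular
cover (`exists_lift_of_cover`), and every reflexive relation is an effective equivalence relation.

*The groupoid of a crossed module.* By the Peiffer condition `(1, 1)` extends to a composition
`ς` of arrows `x` of `G₁` with elements `y` of `G`, regarded as arrows into `0`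
(`exists_star_multiplication`). Shearing by `ς` is invertible, which gives a division morphism
`δ : G × G ⟶ G₁` (`exists_division`). It restricts to `g = ker c` on the second factor and to a
kernel `g•` of `d` on the first, so the normalizations of the kernel pairs of `c` and `d` cooperate
(`exists_cooperator`, `cooperate_normalizations`), and by "Huq = Smith" the kernel pairs
commute. The connector gives the composition `m` (`exists_multiplication`). A unital composition is
automatically associative with inverses, and unique, because morphisms out of pullbacks along `c`
or `d` are determined on identities and on the kernel (`exists_groupoidStr_of_unital`,
`nonempty_unique_groupoidStr`).

*Butterflies as bimodules.* The two equivariance conditions on a butterfly `E : H ⟶ G` say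
exactly that `(1, κ)` and `(1, ι)` extend to groupoid actions of `H₁` and `G₁` on `E`; conversely,
two such actions together with `ι = ker σ` and a regular epimorphism `σ` make a diagram a butterfly
(`IsButterfly.of_kernel_of_actions`). Since `E` is a torsor under `G₁` over `H₀`
(`IsButterfly.shear_isIso`), every morphism of butterflies is invertible
(`IsButterfly.isIso_und`), so each structural isomorphism need only be constructed as a
morphism of butterflies, in whichever direction is convenient.

*Composites.* The orbit relation of the diagonal action of `G₁` on `E ×_{G₀} F` is reflexive,
hence effective, with `⟨ι, κ'⟩` as its class of zero; therefore `⟨ι, κ'⟩` is the kernel of its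
cokernel (`IsButterfly.exists_lift_mid`) and formulas on representatives `(x, y)` descend to `EF`,
even after pullback (`IsButterfly.exists_desc_cpair`). This produces the actions on `EF` and the
associativity isomorphism. The remaining constraints are given by explicit formulas, and all
naturality and coherence conditions are comparisons of their values on generalized elements.
-/

namespace InternalButterfly

attribute [local simp] pullback.lift_fst pullback.lift_snd pullback.lift_fst_assoc
  pullback.lift_snd_assoc prod.lift_fst prod.lift_snd prod.lift_fst_assoc prod.lift_snd_assoc
  coprod.inl_desc coprod.inr_desc coprod.inl_desc_assoc coprod.inr_desc_assoc

/-! ### Exactness in semi-abelian categories -/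

section Exactness

/-- A generalized element lifts through a monomorphism if it does so on a regular cover. -/
theorem exists_lift_of_cover {C : Type u} [Category.{v} C] {T' T K X : C} (p : T' ⟶ T)
    [IsRegularEpi p] (m : K ⟶ X) [Mono m] (z : T ⟶ X) (w : T' ⟶ K) (h : p ≫ z = w ≫ m) :
    ∃ l : T ⟶ K, l ≫ m = z :=
  have sq : CommSq w p m z := ⟨h.symm⟩
  ⟨sq.lift, sq.fac_right⟩

variable {C : Type u} [Category.{v} C] [HasZeroMorphisms C] [SemiAbelian C]

/-- Two morphisms out of a split epimorphism agree as soon as they agree on the section and on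
generalized elements of the kernel. -/
theorem hom_ext_of_section_of_kernel_elements {A B T : C} (p : A ⟶ B) (s : B ⟶ A)
    (hs : s ≫ p = 𝟙 B) {x y : A ⟶ T} (h₁ : s ≫ x = s ≫ y)
    (h₂ : ∀ {U : C} (t : U ⟶ A), t ≫ p = 0 → t ≫ x = t ≫ y) : x = y :=
  hom_ext_of_kernel_section p s hs x y (h₂ _ (kernel.condition p)) h₁

theorem mono_of_kernel_elements {X Y : C} (f : X ⟶ Y)
    (h : ∀ {U : C} (t : U ⟶ X), t ≫ f = 0 → t = 0) : Mono f := by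
  have key : pullback.fst f f = pullback.snd f f := by
    refine hom_ext_of_section_of_kernel_elements (pullback.fst f f)
      (pullback.lift (𝟙 X) (𝟙 X) rfl) (pullback.lift_fst _ _ _) (by simp) ?_
    intro U t ht
    rw [ht, h (t ≫ pullback.snd f f)]
    rw [Category.assoc, ← pullback.condition, ← Category.assoc, ht, zero_comp]
  constructor
  intro T x y hxy
  have := pullback.lift x y hxy ≫= key
  simpa using this

/-- A morphism vanishing on the kernel of a regular epimorphism descends along it. -/
theorem exists_desc_of_isRegularEpi {X Y Z : C} (f : X ⟶ Y) [IsRegularEpi f] (h : X ⟶ Z)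
    (hk : ∀ {U : C} (t : U ⟶ X), t ≫ f = 0 → t ≫ h = 0) : ∃ h' : Y ⟶ Z, f ≫ h' = h := by
  have key : pullback.fst f f ≫ h = pullback.snd f f ≫ h := by
    refine hom_ext_of_section_of_kernel_elements (pullback.fst f f)
      (pullback.lift (𝟙 X) (𝟙 X) rfl) (pullback.lift_fst _ _ _) (by simp) ?_
    intro U t ht
    rw [← Category.assoc, ht, zero_comp, ← Category.assoc, hk]
    rw [Category.assoc, ← pullback.condition, ← Category.assoc, ht, zero_comp]
  refine ⟨IsRegularEpi.desc f h ?_, IsRegularEpi.fac f h _⟩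
  have := pullback.lift (IsRegularEpi.left f) (IsRegularEpi.right f) (IsRegularEpi.w f) ≫= key
  simpa using this

theorem isRegularEpi_of_strongEpi {X Y : C} (f : X ⟶ Y) [StrongEpi f] : IsRegularEpi f :=
  inferInstance

/-- A morphism is a regular epimorphism if each monomorphism through which it factors is
invertible. -/
theorem isRegularEpi_of_factors {X Y : C} (f : X ⟶ Y)
    (h : ∀ {N : C} (n : N ⟶ Y) [Mono n] (e : X ⟶ N), e ≫ n = f → IsIso n) : IsRegularEpi f := by
  let F := Regular.strongEpiMonoFactorisation f
  have : IsIso F.m := h F.m F.e F.fac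
  have : StrongEpi F.e := F.e_strong_epi
  have : StrongEpi f := by
    rw [← F.fac]
    infer_instance
  exact isRegularEpi_of_strongEpi f

theorem isRegularEpi_comp {X Y Z : C} (f : X ⟶ Y) (g : Y ⟶ Z) [IsRegularEpi f]
    [IsRegularEpi g] : IsRegularEpi (f ≫ g) := by
  have : StrongEpi (f ≫ g) := strongEpi_comp f g
  exact isRegularEpi_of_strongEpi _

theorem isRegularEpi_of_comp {X Y Z : C} (f : X ⟶ Y) (g : Y ⟶ Z) [IsRegularEpi (f ≫ g)] :
    IsRegularEpi g := by
  have : StrongEpi g := strongEpi_of_strongEpi f g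
  exact isRegularEpi_of_strongEpi _

/-- Generalized elements of the target of a regular epimorphism lift on a regular cover. -/
theorem exists_cover {X Y T : C} (f : X ⟶ Y) [IsRegularEpi f] (z : T ⟶ Y) :
    ∃ (T' : C) (p : T' ⟶ T) (_ : IsRegularEpi p) (x : T' ⟶ X), p ≫ z = x ≫ f :=
  ⟨pullback z f, pullback.fst z f, inferInstance, pullback.snd z f, pullback.condition⟩

theorem isIso_of_section_of_kernel_elements {A B N : C} (p : A ⟶ B) (s : B ⟶ A)
    (hs : s ≫ p = 𝟙 B) (n : N ⟶ A) [Mono n] (hb : ∃ b : B ⟶ N, b ≫ n = s)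
    (hk : ∀ {U : C} (t : U ⟶ A), t ≫ p = 0 → ∃ a : U ⟶ N, a ≫ n = t) : IsIso n := by
  obtain ⟨b, hb⟩ := hb
  obtain ⟨a, ha⟩ := hk _ (kernel.condition p)
  exact isIso_of_factors p s hs n a ha b hb

theorem prod_hom_ext_axes {A B T : C} {x y : A ⨯ B ⟶ T}
    (h₁ : prod.lift (𝟙 A) 0 ≫ x = prod.lift (𝟙 A) 0 ≫ y)
    (h₂ : prod.lift 0 (𝟙 B) ≫ x = prod.lift 0 (𝟙 B) ≫ y) : x = y := by
  refine hom_ext_of_section_of_kernel_elements prod.fst (prod.lift (𝟙 A) 0) (by simp) h₁ ?_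
  intro U t ht
  have : t = (t ≫ prod.snd) ≫ prod.lift 0 (𝟙 B) := by
    apply prod.hom_ext <;> simp [ht]
  rw [this, Category.assoc, h₂, Category.assoc, Category.assoc, Category.assoc]

end Exactness

/-! ### Semi-direct products -/

section SemidirectProduct

variable {C : Type u} [Category.{v} C] [HasZeroMorphisms C] [SemiAbelian C]

theorem exists_lift_bflat {T B A : C} (t : T ⟶ B ⨿ A)
    (h : t ≫ coprod.desc (𝟙 B) (0 : A ⟶ B) = 0) : ∃ t' : T ⟶ bflat B A, t' ≫ bflatι B A = t :=
  ⟨bflatLift t h, bflatLift_ι t h⟩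

/-- The universal property of a split epimorphism `p` with kernel `k`: morphisms out of it are
the pairs of morphisms on section and kernel which are equivariant for the induced action `ξ`. -/
theorem exists_desc_of_equivariant {P B X Z : C} (p : P ⟶ B) (s : B ⟶ P) (hs : s ≫ p = 𝟙 B)
    (k : X ⟶ P) [Mono k] (hk : k ≫ p = 0)
    (hlift : ∀ {U : C} (t : U ⟶ P), t ≫ p = 0 → ∃ t' : U ⟶ X, t' ≫ k = t)
    (ξ : bflat B X ⟶ X) (hξ : bflatι B X ≫ coprod.desc s k = ξ ≫ k)
    (b : B ⟶ Z) (x : X ⟶ Z) (h : bflatι B X ≫ coprod.desc b x = ξ ≫ x) :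
    ∃ φ : P ⟶ Z, s ≫ φ = b ∧ k ≫ φ = x := by
  have : IsRegularEpi (coprod.desc s k) := by
    refine isRegularEpi_of_factors _ (fun {N} n _ e he => ?_)
    refine isIso_of_section_of_kernel_elements p s hs n ⟨coprod.inl ≫ e, ?_⟩ ?_
    · rw [Category.assoc, he, coprod.inl_desc]
    · intro U t ht
      obtain ⟨t', rfl⟩ := hlift t ht
      exact ⟨t' ≫ coprod.inr ≫ e, by rw [Category.assoc, Category.assoc, he, coprod.inr_desc]⟩
  have hp : coprod.desc s k ≫ p = coprod.desc (𝟙 B) 0 := by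
    ext <;> simp [hs, hk]
  obtain ⟨φ, hφ⟩ := exists_desc_of_isRegularEpi (coprod.desc s k) (coprod.desc b x) (by
    intro U t ht
    obtain ⟨t', rfl⟩ := exists_lift_bflat t (by rw [← hp, ← Category.assoc, ht, zero_comp])
    have h0 : t' ≫ ξ = 0 := by
      rw [← cancel_mono k, Category.assoc, ← hξ, ← Category.assoc, ht, zero_comp]
    rw [Category.assoc, h, ← Category.assoc, h0, zero_comp])
  refine ⟨φ, ?_, ?_⟩
  · simpa using coprod.inl ≫= hφ
  · simpa using coprod.inr ≫= hφ

namespace XMod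

/-- The congruence on `G₀ + G` generated by the action has `0`-class `ker ξ ⊆ G₀ ♭ G`: this is
where the algebra axioms of the action enter. Since `ξ` retracts the unit `G ⟶ G₀ ♭ G`, the
quotient is injective on `G`. -/
instance g_mono (G : XMod C) : Mono G.g := by
  -- `r` and `l` are the two projections of the congruence, presented on `G₀ + (G₀ ♭ G)`.
  let l : G.base ⨿ bflat G.base G.top ⟶ G.base ⨿ G.top := coprod.desc coprod.inl (bflatι _ _)
  let r : G.base ⨿ bflat G.base G.top ⟶ G.base ⨿ G.top := coprod.map (𝟙 _) G.act
  let F := Regular.strongEpiMonoFactorisation (prod.lift l r)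
  have hF₁ : F.e ≫ F.m ≫ prod.fst = l := by rw [← Category.assoc, F.fac, prod.lift_fst]
  have hF₂ : F.e ≫ F.m ≫ prod.snd = r := by rw [← Category.assoc, F.fac, prod.lift_snd]
  have hl : coprod.map (𝟙 _) (bflatUnit _ _) ≫ l = 𝟙 _ := by
    ext <;> simp [l, bflatUnit]
  have hr : coprod.map (𝟙 _) (bflatUnit _ _) ≫ r = 𝟙 _ := by
    ext <;> simp [r, G.act_unit]
  have hequiv : IsEquivalenceRelation (F.m ≫ prod.fst) (F.m ≫ prod.snd) := by
    refine isEquivalenceRelation_of_reflexive _ _ ?_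
      (coprod.map (𝟙 _) (bflatUnit _ _) ≫ F.e) ?_ ?_
    · intro T a b ha hb
      rw [← cancel_mono F.m]
      ext
      · simpa using ha
      · simpa using hb
    · rw [Category.assoc, hF₁, hl]
    · rw [Category.assoc, hF₂, hr]
  obtain ⟨Y, q, hq⟩ := SemiAbelian.effective _ _ hequiv
  have hlr : l ≫ q = r ≫ q := by
    have h := F.e ≫= hq.w
    have h₁ := hF₁ =≫ q
    have h₂ := hF₂ =≫ q
    simp only [Category.assoc] at h h₁ h₂
    rw [← h₁, ← h₂, h]
  have hqq : bflatι G.base G.top ≫ q = (G.act ≫ coprod.inr) ≫ q := by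
    simpa [l, r] using coprod.inr ≫= hlr
  have hgq : G.g ≫ G.arrowsDesc (coprod.inl ≫ q) (coprod.inr ≫ q) (by
      rw [← coprod.desc_comp, coprod.desc_inl_inr, Category.id_comp, hqq, Category.assoc]) =
      coprod.inr ≫ q := g_desc ..
  have : StrongEpi F.e := F.e_strong_epi
  have : IsRegularEpi F.e := isRegularEpi_of_strongEpi _
  apply mono_of_kernel_elements
  intro U t ht
  have htq : (t ≫ coprod.inr) ≫ q = (0 : U ⟶ _) ≫ q := by
    rw [Category.assoc, ← hgq, ← Category.assoc, ht, zero_comp, zero_comp]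
  obtain ⟨U', p, hp, y, hy⟩ := exists_cover F.e (hq.lift _ _ htq)
  have hy₁ : y ≫ l = p ≫ t ≫ coprod.inr := by
    rw [← hF₁, ← Category.assoc, ← hy, Category.assoc, hq.lift_fst]
  have hy₂ : y ≫ r = 0 := by
    rw [← hF₂, ← Category.assoc, ← hy, Category.assoc, hq.lift_snd, comp_zero]
  obtain ⟨z, rfl⟩ := exists_lift_bflat y (by
    have : coprod.desc (𝟙 G.base) (0 : bflat G.base G.top ⟶ G.base) =
        r ≫ coprod.desc (𝟙 G.base) 0 := by ext <;> simp [r]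
    rw [this, ← Category.assoc, hy₂, zero_comp])
  have hz₁ : z ≫ bflatMult _ _ = (p ≫ t) ≫ bflatUnit _ _ := by
    apply bflat_hom_ext
    rw [Category.assoc, bflatMult, bflatLift_ι, ← Category.assoc, hy₁, Category.assoc,
      bflatUnit, bflatLift_ι, Category.assoc]
  have hz₂ : z ≫ bflatMap (𝟙 _) G.act = 0 := by
    apply bflat_hom_ext
    rw [Category.assoc, bflatMap_ι, ← Category.assoc, hy₂, zero_comp]
  rw [← cancel_epi p, comp_zero]
  rw [← Category.comp_id (p ≫ t), ← G.act_unit, ← Category.assoc, ← hz₁, Category.assoc,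
    G.act_mult, ← Category.assoc, hz₂, zero_comp]

/-- `g` is the kernel of `c`. -/
theorem exists_lift_g (G : XMod C) {T : C} (t : T ⟶ G.arrows) (ht : t ≫ G.c = 0) :
    ∃ y : T ⟶ G.top, y ≫ G.g = t := by
  have : IsRegularEpi G.arrowsπ :=
    inferInstanceAs (IsRegularEpi (coequalizer.π (bflatι G.base G.top) (G.act ≫ coprod.inr)))
  obtain ⟨T', p, hp, z, hz⟩ := exists_cover G.arrowsπ t
  have hc : G.arrowsπ ≫ G.c = coprod.desc (𝟙 _) 0 := coequalizer.π_desc _ _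
  obtain ⟨w, rfl⟩ := exists_lift_bflat z (by
    rw [← hc, ← Category.assoc, ← hz, Category.assoc, ht, comp_zero])
  refine exists_lift_of_cover p G.g t (w ≫ G.act) ?_
  rw [hz, Category.assoc, G.arrows_condition, g, Category.assoc, Category.assoc]

theorem bflatι_desc_e_g (G : XMod C) :
    bflatι G.base G.top ≫ coprod.desc G.e G.g = G.act ≫ G.g := by
  have : coprod.desc G.e G.g = G.arrowsπ := by ext <;> simp [e, g]
  rw [this, arrows_condition, Category.assoc, g]

variable (G : XMod C) {X Z : C} (r : X ⟶ G.base)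

/-- Morphisms out of the semi-direct product `X ×_{G₀} G₁`, the pullback along `r : X ⟶ G₀` of
the split epimorphism `c`, are determined by their restrictions to `X` and to `G`. -/
theorem pullback_c_hom_ext {x y : pullback r G.c ⟶ Z}
    (h₁ : pullback.lift (𝟙 X) (r ≫ G.e) (by simp) ≫ x =
      pullback.lift (𝟙 X) (r ≫ G.e) (by simp) ≫ y)
    (h₂ : pullback.lift 0 G.g (by simp) ≫ x = pullback.lift 0 G.g (by simp) ≫ y) : x = y := by
  refine hom_ext_of_section_of_kernel_elements (pullback.fst r G.c) _ (by simp) h₁ ?_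
  intro U t ht
  obtain ⟨w, hw⟩ := G.exists_lift_g (t ≫ pullback.snd r G.c) (by
    rw [Category.assoc, ← pullback.condition, ← Category.assoc, ht, zero_comp])
  have : t = w ≫ pullback.lift 0 G.g (by simp) := by
    apply pullback.hom_ext <;> simp [ht, hw]
  rw [this, Category.assoc, h₂, Category.assoc]

/-- The same with the factors of the pullback interchanged. -/
theorem pullback_c_hom_ext' {x y : pullback G.c r ⟶ Z}
    (h₁ : pullback.lift (r ≫ G.e) (𝟙 X) (by simp) ≫ x =
      pullback.lift (r ≫ G.e) (𝟙 X) (by simp) ≫ y)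
    (h₂ : pullback.lift G.g 0 (by simp) ≫ x = pullback.lift G.g 0 (by simp) ≫ y) : x = y := by
  refine hom_ext_of_section_of_kernel_elements (pullback.snd G.c r) _ (by simp) h₁ ?_
  intro U t ht
  obtain ⟨w, hw⟩ := G.exists_lift_g (t ≫ pullback.fst G.c r) (by
    rw [Category.assoc, pullback.condition, ← Category.assoc, ht, zero_comp])
  have : t = w ≫ pullback.lift G.g 0 (by simp) := by
    apply pullback.hom_ext <;> simp [ht, hw]
  rw [this, Category.assoc, h₂, Category.assoc]

theorem bflatι_desc_pullback_c :
    bflatι X G.top ≫ coprod.desc (pullback.lift (𝟙 X) (r ≫ G.e) (by simp))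
        (pullback.lift 0 G.g (by simp) : G.top ⟶ pullback r G.c) =
      (bflatMap r (𝟙 _) ≫ G.act) ≫ pullback.lift 0 G.g (by simp) := by
  apply pullback.hom_ext
  · have : coprod.desc (pullback.lift (𝟙 X) (r ≫ G.e) (by simp))
        (pullback.lift 0 G.g (by simp) : G.top ⟶ pullback r G.c) ≫ pullback.fst r G.c =
        coprod.desc (𝟙 _) 0 := by ext <;> simp
    rw [Category.assoc, this, bflatι_desc, Category.assoc, pullback.lift_fst, comp_zero]
  · have : coprod.desc (pullback.lift (𝟙 X) (r ≫ G.e) (by simp))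
        (pullback.lift 0 G.g (by simp) : G.top ⟶ pullback r G.c) ≫ pullback.snd r G.c =
        coprod.map r (𝟙 _) ≫ coprod.desc G.e G.g := by ext <;> simp
    rw [Category.assoc, this, Category.assoc, pullback.lift_snd, Category.assoc,
      ← G.bflatι_desc_e_g, ← Category.assoc, ← bflatMap_ι, Category.assoc]

/-- The universal property of the semi-direct product `X ×_{G₀} G₁`. -/
theorem exists_pullback_c_desc (b : X ⟶ Z) (t : G.top ⟶ Z)
    (h : bflatι X G.top ≫ coprod.desc b t = bflatMap r (𝟙 _) ≫ G.act ≫ t) :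
    ∃ φ : pullback r G.c ⟶ Z, pullback.lift (𝟙 X) (r ≫ G.e) (by simp) ≫ φ = b ∧
      pullback.lift 0 G.g (by simp) ≫ φ = t := by
  have : Mono (pullback.lift 0 G.g (by simp) : G.top ⟶ pullback r G.c) := by
    have : Mono ((pullback.lift 0 G.g (by simp) : G.top ⟶ pullback r G.c) ≫ pullback.snd _ _) := by
      rw [pullback.lift_snd]; infer_instance
    exact mono_of_mono _ (pullback.snd r G.c)
  refine exists_desc_of_equivariant (pullback.fst r G.c) _ (pullback.lift_fst _ _ _)
    _ (pullback.lift_fst _ _ _) ?_ (bflatMap r (𝟙 _) ≫ G.act)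
    (G.bflatι_desc_pullback_c r) b t (by rw [h, Category.assoc])
  intro U w hw
  obtain ⟨y, hy⟩ := G.exists_lift_g (w ≫ pullback.snd r G.c) (by
    rw [Category.assoc, ← pullback.condition, ← Category.assoc, hw, zero_comp])
  exact ⟨y, by apply pullback.hom_ext <;> simp [hy, hw]⟩

theorem equivariant_of_pullback_c_desc (b : X ⟶ Z) (t : G.top ⟶ Z) (φ : pullback r G.c ⟶ Z)
    (h₁ : pullback.lift (𝟙 X) (r ≫ G.e) (by simp) ≫ φ = b)
    (h₂ : pullback.lift 0 G.g (by simp) ≫ φ = t) :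
    bflatι X G.top ≫ coprod.desc b t = bflatMap r (𝟙 _) ≫ G.act ≫ t := by
  have := G.bflatι_desc_pullback_c r =≫ φ
  rw [Category.assoc, coprod.desc_comp, h₁, Category.assoc, h₂] at this
  simpa using this

end XMod

end SemidirectProduct

/-! ### The groupoid of a crossed module -/

section Groupoid

variable {C : Type u} [Category.{v} C] [HasZeroMorphisms C] [SemiAbelian C]

theorem comp_pullback_lift {X Y Z T T' : C} {f : X ⟶ Z} {g : Y ⟶ Z} (t : T' ⟶ T) (a : T ⟶ X)
    (b : T ⟶ Y) (h : a ≫ f = b ≫ g) :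
    t ≫ pullback.lift a b h = pullback.lift (t ≫ a) (t ≫ b) (by simp [h]) := by
  apply pullback.hom_ext <;> simp

theorem pullback_lift_eta {X Y Z T : C} {f : X ⟶ Z} {g : Y ⟶ Z} (t : T ⟶ pullback f g) :
    pullback.lift (t ≫ pullback.fst f g) (t ≫ pullback.snd f g)
      (by simp [pullback.condition]) = t := by
  apply pullback.hom_ext <;> simp

theorem pullback_lift_congr {X Y Z T : C} {f : X ⟶ Z} {g : Y ⟶ Z} {a a' : T ⟶ X} {b b' : T ⟶ Y}
    (ha : a = a') (hb : b = b') (h : a ≫ f = b ≫ g) :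
    pullback.lift a b h = pullback.lift a' b' (by rw [← ha, ← hb, h]) := by
  subst ha hb; rfl

namespace XMod

@[simp] theorem e_c_assoc (G : XMod C) {T : C} (f : G.base ⟶ T) : G.e ≫ G.c ≫ f = f := by
  rw [← Category.assoc, e_c, Category.id_comp]

@[simp] theorem e_d_assoc (G : XMod C) {T : C} (f : G.base ⟶ T) : G.e ≫ G.d ≫ f = f := by
  rw [← Category.assoc, e_d, Category.id_comp]

@[simp] theorem g_c_assoc (G : XMod C) {T : C} (f : G.base ⟶ T) : G.g ≫ G.c ≫ f = 0 := by
  rw [← Category.assoc, g_c, zero_comp]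

/-- The star multiplication: the composite of `x : G₁` with a generalized element `y` of `G`,
seen as an arrow into `0`, subject to `c x = ∂ y`. Peiffer's condition is what makes the pair
`(1, 1)` equivariant on `G ⋊ G`. -/
theorem exists_star_multiplication (G : XMod C) : ∃ ς : pullback G.del G.c ⟶ G.top,
    pullback.lift (𝟙 _) (G.del ≫ G.e) (by simp) ≫ ς = 𝟙 _ ∧
    pullback.lift 0 G.g (by simp) ≫ ς = 𝟙 _ ∧
    ς ≫ G.del = pullback.snd _ _ ≫ G.d := by
  obtain ⟨ς, h₁, h₂⟩ := G.exists_pullback_c_desc G.del (𝟙 G.top) (𝟙 G.top) (by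
    rw [Category.comp_id, G.peiffer]; rfl)
  refine ⟨ς, h₁, h₂, G.pullback_c_hom_ext _ ?_ ?_⟩
  · rw [← Category.assoc, h₁]
    simp
  · rw [← Category.assoc, h₂]
    simp

/-- Division in the groupoid: `δ (y, y')` is the arrow `x` with `c x = ∂ y` whose composite with
`y` is `y'`. -/
theorem exists_division (G : XMod C) : ∃ (ς : pullback G.del G.c ⟶ G.top)
    (δ : G.top ⨯ G.top ⟶ G.arrows) (_ : δ ≫ G.c = prod.fst ≫ G.del)
    (_ : δ ≫ G.d = prod.snd ≫ G.del)
    (_ : ∀ {T : C} (y y' : T ⟶ G.top) (x : T ⟶ G.arrows) (h : y ≫ G.del = x ≫ G.c),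
      pullback.lift y x h ≫ ς = y' → prod.lift y y' ≫ δ = x)
    (_ : ∀ {T : C} (y y' : T ⟶ G.top) (x : T ⟶ G.arrows) (h : y ≫ G.del = x ≫ G.c),
      prod.lift y y' ≫ δ = x → pullback.lift y x h ≫ ς = y')
    (_ : ∀ {T : C} (y : T ⟶ G.top), prod.lift y y ≫ δ = y ≫ G.del ≫ G.e)
    (_ : ∀ {T : C} (y : T ⟶ G.top), prod.lift 0 y ≫ δ = y ≫ G.g),
    ς ≫ G.del = pullback.snd _ _ ≫ G.d := by
  obtain ⟨ς, h₁, h₂, h₃⟩ := G.exists_star_multiplication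
  let θ : pullback G.del G.c ⟶ G.top ⨯ G.top := prod.lift (pullback.fst _ _) ς
  have hθ : ∀ {T : C} (y : T ⟶ G.top) (x : T ⟶ G.arrows) (h : y ≫ G.del = x ≫ G.c),
      pullback.lift y x h ≫ θ = prod.lift y (pullback.lift y x h ≫ ς) := by
    intro T y x h
    apply prod.hom_ext <;> simp [θ]
  have hθ₁ : ∀ {T : C} (y : T ⟶ G.top) (h : y ≫ G.del = (y ≫ G.del ≫ G.e) ≫ G.c),
      pullback.lift y (y ≫ G.del ≫ G.e) h ≫ ς = y := by
    intro T y h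
    have := y ≫= h₁
    rw [← Category.assoc, comp_pullback_lift] at this
    simpa using this
  have hθ₂ : ∀ {T : C} (y : T ⟶ G.top) (h : (0 : T ⟶ G.top) ≫ G.del = (y ≫ G.g) ≫ G.c),
      pullback.lift 0 (y ≫ G.g) h ≫ ς = y := by
    intro T y h
    have := y ≫= h₂
    rw [← Category.assoc, comp_pullback_lift] at this
    simpa using this
  have : Mono θ := by
    apply mono_of_kernel_elements
    intro U t ht
    have hfst : t ≫ pullback.fst _ _ = 0 := by simpa [θ] using ht =≫ prod.fst
    have hς : t ≫ ς = 0 := by simpa [θ] using ht =≫ prod.snd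
    obtain ⟨w, hw⟩ := G.exists_lift_g (t ≫ pullback.snd _ _) (by
      rw [Category.assoc, ← pullback.condition, ← Category.assoc, hfst, zero_comp])
    have ht' : t = pullback.lift 0 (w ≫ G.g) (by simp) := by
      apply pullback.hom_ext <;> simp [hfst, hw]
    rw [ht', hθ₂] at hς
    apply pullback.hom_ext <;> simp [hfst, ← hw, hς]
  have : IsIso θ := by
    refine isIso_of_section_of_kernel_elements prod.fst (prod.lift (𝟙 _) (𝟙 _)) (by simp) θ
      ⟨pullback.lift (𝟙 _) (𝟙 _ ≫ G.del ≫ G.e) (by simp), ?_⟩ ?_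
    · rw [hθ, hθ₁]
    · intro U t ht
      refine ⟨pullback.lift 0 ((t ≫ prod.snd) ≫ G.g) (by simp), ?_⟩
      rw [hθ, hθ₂]
      apply prod.hom_ext <;> simp [ht]
  have hinv : ∀ {T : C} (y y' : T ⟶ G.top) (x : T ⟶ G.arrows) (h : y ≫ G.del = x ≫ G.c),
      pullback.lift y x h ≫ ς = y' → prod.lift y y' ≫ inv θ ≫ pullback.snd _ _ = x := by
    intro T y y' x h hy
    rw [← hy, ← hθ y x h, Category.assoc, IsIso.hom_inv_id_assoc, pullback.lift_snd]
  have hfst : inv θ ≫ pullback.fst _ _ = prod.fst := by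
    rw [IsIso.inv_comp_eq]; simp [θ]
  have hsnd : inv θ ≫ ς = prod.snd := by
    rw [IsIso.inv_comp_eq]; simp [θ]
  refine ⟨ς, inv θ ≫ pullback.snd _ _, ?_, ?_, hinv, ?_, ?_, ?_, h₃⟩
  · rw [Category.assoc, ← pullback.condition, ← Category.assoc, hfst]
  · rw [Category.assoc, ← h₃, ← Category.assoc, hsnd]
  · intro T y y' x h hx
    have : pullback.lift y x h = prod.lift y y' ≫ inv θ := by
      apply pullback.hom_ext
      · simp [hfst]
      · simp [← hx]
    rw [this, Category.assoc, hsnd, prod.lift_snd]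
  · intro T y
    exact hinv _ _ _ (by simp) (hθ₁ y (by simp))
  · intro T y
    exact hinv _ _ _ (by simp) (hθ₂ y (by simp))

/-- The kernels of `c` and `d` cooperate. The division `δ` restricts to `g` on the second factor
of `G × G` and to a morphism `g•` with `g• d = 0` on the first; the bulk of the proof shows
that `g•` is a kernel of `d`. -/
theorem exists_cooperator (G : XMod C) : ∃ (δ : G.top ⨯ G.top ⟶ G.arrows),
    prod.lift 0 (𝟙 _) ≫ δ = G.g ∧
    ∀ {T : C} (k : T ⟶ G.arrows), k ≫ G.d = 0 →
      ∃ y : T ⟶ G.top, y ≫ prod.lift (𝟙 _) 0 ≫ δ = k := by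
  obtain ⟨ς, δ, hc, hd, hδ, hδ', hdiag, hax, hς⟩ := G.exists_division
  let b : G.top ⟶ G.arrows := prod.lift (𝟙 _) 0 ≫ δ
  have hb : ∀ {T : C} (y : T ⟶ G.top), y ≫ b = prod.lift y 0 ≫ δ := by
    intro T y
    simp only [b, ← Category.assoc]
    congr 1
    apply prod.hom_ext <;> simp
  refine ⟨δ, by simpa using hax (𝟙 G.top), fun {T} k hk => ?_⟩
  change ∃ y : T ⟶ G.top, y ≫ b = k
  have : Mono b := by
    apply mono_of_kernel_elements
    intro U y hy
    have hy₀ : y ≫ G.del = 0 := by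
      have := hy =≫ G.c
      rw [hb, Category.assoc, hc] at this
      simpa using this
    rw [hb] at hy
    have h₁ := hδ' y 0 0 (by simp [hy₀]) hy
    have h₂ := hδ' y y 0 (by simp [hy₀]) (by rw [hdiag, ← Category.assoc, hy₀, zero_comp])
    exact h₂.symm.trans h₁
  -- On `A = ker ∂` division is a subtraction `ψ`, so that `a ↦ ψ (a, 0)` is an involution.
  let A := kernel G.del
  let j : A ⟶ G.top := kernel.ι G.del
  have hj : j ≫ G.del = 0 := kernel.condition _
  obtain ⟨ψ, hψ⟩ : ∃ ψ : A ⨯ A ⟶ A, ψ ≫ j ≫ G.g = prod.map j j ≫ δ := by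
    obtain ⟨ψ₀, hψ₀⟩ := G.exists_lift_g (prod.map j j ≫ δ) (by
      rw [Category.assoc, hc, ← Category.assoc, prod.map_fst, Category.assoc, hj, comp_zero])
    refine ⟨kernel.lift _ ψ₀ ?_, by rw [← Category.assoc, kernel.lift_ι, hψ₀]⟩
    rw [← G.g_d, ← Category.assoc, hψ₀, Category.assoc, hd, ← Category.assoc, prod.map_snd,
      Category.assoc, hj, comp_zero]
  have hlift : ∀ {T : C} (a a' : T ⟶ A), (prod.lift a a' ≫ ψ) ≫ j ≫ G.g =
      prod.lift (a ≫ j) (a' ≫ j) ≫ δ := by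
    intro T a a'
    rw [Category.assoc, hψ, ← Category.assoc, prod.lift_map]
  have hψ_diag : ∀ {T : C} (a : T ⟶ A), prod.lift a a ≫ ψ = 0 := by
    intro T a
    rw [← cancel_mono (j ≫ G.g), hlift, hdiag, Category.assoc, reassoc_of% hj]
    simp
  have hψ_ax : ∀ {T : C} (a : T ⟶ A), prod.lift 0 a ≫ ψ = a := by
    intro T a
    rw [← cancel_mono (j ≫ G.g), hlift, zero_comp, hax, Category.assoc]
  let n : A ⟶ A := prod.lift (𝟙 _) 0 ≫ ψ
  have hn : ∀ {T : C} (a : T ⟶ A), a ≫ n = prod.lift a 0 ≫ ψ := by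
    intro T a
    simp only [n, ← Category.assoc]
    congr 1
    apply prod.hom_ext <;> simp
  have hnn : n ≫ n = 𝟙 A := by
    -- Compare `ψ (ψ (a, b), b)` with `ψ (ψ (a, 0), 0)` on the axes, and take `a = b`.
    have key : prod.lift ψ prod.snd ≫ ψ = prod.fst ≫ n ≫ n := by
      apply prod_hom_ext_axes
      · rw [← Category.assoc, prod.comp_lift, prod.lift_snd, ← hn]
        simp [n]
      · rw [← Category.assoc, prod.comp_lift, prod.lift_snd, hψ_ax, hψ_diag]
        simp
    have h := prod.lift (𝟙 A) (𝟙 A) ≫= key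
    rw [← Category.assoc, prod.comp_lift, prod.lift_snd, hψ_diag, hψ_ax] at h
    simpa using h.symm
  have hjb : j ≫ G.g = (n ≫ j) ≫ b := by
    rw [hb]
    have := hlift n 0
    rw [zero_comp] at this
    rw [← this, ← hn, hnn, Category.id_comp]
  have hμ : ∃ ν : G.top ⨯ A ⟶ G.top, prod.map (𝟙 _) j ≫ δ = ν ≫ b := by
    have : IsIso (pullback.fst (prod.map (𝟙 _) j ≫ δ) b) := by
      refine isIso_of_section_of_kernel_elements prod.fst (prod.lift (𝟙 _) 0) (by simp) _
        ⟨pullback.lift (prod.lift (𝟙 _) 0) (𝟙 _) ?_, pullback.lift_fst _ _ _⟩ ?_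
      · rw [← Category.assoc, prod.lift_map, hb]
        simp
      · intro U t ht
        refine ⟨pullback.lift t (t ≫ prod.snd ≫ n ≫ j) ?_, pullback.lift_fst _ _ _⟩
        have h : t ≫ prod.map (𝟙 G.top) j = prod.lift 0 (t ≫ prod.snd ≫ j) := by
          apply prod.hom_ext <;> simp [ht]
        rw [← Category.assoc, h, hax, Category.assoc, Category.assoc, Category.assoc, hjb]
        simp only [Category.assoc]
    refine ⟨inv (pullback.fst (prod.map (𝟙 _) j ≫ δ) b) ≫ pullback.snd _ _, ?_⟩
    rw [Category.assoc, ← pullback.condition, IsIso.inv_hom_id_assoc]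
  obtain ⟨ν, hν⟩ := hμ
  -- The support of the graph is a reflexive relation, hence symmetric: from `(0, c k)` in it
  -- there results, locally, an element `y` of `G` with `∂ y = c k`.
  obtain ⟨T', p, hp, y, hy⟩ : ∃ (T' : C) (p : T' ⟶ T) (_ : IsRegularEpi p) (y : T' ⟶ G.top),
      y ≫ G.del = (p ≫ k) ≫ G.c := by
    let F := Regular.strongEpiMonoFactorisation (prod.lift G.d G.c)
    have hF₁ : F.e ≫ F.m ≫ prod.fst = G.d := by rw [← Category.assoc, F.fac, prod.lift_fst]
    have hF₂ : F.e ≫ F.m ≫ prod.snd = G.c := by rw [← Category.assoc, F.fac, prod.lift_snd]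
    have : StrongEpi F.e := F.e_strong_epi
    have : IsRegularEpi F.e := isRegularEpi_of_strongEpi _
    obtain ⟨t, ht₁, ht₂⟩ := difunctional (F.m ≫ prod.fst) (F.m ≫ prod.snd)
      (fun f g h₁ h₂ => by
        rw [← cancel_mono F.m]
        ext
        · simpa using h₁
        · simpa using h₂)
      ((k ≫ G.c ≫ G.e) ≫ F.e) (k ≫ F.e) 0
      (by rw [Category.assoc, Category.assoc k F.e, hF₂]; simp)
      (by rw [Category.assoc, hF₁, hk, zero_comp])
    obtain ⟨T', p, hp, x, hx⟩ := exists_cover F.e t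
    obtain ⟨y, hy⟩ := G.exists_lift_g x (by
      rw [← hF₂, ← Category.assoc, ← hx, Category.assoc, ht₂, zero_comp, comp_zero])
    refine ⟨T', p, hp, y, ?_⟩
    rw [← G.g_d, ← Category.assoc, hy, ← hF₁, ← Category.assoc, ← hx, Category.assoc, ht₁,
      Category.assoc, hF₁]
    simp
  refine exists_lift_of_cover p b k
    (prod.lift y (kernel.lift _ (pullback.lift y (p ≫ k) hy ≫ ς) (by
      rw [Category.assoc, hς, ← Category.assoc, pullback.lift_snd, Category.assoc, hk,
        comp_zero])) ≫ ν) ?_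
  rw [Category.assoc, ← hν, ← Category.assoc, prod.lift_map, Category.comp_id, kernel.lift_ι]
  exact (hδ y _ (p ≫ k) hy rfl).symm

theorem isEquivalenceRelation_kernelPair {X Y : C} (f : X ⟶ Y) :
    IsEquivalenceRelation (pullback.fst f f) (pullback.snd f f) :=
  isEquivalenceRelation_of_reflexive _ _ (fun _ _ h₁ h₂ => pullback.hom_ext h₁ h₂)
    (pullback.lift (𝟙 X) (𝟙 X) rfl) (pullback.lift_fst _ _ _) (pullback.lift_snd _ _ _)

theorem cooperate_normalizations (G : XMod C) :
    Cooperate (normalization (pullback.fst G.c G.c) (pullback.snd G.c G.c))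
      (normalization (pullback.fst G.d G.d) (pullback.snd G.d G.d)) := by
  obtain ⟨δ, hg, hδ⟩ := G.exists_cooperator
  obtain ⟨u, hu⟩ := G.exists_lift_g
    (normalization (pullback.fst G.c G.c) (pullback.snd G.c G.c)) (by
      rw [normalization, Category.assoc, pullback.condition, ← Category.assoc,
        kernel.condition, zero_comp])
  obtain ⟨w, hw⟩ := hδ
    (normalization (pullback.fst G.d G.d) (pullback.snd G.d G.d)) (by
      rw [normalization, Category.assoc, pullback.condition, ← Category.assoc,
        kernel.condition, zero_comp])
  refine ⟨prod.lift (prod.snd ≫ w) (prod.fst ≫ u) ≫ δ, ?_, ?_⟩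
  · rw [← hu, ← hg, ← Category.assoc, ← Category.assoc]
    congr 1
    apply prod.hom_ext <;> simp
  · rw [← hw, ← Category.assoc, ← Category.assoc]
    congr 1
    apply prod.hom_ext <;> simp

/-- The composition of the groupoid, obtained from the connector `Φ` between the kernel pairs of
`c` and `d` as `m (x, y) = Φ (x, 1, y)`. -/
theorem exists_multiplication [HuqSmith C] (G : XMod C) : ∃ m : pullback G.c G.d ⟶ G.arrows,
    (∀ {T : C} (x : T ⟶ G.arrows) (h : (x ≫ G.d ≫ G.e) ≫ G.c = x ≫ G.d),
      pullback.lift (x ≫ G.d ≫ G.e) x h ≫ m = x) ∧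
    (∀ {T : C} (x : T ⟶ G.arrows) (h : x ≫ G.c = (x ≫ G.c ≫ G.e) ≫ G.d),
      pullback.lift x (x ≫ G.c ≫ G.e) h ≫ m = x) := by
  obtain ⟨Φ, h₁, h₂⟩ := HuqSmith.smith_of_huq _ _ _ _ (isEquivalenceRelation_kernelPair G.c)
    (isEquivalenceRelation_kernelPair G.d) G.cooperate_normalizations
  have e₁ : pullback.fst G.c G.d ≫ G.c = (pullback.fst G.c G.d ≫ G.c ≫ G.e) ≫ G.c := by simp
  have e₂ : (pullback.snd G.c G.d ≫ G.d ≫ G.e) ≫ G.d = pullback.snd G.c G.d ≫ G.d := by simp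
  refine ⟨pullback.lift (pullback.lift (pullback.fst _ _) (pullback.fst _ _ ≫ G.c ≫ G.e) e₁)
    (pullback.lift (pullback.snd _ _ ≫ G.d ≫ G.e) (pullback.snd _ _) e₂)
    (by simp [pullback.condition_assoc]) ≫ Φ, ?_, ?_⟩
  · intro T x h
    have := (h₂ (pullback.lift (x ≫ G.d ≫ G.e) (x ≫ G.d ≫ G.e) rfl)
      (pullback.lift (x ≫ G.d ≫ G.e) x (by simp)) (by simp) (by simp)).trans
      (pullback.lift_snd _ _ _)
    rw [← Category.assoc]
    refine Eq.trans ?_ this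
    congr 1
    apply pullback.hom_ext <;> apply pullback.hom_ext <;> simp
  · intro T x h
    have := (h₁ (pullback.lift x (x ≫ G.c ≫ G.e) (by simp))
      (pullback.lift (x ≫ G.c ≫ G.e) (x ≫ G.c ≫ G.e) rfl) (by simp) (by simp)).trans
      (pullback.lift_fst _ _ _)
    rw [← Category.assoc]
    refine Eq.trans ?_ this
    congr 1
    apply pullback.hom_ext <;> apply pullback.hom_ext <;> simp

/-- Every unital composition on the graph `d, c` makes it an internal groupoid: it is associative
because both sides agree on identities and on the kernel of `c`, and it has inverses because
`(x, y) ↦ (x, x y)` is an isomorphism. -/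
theorem exists_groupoidStr_of_unital (G : XMod C) (m : pullback G.c G.d ⟶ G.arrows)
    (e_m : ∀ {T : C} (x : T ⟶ G.arrows) (h : (x ≫ G.d ≫ G.e) ≫ G.c = x ≫ G.d),
      pullback.lift (x ≫ G.d ≫ G.e) x h ≫ m = x)
    (m_e : ∀ {T : C} (x : T ⟶ G.arrows) (h : x ≫ G.c = (x ≫ G.c ≫ G.e) ≫ G.d),
      pullback.lift x (x ≫ G.c ≫ G.e) h ≫ m = x) : Nonempty (GroupoidStr G) := by
  have m_sec : pullback.lift (G.d ≫ G.e) (𝟙 _) (by simp) ≫ m = 𝟙 _ := by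
    simpa using e_m (𝟙 _) (by simp)
  have m_ker : pullback.lift G.g 0 (by simp) ≫ m = G.g := by
    have h := m_e G.g (by simp)
    refine Eq.trans ?_ h
    congr 1
    exact pullback_lift_congr rfl (by rw [← Category.assoc, G.g_c, zero_comp]) _
  have m_d : m ≫ G.d = pullback.fst G.c G.d ≫ G.d := by
    apply G.pullback_c_hom_ext'
    · rw [← Category.assoc, m_sec]; simp
    · rw [← Category.assoc, m_ker]; simp
  have m_c : m ≫ G.c = pullback.snd G.c G.d ≫ G.c := by
    apply G.pullback_c_hom_ext'
    · rw [← Category.assoc, m_sec]; simp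
    · rw [← Category.assoc, m_ker]; simp
  have lift_m_d : ∀ {T : C} (x y : T ⟶ G.arrows) (h : x ≫ G.c = y ≫ G.d),
      (pullback.lift x y h ≫ m) ≫ G.d = x ≫ G.d := by
    intro T x y h
    rw [Category.assoc, m_d, ← Category.assoc, pullback.lift_fst]
  have lift_m_c : ∀ {T : C} (x y : T ⟶ G.arrows) (h : x ≫ G.c = y ≫ G.d),
      (pullback.lift x y h ≫ m) ≫ G.c = y ≫ G.c := by
    intro T x y h
    rw [Category.assoc, m_c, ← Category.assoc, pullback.lift_snd]
  have comp_m : ∀ {T T' : C} (t : T' ⟶ T) (x y : T ⟶ G.arrows) (h : x ≫ G.c = y ≫ G.d),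
      t ≫ pullback.lift x y h ≫ m = pullback.lift (t ≫ x) (t ≫ y) (by simp [h]) ≫ m := by
    intro T T' t x y h
    rw [← Category.assoc, comp_pullback_lift]
  have m_congr : ∀ {T : C} {x x' y y' : T ⟶ G.arrows} (hx : x = x') (hy : y = y')
      (h : x ≫ G.c = y ≫ G.d),
      pullback.lift x y h ≫ m = pullback.lift x' y' (by rw [← hx, ← hy, h]) ≫ m := by
    intro T x x' y y' hx hy h
    subst hx hy
    rfl
  have m_assoc : ∀ {T : C} (x y z : T ⟶ G.arrows) (hxy : x ≫ G.c = y ≫ G.d)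
      (hyz : y ≫ G.c = z ≫ G.d) (h₁ : (pullback.lift x y hxy ≫ m) ≫ G.c = z ≫ G.d)
      (h₂ : x ≫ G.c = (pullback.lift y z hyz ≫ m) ≫ G.d),
      pullback.lift (pullback.lift x y hxy ≫ m) z h₁ ≫ m =
        pullback.lift x (pullback.lift y z hyz ≫ m) h₂ ≫ m := by
    intro T x y z hxy hyz h₁ h₂
    -- The universal composable triple: the pullback of `c` along `(y, z) ↦ d y`.
    let W := pullback G.c (pullback.fst G.c G.d ≫ G.d)
    let X : W ⟶ G.arrows := pullback.fst _ _
    let Y : W ⟶ G.arrows := pullback.snd _ _ ≫ pullback.fst _ _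
    let Z : W ⟶ G.arrows := pullback.snd _ _ ≫ pullback.snd _ _
    have hXY : X ≫ G.c = Y ≫ G.d := by
      rw [Category.assoc]; exact pullback.condition
    have hYZ : Y ≫ G.c = Z ≫ G.d := by
      rw [Category.assoc, Category.assoc, pullback.condition]
    have hT : pullback.lift (pullback.fst G.c G.d) (pullback.snd G.c G.d) pullback.condition =
        𝟙 _ := by
      apply pullback.hom_ext <;> simp
    have key : pullback.lift (pullback.lift X Y hXY ≫ m) Z (by rw [lift_m_c, hYZ]) ≫ m =
        pullback.lift X (pullback.lift Y Z hYZ ≫ m) (by rw [lift_m_d, hXY]) ≫ m := by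
      apply G.pullback_c_hom_ext'
      · refine (comp_m _ _ _ _).trans (Eq.trans ?_ (comp_m _ _ _ _).symm)
        refine (m_congr (y' := pullback.snd G.c G.d) (x' := pullback.fst G.c G.d) ?_ ?_ _).trans
          (Eq.trans ?_ (m_congr (y' := m) (x' := m ≫ G.d ≫ G.e) ?_ ?_ _).symm)
        · refine (comp_m _ _ _ _).trans ((m_congr (y' := pullback.fst G.c G.d)
            (x' := pullback.fst G.c G.d ≫ G.d ≫ G.e) ?_ ?_ _).trans (e_m _ (by simp)))
          · simp [X]
          · simp [Y]
        · simp [Z]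
        · exact (hT =≫ m).trans ((Category.id_comp m).trans (e_m m (by simp)).symm)
        · rw [← Category.assoc m, m_d]
          simp [X]
        · refine (comp_m _ _ _ _).trans ((m_congr (y' := pullback.snd G.c G.d)
            (x' := pullback.fst G.c G.d) ?_ ?_ _).trans (by rw [hT, Category.id_comp]))
          · simp [Y]
          · simp [Z]
      · have h0 : pullback.lift (0 : G.top ⟶ G.arrows) 0 (by simp) ≫ m = 0 := by
          have : pullback.lift (0 : G.top ⟶ G.arrows) 0 (by simp) = (0 : _ ⟶ pullback G.c G.d) := by
            apply pullback.hom_ext <;> simp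
          rw [this, zero_comp]
        refine (comp_m _ _ _ _).trans (Eq.trans ?_ (comp_m _ _ _ _).symm)
        refine (m_congr (x' := G.g) (y' := 0) ?_ ?_ _).trans
          (m_congr (x' := G.g) (y' := 0) ?_ ?_ _).symm
        · refine (comp_m _ _ _ _).trans
            ((m_congr (x' := G.g) (y' := 0) ?_ ?_ _).trans m_ker)
          · simp [X]
          · simp [Y]
        · simp [Z]
        · simp [X]
        · refine (comp_m _ _ _ _).trans ((m_congr (x' := 0) (y' := 0) ?_ ?_ _).trans h0)
          · simp [Y]
          · simp [Z]
    let t : T ⟶ W := pullback.lift x (pullback.lift y z hyz) (by simp [hxy])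
    refine Eq.trans (m_congr ?_ ?_ _) ((comp_m t _ _ _).symm.trans
      ((t ≫= key).trans ((comp_m t _ _ _).trans (m_congr ?_ ?_ _))))
    · exact (m_congr (by simp [t, X]) (by simp [t, Y]) _).trans (comp_m t _ _ _).symm
    · simp [t, Z]
    · simp [t, X]
    · exact (comp_m t _ _ _).trans (m_congr (by simp [t, Y]) (by simp [t, Z]) _)
  -- The shearing morphism `(x, y) ↦ (x, x y)` is invertible.
  let φ : pullback G.c G.d ⟶ pullback G.d G.d := pullback.lift (pullback.fst _ _) m m_d.symm
  have hφ : ∀ {T : C} (x y : T ⟶ G.arrows) (h : x ≫ G.c = y ≫ G.d),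
      pullback.lift x y h ≫ φ = pullback.lift x (pullback.lift x y h ≫ m)
        (by rw [lift_m_d]) := by
    intro T x y h
    apply pullback.hom_ext <;> simp [φ]
  have zero_m : ∀ {T : C} (y : T ⟶ G.arrows) (h : (0 : T ⟶ G.arrows) ≫ G.c = y ≫ G.d),
      pullback.lift 0 y h ≫ m = y := by
    intro T y h
    refine (m_congr ?_ rfl _).trans (e_m y ?_)
    · rw [← Category.assoc, ← h, zero_comp, zero_comp]
    · simp
  have : Mono φ := by
    apply mono_of_kernel_elements
    intro U t ht
    have h₁ : t ≫ pullback.fst _ _ = 0 := by simpa [φ] using ht =≫ pullback.fst _ _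
    have h₂ : t ≫ m = 0 := by simpa [φ] using ht =≫ pullback.snd _ _
    have h₃ : t = pullback.lift 0 (t ≫ pullback.snd _ _) (by
        rw [Category.assoc, ← pullback.condition, ← Category.assoc, h₁]) := by
      apply pullback.hom_ext <;> simp [h₁]
    rw [h₃, zero_m] at h₂
    apply pullback.hom_ext <;> simp [h₁, h₂]
  have : IsIso φ := by
    refine isIso_of_section_of_kernel_elements (pullback.fst _ _)
      (pullback.lift (𝟙 _) (𝟙 _) rfl) (by simp) φ
      ⟨pullback.lift (𝟙 _) (𝟙 _ ≫ G.c ≫ G.e) (by simp), ?_⟩ ?_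
    · exact (hφ _ _ _).trans (pullback_lift_congr rfl (m_e _ _) _)
    · intro U t ht
      refine ⟨pullback.lift 0 (t ≫ pullback.snd _ _) ?_, ?_⟩
      · rw [Category.assoc, ← pullback.condition, ← Category.assoc, ht, zero_comp, zero_comp]
      · refine (hφ _ _ _).trans ((pullback_lift_congr rfl (zero_m _ _) _).trans ?_)
        apply pullback.hom_ext <;> simp [ht]
  have cancel : ∀ {T : C} (x y y' : T ⟶ G.arrows) (h : x ≫ G.c = y ≫ G.d)
      (h' : x ≫ G.c = y' ≫ G.d), pullback.lift x y h ≫ m = pullback.lift x y' h' ≫ m →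
      y = y' := by
    intro T x y y' h h' hyy
    have : pullback.lift x y h = pullback.lift x y' h' := by
      rw [← cancel_mono φ, hφ, hφ]
      exact pullback_lift_congr rfl hyy _
    simpa using this =≫ pullback.snd _ _
  let t : G.arrows ⟶ pullback G.c G.d := pullback.lift (𝟙 _) (G.d ≫ G.e) (by simp) ≫ inv φ
  have ht₁ : t ≫ pullback.fst _ _ = 𝟙 _ := by
    have h : φ ≫ pullback.fst _ _ = pullback.fst _ _ := by simp [φ]
    rw [Category.assoc, ← h, IsIso.inv_hom_id_assoc, pullback.lift_fst]
  have ht₂ : t ≫ m = G.d ≫ G.e := by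
    have h : φ ≫ pullback.snd _ _ = m := by simp [φ]
    rw [Category.assoc, ← h, IsIso.inv_hom_id_assoc, pullback.lift_snd]
  let i : G.arrows ⟶ G.arrows := t ≫ pullback.snd _ _
  have i_d : i ≫ G.d = G.c := by
    rw [Category.assoc, ← pullback.condition, ← Category.assoc, ht₁, Category.id_comp]
  have i_c : i ≫ G.c = G.d := by
    have := ht₂ =≫ G.c
    rw [Category.assoc, m_c] at this
    simpa [i] using this
  have m_i : ∀ {T : C} (x : T ⟶ G.arrows) (h : x ≫ G.c = (x ≫ i) ≫ G.d),
      pullback.lift x (x ≫ i) h ≫ m = x ≫ G.d ≫ G.e := by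
    intro T x h
    refine Eq.trans ?_ ((Category.assoc _ _ _).trans (x ≫= ht₂))
    congr 1
    apply pullback.hom_ext <;> simp [ht₁, i]
  refine ⟨{ m := m, i := i, m_d := m_d, m_c := m_c, e_m := e_m, m_e := m_e, m_assoc := m_assoc
            i_d := i_d, i_c := i_c, m_i := m_i, i_m := ?_ }⟩
  intro T x h
  have hx : x ≫ G.c = (x ≫ i) ≫ G.d := by rw [Category.assoc, i_d]
  refine cancel x _ _ (by rw [lift_m_d, hx]) (by simp) ?_
  rw [← m_assoc x (x ≫ i) x hx h (by rw [lift_m_c, h]), m_e]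
  exact (m_congr (m_i x hx) rfl _).trans (e_m x (by simp))

end XMod

namespace GroupoidStr

variable {G : XMod C} (S : GroupoidStr G)

@[simp] theorem i_d_elt {T : C} (x : T ⟶ G.arrows) : (x ≫ S.i) ≫ G.d = x ≫ G.c := by
  rw [Category.assoc, S.i_d]

@[simp] theorem i_c_elt {T : C} (x : T ⟶ G.arrows) : (x ≫ S.i) ≫ G.c = x ≫ G.d := by
  rw [Category.assoc, S.i_c]

theorem e_mul {T : C} (x y : T ⟶ G.arrows) (hx : x = y ≫ G.d ≫ G.e)
    (h : x ≫ G.c = y ≫ G.d) : S.mul x y h = y := by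
  subst hx; exact S.e_m y h

theorem mul_e {T : C} (x y : T ⟶ G.arrows) (hy : y = x ≫ G.c ≫ G.e)
    (h : x ≫ G.c = y ≫ G.d) : S.mul x y h = x := by
  subst hy; exact S.m_e x h

theorem mul_mul {T : C} (x y z : T ⟶ G.arrows) (hxy : x ≫ G.c = y ≫ G.d)
    (hyz : y ≫ G.c = z ≫ G.d) :
    S.mul (S.mul x y hxy) z (by rw [mul_c, hyz]) =
      S.mul x (S.mul y z hyz) (by rw [mul_d, hxy]) :=
  S.m_assoc x y z hxy hyz _ _

theorem mul_inv {T : C} (x : T ⟶ G.arrows) :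
    S.mul x (x ≫ S.i) (by rw [i_d_elt]) = x ≫ G.d ≫ G.e := S.m_i x _

theorem inv_mul {T : C} (x : T ⟶ G.arrows) :
    S.mul (x ≫ S.i) x (by rw [i_c_elt]) = x ≫ G.c ≫ G.e := S.i_m x _

/-- Left inverses in the groupoid are unique. -/
theorem eq_inv_of_mul_eq {T : C} (x y : T ⟶ G.arrows) (h : x ≫ G.c = y ≫ G.d)
    (hxy : S.mul x y h = x ≫ G.d ≫ G.e) : x = y ≫ S.i := by
  have hd : x ≫ G.d = y ≫ G.c := by
    have := hxy =≫ G.c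
    simpa using this.symm
  have hy : x ≫ G.c = (y ≫ G.d ≫ G.e) ≫ G.d := by simp [h]
  calc x = S.mul x (y ≫ G.d ≫ G.e) hy := (S.mul_e _ _ (by rw [reassoc_of% h]) _).symm
    _ = S.mul x (S.mul y (y ≫ S.i) (i_d_elt S y).symm) (by rw [mul_d, h]) :=
      S.mul_congr rfl (S.mul_inv y).symm _
    _ = S.mul (S.mul x y h) (y ≫ S.i) (by rw [mul_c, i_d_elt]) :=
      (S.mul_mul _ _ _ _ _).symm
    _ = S.mul (x ≫ G.d ≫ G.e) (y ≫ S.i) (by simp [hd, S.i_d]) := S.mul_congr hxy rfl _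
    _ = y ≫ S.i := S.e_mul _ _ (by simp only [← Category.assoc, i_d_elt, hd]) _

@[simp] theorem e_i : G.e ≫ S.i = G.e := by
  refine (S.eq_inv_of_mul_eq G.e G.e (by simp) ?_).symm
  exact (S.e_mul _ _ (by simp) _).trans (by simp)

theorem i_i : S.i ≫ S.i = 𝟙 _ := by
  refine (S.eq_inv_of_mul_eq (𝟙 _) S.i (by rw [S.i_d, Category.id_comp]) ?_).symm
  simpa using S.mul_inv (𝟙 _)

@[simp] theorem gb_i : S.gb ≫ S.i = G.g := by
  rw [gb, Category.assoc, i_i, Category.comp_id]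

/-- `g•` is the kernel of `d`. -/
theorem exists_lift_gb {T : C} (t : T ⟶ G.arrows) (ht : t ≫ G.d = 0) :
    ∃ y : T ⟶ G.top, y ≫ S.gb = t := by
  obtain ⟨y, hy⟩ := G.exists_lift_g (t ≫ S.i) (by rw [i_c_elt, ht])
  exact ⟨y, by rw [gb, reassoc_of% hy, i_i, Category.comp_id]⟩

/-- Morphisms out of the pullback of `d` along `r : X ⟶ G₀` are determined by their restrictions
to `X` and, along `g•`, to `G`. -/
theorem pullback_d_hom_ext {X Z : C} {r : X ⟶ G.base} {x y : pullback G.d r ⟶ Z}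
    (h₁ : pullback.lift (r ≫ G.e) (𝟙 X) (by simp) ≫ x =
      pullback.lift (r ≫ G.e) (𝟙 X) (by simp) ≫ y)
    (h₂ : pullback.lift S.gb 0 (by simp) ≫ x = pullback.lift S.gb 0 (by simp) ≫ y) : x = y := by
  refine hom_ext_of_section_of_kernel_elements (pullback.snd G.d r) _ (by simp) h₁ ?_
  intro U t ht
  obtain ⟨w, hw⟩ := S.exists_lift_gb (t ≫ pullback.fst G.d r) (by
    rw [Category.assoc, pullback.condition, ← Category.assoc, ht, zero_comp])
  have : t = w ≫ pullback.lift S.gb 0 (by simp) := by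
    apply pullback.hom_ext <;> simp [ht, hw]
  rw [this, Category.assoc, h₂, Category.assoc]

/-- The morphism `q₁` induced by a morphism of crossed modules preserves inverses. -/
theorem i_arrows {H : XMod C} (S' : GroupoidStr H) (Q : H ⟶ G) :
    S'.i ≫ XModHom.arrows Q = XModHom.arrows Q ≫ S.i := by
  refine S.eq_inv_of_mul_eq _ _ ?_ ?_
  · rw [Category.assoc, XModHom.arrows_c, XModHom.arrows_d, ← Category.assoc, S'.i_c]
  · have h := S.mul_arrows S' Q S'.i (𝟙 _) (by rw [S'.i_c, Category.id_comp])
    have h' := S'.inv_mul (𝟙 _)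
    rw [S'.mul_congr (Category.id_comp _) rfl] at h'
    rw [h'] at h
    refine Eq.trans (S.mul_congr rfl (Category.id_comp _).symm _) (h.symm.trans ?_)
    simp only [Category.assoc, Category.id_comp, XModHom.e_arrows]
    rw [← Category.assoc (XModHom.arrows Q), XModHom.arrows_d, ← Category.assoc S'.i,
      ← Category.assoc S'.i, S'.i_d, Category.assoc]

theorem gb_arrows {H : XMod C} (S' : GroupoidStr H) (Q : H ⟶ G) :
    S'.gb ≫ XModHom.arrows Q = XModHom.top Q ≫ S.gb := by
  rw [gb, Category.assoc, i_arrows S S', ← Category.assoc, XModHom.g_arrows, Category.assoc, gb]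

end GroupoidStr

/-- The groupoid structure on the graph of a crossed module exists and is unique. -/
theorem nonempty_unique_groupoidStr [HuqSmith C] (G : XMod C) :
    Nonempty (Unique (GroupoidStr G)) := by
  obtain ⟨m, h₁, h₂⟩ := G.exists_multiplication
  obtain ⟨S⟩ := G.exists_groupoidStr_of_unital m h₁ h₂
  refine ⟨⟨⟨S⟩, fun S' => ?_⟩⟩
  have hid : XModHom.arrows (𝟙 G) = 𝟙 G.arrows := by
    apply G.arrows_hom_ext
    · rw [XModHom.g_arrows]; simp
    · rw [XModHom.e_arrows]; simp
  change S' = S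
  refine GroupoidStr.ext ?_ ?_
  · have h := GroupoidStr.mul_arrows S S' (𝟙 G) (pullback.fst _ _) (pullback.snd _ _)
      pullback.condition
    simp only [hid, Category.comp_id] at h
    have h1 : pullback.lift (pullback.fst G.c G.d) (pullback.snd G.c G.d) pullback.condition =
      𝟙 _ := by
      apply pullback.hom_ext <;> simp
    rwa [GroupoidStr.mul, GroupoidStr.mul, h1, Category.id_comp, Category.id_comp] at h
  · simpa [hid] using GroupoidStr.i_arrows S S' (𝟙 G)

end Groupoid

/-! ### Morphisms determined by generalized elements -/

section NaturalFamilies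

variable {C : Type u} [Category.{v} C] [HasZeroMorphisms C] [SemiAbelian C]

/-- Two natural constructions on generalized elements `(x, a)` with `r x = c a` agree as soon as
they agree on identities `a` and on the pairs `(0, g)`. -/
theorem XMod.eq_of_natural_c (G : XMod C) {X Z : C} (r : X ⟶ G.base)
    (F F' : ∀ {T : C} (x : T ⟶ X) (a : T ⟶ G.arrows), x ≫ r = a ≫ G.c → (T ⟶ Z))
    (hF : ∀ {T T' : C} (t : T' ⟶ T) (x : T ⟶ X) (a : T ⟶ G.arrows) (h : x ≫ r = a ≫ G.c),
      t ≫ F x a h = F (t ≫ x) (t ≫ a) (by simp [h]))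
    (hF' : ∀ {T T' : C} (t : T' ⟶ T) (x : T ⟶ X) (a : T ⟶ G.arrows) (h : x ≫ r = a ≫ G.c),
      t ≫ F' x a h = F' (t ≫ x) (t ≫ a) (by simp [h]))
    (h₁ : ∀ {T : C} (x : T ⟶ X) (a : T ⟶ G.arrows) (h : x ≫ r = a ≫ G.c), a = x ≫ r ≫ G.e →
      F x a h = F' x a h)
    (h₂ : ∀ {T : C} (x : T ⟶ X) (y : T ⟶ G.top) (h : x ≫ r = (y ≫ G.g) ≫ G.c), x = 0 →
      F x (y ≫ G.g) h = F' x (y ≫ G.g) h)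
    {T : C} (x : T ⟶ X) (a : T ⟶ G.arrows) (h : x ≫ r = a ≫ G.c) : F x a h = F' x a h := by
  have key : F (pullback.fst r G.c) (pullback.snd r G.c) pullback.condition =
      F' (pullback.fst r G.c) (pullback.snd r G.c) pullback.condition := by
    apply G.pullback_c_hom_ext
    · rw [hF, hF']
      exact h₁ _ _ _ (by simp)
    · rw [hF, hF']
      simpa using h₂ (0 : G.top ⟶ X) (𝟙 _) (by simp) rfl
  have := pullback.lift x a h ≫= key
  rw [hF, hF'] at this
  simpa using this

/-- The analogue for pairs `(a, x)` with `d a = r x`, with `g•` in the place of `g`. -/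
theorem GroupoidStr.eq_of_natural_d {G : XMod C} (S : GroupoidStr G) {X Z : C} (r : X ⟶ G.base)
    (F F' : ∀ {T : C} (a : T ⟶ G.arrows) (x : T ⟶ X), a ≫ G.d = x ≫ r → (T ⟶ Z))
    (hF : ∀ {T T' : C} (t : T' ⟶ T) (a : T ⟶ G.arrows) (x : T ⟶ X) (h : a ≫ G.d = x ≫ r),
      t ≫ F a x h = F (t ≫ a) (t ≫ x) (by simp [h]))
    (hF' : ∀ {T T' : C} (t : T' ⟶ T) (a : T ⟶ G.arrows) (x : T ⟶ X) (h : a ≫ G.d = x ≫ r),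
      t ≫ F' a x h = F' (t ≫ a) (t ≫ x) (by simp [h]))
    (h₁ : ∀ {T : C} (a : T ⟶ G.arrows) (x : T ⟶ X) (h : a ≫ G.d = x ≫ r), a = x ≫ r ≫ G.e →
      F a x h = F' a x h)
    (h₂ : ∀ {T : C} (y : T ⟶ G.top) (x : T ⟶ X) (h : (y ≫ S.gb) ≫ G.d = x ≫ r), x = 0 →
      F (y ≫ S.gb) x h = F' (y ≫ S.gb) x h)
    {T : C} (a : T ⟶ G.arrows) (x : T ⟶ X) (h : a ≫ G.d = x ≫ r) : F a x h = F' a x h := by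
  have key : F (pullback.fst G.d r) (pullback.snd G.d r) pullback.condition =
      F' (pullback.fst G.d r) (pullback.snd G.d r) pullback.condition := by
    apply S.pullback_d_hom_ext
    · rw [hF, hF']
      exact h₁ _ _ _ (by simp)
    · rw [hF, hF']
      simpa using h₂ (𝟙 _) (0 : G.top ⟶ X) (by simp) rfl
  have := pullback.lift a x h ≫= key
  rw [hF, hF'] at this
  simpa using this

end NaturalFamilies

/-! ### The two actions on a butterfly -/

namespace IsButterfly

variable {C : Type u} [Category.{v} C] [HasZeroMorphisms C] [SemiAbelian C]
variable {H G : XMod C} {E : ButterflyDiagram H G}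

theorem ι_mono (hE : IsButterfly E) : Mono E.ι := by
  obtain ⟨h⟩ := hE.ι_kernel
  exact ⟨fun a b hab => Fork.IsLimit.hom_ext h hab⟩

theorem eq_zero_of_ι (hE : IsButterfly E) {T : C} (y : T ⟶ G.top) (h : y ≫ E.ι = 0) : y = 0 := by
  have := hE.ι_mono
  rw [← cancel_mono E.ι, h, zero_comp]

theorem exists_lift_ι (hE : IsButterfly E) {T : C} (t : T ⟶ E.X) (ht : t ≫ E.σ = 0) :
    ∃ y : T ⟶ G.top, y ≫ E.ι = t := by
  obtain ⟨h⟩ := hE.ι_kernel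
  exact ⟨_, (KernelFork.IsLimit.lift' h t ht).2⟩

theorem σ_isRegularEpi (hE : IsButterfly E) : IsRegularEpi E.σ := by
  obtain ⟨h⟩ := hE.σ_cokernel
  exact ⟨⟨{ W := _, left := E.ι, right := 0, w := by simp, isColimit := h }⟩⟩

/-- The second of the two butterfly conditions on the actions says that `(1, ι)` is equivariant,
that is, that it extends to the semi-direct product `E ×_{ρ, c} G₁`. -/
theorem exists_ract (hE : IsButterfly E) : ∃ r : pullback E.ρ G.c ⟶ E.X,
    pullback.lift (𝟙 E.X) (E.ρ ≫ G.e) (by simp) ≫ r = 𝟙 E.X ∧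
    pullback.lift 0 G.g (by simp) ≫ r = E.ι :=
  G.exists_pullback_c_desc E.ρ (𝟙 E.X) E.ι (by
    rw [hE.ι_precrossed, conj, ← Category.assoc, bflatMap_ι, Category.assoc, coprod.map_desc]
    simp)

/-- The action of `H₁` is obtained from the corresponding extension to `E ×_{σ, c} H₁` by
inversion in `H₁`. -/
theorem exists_lact (S : GroupoidStr H) (hE : IsButterfly E) : ∃ l : pullback H.d E.σ ⟶ E.X,
    pullback.lift (E.σ ≫ H.e) (𝟙 E.X) (by simp) ≫ l = 𝟙 E.X ∧
    pullback.lift S.gb 0 (by simp) ≫ l = E.κ := by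
  obtain ⟨l, h₁, h₂⟩ := H.exists_pullback_c_desc E.σ (𝟙 E.X) E.κ (by
    rw [hE.κ_precrossed, conj, ← Category.assoc, bflatMap_ι, Category.assoc, coprod.map_desc]
    simp)
  refine ⟨pullback.lift (pullback.snd _ _) (pullback.fst _ _ ≫ S.i)
    (by rw [S.i_c_elt, pullback.condition]) ≫ l, ?_, ?_⟩
  · refine Eq.trans ?_ h₁
    rw [← Category.assoc, comp_pullback_lift]
    congr 1
    apply pullback.hom_ext <;> simp
  · rw [← Category.assoc, comp_pullback_lift, ← h₂]
    congr 1
    apply pullback.hom_ext <;> simp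

theorem of_kernel_of_actions (S : GroupoidStr H) (hmono : Mono E.ι)
    (hlift : ∀ {T : C} (t : T ⟶ E.X), t ≫ E.σ = 0 → ∃ y : T ⟶ G.top, y ≫ E.ι = t)
    (hσ : IsRegularEpi E.σ)
    (l : pullback H.d E.σ ⟶ E.X)
    (l_e : pullback.lift (E.σ ≫ H.e) (𝟙 E.X) (by simp) ≫ l = 𝟙 E.X)
    (l_κ : pullback.lift S.gb 0 (by simp) ≫ l = E.κ)
    (r : pullback E.ρ G.c ⟶ E.X)
    (r_e : pullback.lift (𝟙 E.X) (E.ρ ≫ G.e) (by simp) ≫ r = 𝟙 E.X)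
    (r_ι : pullback.lift 0 G.g (by simp) ≫ r = E.ι) : IsButterfly E where
  ι_kernel := by
    choose f hf using @hlift
    exact ⟨KernelFork.IsLimit.ofι' _ _ fun t ht => ⟨f t ht, hf t ht⟩⟩
  σ_cokernel := by
    have h : ∀ {Z : C} (k : E.X ⟶ Z), E.ι ≫ k = 0 → ∃ k' : H.base ⟶ Z, E.σ ≫ k' = k := by
      intro Z k hk
      refine exists_desc_of_isRegularEpi E.σ k fun {U} t ht => ?_
      obtain ⟨y, rfl⟩ := hlift t ht
      rw [Category.assoc, hk, comp_zero]
    choose f hf using @h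
    exact ⟨CokernelCofork.IsColimit.ofπ' _ _ fun k hk => ⟨f k hk, hf k hk⟩⟩
  κ_precrossed := by
    have := H.equivariant_of_pullback_c_desc E.σ (𝟙 E.X) E.κ
      (pullback.lift (pullback.snd _ _ ≫ S.i) (pullback.fst _ _)
        (by rw [S.i_d_elt, pullback.condition]) ≫ l)
      (by
        refine Eq.trans ?_ l_e
        rw [← Category.assoc, comp_pullback_lift]
        congr 1
        apply pullback.hom_ext <;> simp)
      (by
        rw [← Category.assoc, comp_pullback_lift, ← l_κ]
        congr 1
        apply pullback.hom_ext <;> simp [GroupoidStr.gb])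
    rw [← this, conj, ← Category.assoc, bflatMap_ι, Category.assoc, coprod.map_desc]
    simp
  ι_precrossed := by
    have := G.equivariant_of_pullback_c_desc E.ρ (𝟙 E.X) E.ι r r_e r_ι
    rw [← this, conj, ← Category.assoc, bflatMap_ι, Category.assoc, coprod.map_desc]
    simp

/-- The action `E ×_{ρ, c} G₁ ⟶ E` of the groupoid of `G` on a butterfly. -/
noncomputable def ract (hE : IsButterfly E) : pullback E.ρ G.c ⟶ E.X := hE.exists_ract.choose

/-- The action `H₁ ×_{d, σ} E ⟶ E` of the groupoid of `H` on a butterfly. -/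
noncomputable def lact (S : GroupoidStr H) (hE : IsButterfly E) : pullback H.d E.σ ⟶ E.X :=
  (exists_lact S hE).choose

theorem ract_e (hE : IsButterfly E) :
    pullback.lift (𝟙 E.X) (E.ρ ≫ G.e) (by simp) ≫ hE.ract = 𝟙 E.X := hE.exists_ract.choose_spec.1

theorem ract_ι (hE : IsButterfly E) : pullback.lift 0 G.g (by simp) ≫ hE.ract = E.ι :=
  hE.exists_ract.choose_spec.2

theorem lact_e (S : GroupoidStr H) (hE : IsButterfly E) :
    pullback.lift (E.σ ≫ H.e) (𝟙 E.X) (by simp) ≫ hE.lact S = 𝟙 E.X :=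
  (exists_lact S hE).choose_spec.1

theorem lact_κ (S : GroupoidStr H) (hE : IsButterfly E) :
    pullback.lift S.gb 0 (by simp) ≫ hE.lact S = E.κ := (exists_lact S hE).choose_spec.2

/-- The result `x · a` of the action of `G₁` on generalized elements. -/
noncomputable def rsmul (hE : IsButterfly E) {T : C} (x : T ⟶ E.X) (a : T ⟶ G.arrows)
    (h : x ≫ E.ρ = a ≫ G.c) : T ⟶ E.X := pullback.lift x a h ≫ hE.ract

/-- The result `a · x` of the action of `H₁` on generalized elements. -/
noncomputable def lsmul (S : GroupoidStr H) (hE : IsButterfly E) {T : C} (a : T ⟶ H.arrows)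
    (x : T ⟶ E.X) (h : a ≫ H.d = x ≫ E.σ) : T ⟶ E.X := pullback.lift a x h ≫ hE.lact S

theorem rsmul_congr (hE : IsButterfly E) {T : C} {x x' : T ⟶ E.X} {a a' : T ⟶ G.arrows}
    (hx : x = x') (ha : a = a') (h : x ≫ E.ρ = a ≫ G.c) :
    hE.rsmul x a h = hE.rsmul x' a' (by rw [← hx, ← ha, h]) := by
  subst hx ha; rfl

theorem lsmul_congr (S : GroupoidStr H) (hE : IsButterfly E) {T : C} {a a' : T ⟶ H.arrows}
    {x x' : T ⟶ E.X} (ha : a = a') (hx : x = x') (h : a ≫ H.d = x ≫ E.σ) :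
    hE.lsmul S a x h = hE.lsmul S a' x' (by rw [← hx, ← ha, h]) := by
  subst hx ha; rfl

theorem comp_rsmul (hE : IsButterfly E) {T T' : C} (t : T' ⟶ T) (x : T ⟶ E.X)
    (a : T ⟶ G.arrows) (h : x ≫ E.ρ = a ≫ G.c) :
    t ≫ hE.rsmul x a h = hE.rsmul (t ≫ x) (t ≫ a) (by simp [h]) := by
  rw [rsmul, ← Category.assoc, comp_pullback_lift]; rfl

theorem comp_lsmul (S : GroupoidStr H) (hE : IsButterfly E) {T T' : C} (t : T' ⟶ T)
    (a : T ⟶ H.arrows) (x : T ⟶ E.X) (h : a ≫ H.d = x ≫ E.σ) :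
    t ≫ hE.lsmul S a x h = hE.lsmul S (t ≫ a) (t ≫ x) (by simp [h]) := by
  rw [lsmul, ← Category.assoc, comp_pullback_lift]; rfl

theorem rsmul_e (hE : IsButterfly E) {T : C} (x : T ⟶ E.X) (a : T ⟶ G.arrows)
    (ha : a = x ≫ E.ρ ≫ G.e) (h : x ≫ E.ρ = a ≫ G.c) : hE.rsmul x a h = x := by
  subst ha
  have := x ≫= hE.ract_e
  rw [← Category.assoc, comp_pullback_lift] at this
  simpa [rsmul] using this

theorem lsmul_e (S : GroupoidStr H) (hE : IsButterfly E) {T : C} (a : T ⟶ H.arrows)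
    (x : T ⟶ E.X) (ha : a = x ≫ E.σ ≫ H.e) (h : a ≫ H.d = x ≫ E.σ) :
    hE.lsmul S a x h = x := by
  subst ha
  have := x ≫= hE.lact_e S
  rw [← Category.assoc, comp_pullback_lift] at this
  simpa [lsmul] using this

theorem zero_rsmul_g (hE : IsButterfly E) {T : C} (x : T ⟶ E.X) (y : T ⟶ G.top) (hx : x = 0)
    (h : x ≫ E.ρ = (y ≫ G.g) ≫ G.c) : hE.rsmul x (y ≫ G.g) h = y ≫ E.ι := by
  subst hx
  have := y ≫= hE.ract_ι
  rw [← Category.assoc, comp_pullback_lift] at this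
  simpa [rsmul] using this

theorem gb_lsmul_zero (S : GroupoidStr H) (hE : IsButterfly E) {T : C} (y : T ⟶ H.top)
    (x : T ⟶ E.X) (hx : x = 0) (h : (y ≫ S.gb) ≫ H.d = x ≫ E.σ) :
    hE.lsmul S (y ≫ S.gb) x h = y ≫ E.κ := by
  subst hx
  have := y ≫= hE.lact_κ S
  rw [← Category.assoc, comp_pullback_lift] at this
  simpa [lsmul] using this

theorem ract_ρ (hE : IsButterfly E) : hE.ract ≫ E.ρ = pullback.snd E.ρ G.c ≫ G.d := by
  apply G.pullback_c_hom_ext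
  · rw [← Category.assoc, ract_e]; simp
  · rw [← Category.assoc, ract_ι]; simp

@[simp] theorem rsmul_ρ (hE : IsButterfly E) {T : C} (x : T ⟶ E.X) (a : T ⟶ G.arrows)
    (h : x ≫ E.ρ = a ≫ G.c) : hE.rsmul x a h ≫ E.ρ = a ≫ G.d := by
  rw [rsmul, Category.assoc, hE.ract_ρ, ← Category.assoc, pullback.lift_snd]

theorem ract_σ (hE : IsButterfly E) : hE.ract ≫ E.σ = pullback.fst E.ρ G.c ≫ E.σ := by
  apply G.pullback_c_hom_ext
  · rw [← Category.assoc, ract_e]; simp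
  · rw [← Category.assoc, ract_ι]; simp

@[simp] theorem rsmul_σ (hE : IsButterfly E) {T : C} (x : T ⟶ E.X) (a : T ⟶ G.arrows)
    (h : x ≫ E.ρ = a ≫ G.c) : hE.rsmul x a h ≫ E.σ = x ≫ E.σ := by
  rw [rsmul, Category.assoc, hE.ract_σ, ← Category.assoc, pullback.lift_fst]

theorem lact_σ (S : GroupoidStr H) (hE : IsButterfly E) :
    hE.lact S ≫ E.σ = pullback.fst H.d E.σ ≫ H.c := by
  apply S.pullback_d_hom_ext
  · rw [← Category.assoc, lact_e]; simp
  · rw [← Category.assoc, lact_κ]; simp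

@[simp] theorem lsmul_σ (S : GroupoidStr H) (hE : IsButterfly E) {T : C} (a : T ⟶ H.arrows)
    (x : T ⟶ E.X) (h : a ≫ H.d = x ≫ E.σ) : hE.lsmul S a x h ≫ E.σ = a ≫ H.c := by
  rw [lsmul, Category.assoc, hE.lact_σ S, ← Category.assoc, pullback.lift_fst]

theorem lact_ρ (S : GroupoidStr H) (hE : IsButterfly E) :
    hE.lact S ≫ E.ρ = pullback.snd H.d E.σ ≫ E.ρ := by
  apply S.pullback_d_hom_ext
  · rw [← Category.assoc, lact_e]; simp
  · rw [← Category.assoc, lact_κ]; simp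

@[simp] theorem lsmul_ρ (S : GroupoidStr H) (hE : IsButterfly E) {T : C} (a : T ⟶ H.arrows)
    (x : T ⟶ E.X) (h : a ≫ H.d = x ≫ E.σ) : hE.lsmul S a x h ≫ E.ρ = x ≫ E.ρ := by
  rw [lsmul, Category.assoc, hE.lact_ρ S, ← Category.assoc, pullback.lift_snd]

theorem rsmul_rsmul (S : GroupoidStr G) (hE : IsButterfly E) {T : C} (x : T ⟶ E.X)
    (a b : T ⟶ G.arrows) (h : x ≫ E.ρ = a ≫ G.c) (hab : b ≫ G.c = a ≫ G.d) :
    hE.rsmul (hE.rsmul x a h) b (by rw [rsmul_ρ, hab]) =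
      hE.rsmul x (S.mul b a hab) (by rw [S.mul_c, h]) := by
  have key := G.eq_of_natural_c (pullback.snd E.ρ G.c ≫ G.d)
    (fun p b hb => hE.rsmul (p ≫ hE.ract) b (by rw [← hb, Category.assoc, ract_ρ]))
    (fun p b hb => hE.rsmul (p ≫ pullback.fst _ _)
      (S.mul b (p ≫ pullback.snd _ _) (by rw [← hb, Category.assoc]))
      (by rw [S.mul_c, Category.assoc, pullback.condition, Category.assoc]))
    (fun t p b hb => by
      rw [comp_rsmul]
      exact hE.rsmul_congr (Category.assoc _ _ _).symm rfl _)
    (fun t p b hb => by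
      rw [comp_rsmul]
      refine hE.rsmul_congr (Category.assoc _ _ _).symm ?_ _
      rw [S.comp_mul]
      exact S.mul_congr rfl (Category.assoc _ _ _).symm _)
    (fun p b hb he => by
      have h₁ : b = (p ≫ hE.ract) ≫ E.ρ ≫ G.e := by
        simp only [he, Category.assoc, reassoc_of% hE.ract_ρ]
      have h₂ : S.mul b (p ≫ pullback.snd _ _) (by rw [← hb, Category.assoc]) =
          p ≫ pullback.snd _ _ := S.e_mul _ _ (by rw [he]; simp) _
      have h₃ : p ≫ hE.ract = hE.rsmul (p ≫ pullback.fst _ _) (p ≫ pullback.snd _ _)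
          (by rw [Category.assoc, pullback.condition, Category.assoc]) := by
        rw [rsmul, pullback_lift_eta]
      exact (hE.rsmul_e _ _ h₁ _).trans (h₃.trans (hE.rsmul_congr rfl h₂.symm _)))
    (fun p y hy hp => by
      have h₂ : S.mul (y ≫ G.g) (p ≫ pullback.snd _ _) (by rw [← hy, Category.assoc]) =
          y ≫ G.g := S.mul_e _ _ (by rw [hp]; simp) _
      refine (hE.zero_rsmul_g _ _ (by rw [hp, zero_comp]) _).trans
        ((hE.zero_rsmul_g _ _ (by rw [hp, zero_comp]) ?_).symm.trans
          (hE.rsmul_congr rfl h₂.symm _))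
      rw [hp]; simp)
    (pullback.lift x a h) b (by rw [← Category.assoc, pullback.lift_snd, hab])
  exact key.trans (hE.rsmul_congr (pullback.lift_fst _ _ _)
    (S.mul_congr rfl (pullback.lift_snd _ _ _) _) _)

theorem lsmul_lsmul (S : GroupoidStr H) (hE : IsButterfly E) {T : C} (a b : T ⟶ H.arrows)
    (x : T ⟶ E.X) (h : a ≫ H.d = x ≫ E.σ) (hab : a ≫ H.c = b ≫ H.d) :
    hE.lsmul S b (hE.lsmul S a x h) (by rw [lsmul_σ, hab]) =
      hE.lsmul S (S.mul a b hab) x (by rw [S.mul_d, h]) := by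
  have key := S.eq_of_natural_d (pullback.fst H.d E.σ ≫ H.c)
    (fun b p hb => hE.lsmul S b (p ≫ hE.lact S) (by rw [hb, Category.assoc, lact_σ]))
    (fun b p hb => hE.lsmul S (S.mul (p ≫ pullback.fst _ _) b (by rw [hb, Category.assoc]))
      (p ≫ pullback.snd _ _)
      (by rw [S.mul_d, Category.assoc, pullback.condition, Category.assoc]))
    (fun t b p hb => by
      rw [comp_lsmul]
      exact hE.lsmul_congr S rfl (Category.assoc _ _ _).symm _)
    (fun t b p hb => by
      rw [comp_lsmul]
      refine hE.lsmul_congr S ?_ (Category.assoc _ _ _).symm _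
      rw [S.comp_mul]
      exact S.mul_congr (Category.assoc _ _ _).symm rfl _)
    (fun b p hb he => by
      have h₁ : b = (p ≫ hE.lact S) ≫ E.σ ≫ H.e := by
        simp only [he, Category.assoc, reassoc_of% hE.lact_σ S]
      have h₂ : S.mul (p ≫ pullback.fst _ _) b (by rw [hb, Category.assoc]) =
          p ≫ pullback.fst _ _ := S.mul_e _ _ (by rw [he]; simp) _
      have h₃ : p ≫ hE.lact S = hE.lsmul S (p ≫ pullback.fst _ _) (p ≫ pullback.snd _ _)
          (by rw [Category.assoc, pullback.condition, Category.assoc]) := by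
        rw [lsmul, pullback_lift_eta]
      exact (hE.lsmul_e S _ _ h₁ _).trans (h₃.trans (hE.lsmul_congr S h₂.symm rfl _)))
    (fun y p hy hp => by
      have h₂ : S.mul (p ≫ pullback.fst _ _) (y ≫ S.gb) (by rw [hy, Category.assoc]) =
          y ≫ S.gb := S.e_mul _ _ (by rw [hp]; simp [reassoc_of% S.gb_d]) _
      refine (hE.gb_lsmul_zero S _ _ (by rw [hp, zero_comp]) _).trans
        ((hE.gb_lsmul_zero S _ _ (by rw [hp, zero_comp]) ?_).symm.trans
          (hE.lsmul_congr S h₂.symm rfl _))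
      rw [hp]; simp)
    b (pullback.lift a x h) (by rw [← Category.assoc, pullback.lift_fst, hab])
  exact key.trans (hE.lsmul_congr S (S.mul_congr (pullback.lift_fst _ _ _) rfl _)
    (pullback.lift_snd _ _ _) _)

theorem g_lsmul_κ (S : GroupoidStr H) (hE : IsButterfly E) {T : C} (y : T ⟶ H.top)
    (h : (y ≫ H.g) ≫ H.d = (y ≫ E.κ) ≫ E.σ) : hE.lsmul S (y ≫ H.g) (y ≫ E.κ) h = 0 := by
  have h₀ : (y ≫ S.gb) ≫ H.d = (0 : T ⟶ E.X) ≫ E.σ := by simp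
  have hm : S.mul (y ≫ S.gb) (y ≫ H.g) (by simp) = 0 :=
    (S.mul_congr (by simp [GroupoidStr.gb]) rfl _).trans ((S.inv_mul (y ≫ H.g)).trans (by simp))
  refine (hE.lsmul_congr S rfl (hE.gb_lsmul_zero S y 0 rfl h₀).symm _).trans ?_
  rw [hE.lsmul_lsmul S _ _ _ h₀ (by simp)]
  exact (hE.lsmul_congr S hm rfl _).trans (hE.lsmul_e S _ _ (by simp) _)

theorem ι_rsmul_gb (S : GroupoidStr G) (hE : IsButterfly E) {T : C} (y : T ⟶ G.top)
    (h : (y ≫ E.ι) ≫ E.ρ = (y ≫ S.gb) ≫ G.c) : hE.rsmul (y ≫ E.ι) (y ≫ S.gb) h = 0 := by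
  have h₀ : (0 : T ⟶ E.X) ≫ E.ρ = (y ≫ G.g) ≫ G.c := by simp
  have hm : S.mul (y ≫ S.gb) (y ≫ G.g) (by simp) = 0 :=
    (S.mul_congr (by simp [GroupoidStr.gb]) rfl _).trans ((S.inv_mul (y ≫ G.g)).trans (by simp))
  refine (hE.rsmul_congr (hE.zero_rsmul_g 0 y rfl h₀).symm rfl _).trans ?_
  rw [hE.rsmul_rsmul S _ _ _ h₀ (by simp)]
  exact (hE.rsmul_congr rfl hm _).trans (hE.rsmul_e _ _ (by simp) _)

theorem rsmul_und {E' : ButterflyDiagram H G} (hE : IsButterfly E) (hE' : IsButterfly E')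
    (f : E ⟶ E') {T : C} (x : T ⟶ E.X) (a : T ⟶ G.arrows) (h : x ≫ E.ρ = a ≫ G.c) :
    hE.rsmul x a h ≫ und f = hE'.rsmul (x ≫ und f) a (by simp [h]) := by
  refine G.eq_of_natural_c E.ρ (fun x a h => hE.rsmul x a h ≫ und f)
    (fun x a h => hE'.rsmul (x ≫ und f) a (by simp [h])) ?_ ?_ ?_ ?_ x a h
  · intro T T' t x a h
    rw [← Category.assoc, comp_rsmul]
  · intro T T' t x a h
    rw [comp_rsmul]
    exact hE'.rsmul_congr (Category.assoc _ _ _).symm rfl _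
  · intro T x a h ha
    rw [hE.rsmul_e x a ha, hE'.rsmul_e]
    rw [ha, Category.assoc, ← Category.assoc (und f), ButterflyDiagram.und_ρ]
  · intro T x y h hx
    rw [hE.zero_rsmul_g x y hx, hE'.zero_rsmul_g _ _ (by rw [hx, zero_comp]), Category.assoc,
      ButterflyDiagram.ι_und]

theorem lsmul_und {E' : ButterflyDiagram H G} (S : GroupoidStr H) (hE : IsButterfly E)
    (hE' : IsButterfly E') (f : E ⟶ E') {T : C} (a : T ⟶ H.arrows) (x : T ⟶ E.X)
    (h : a ≫ H.d = x ≫ E.σ) :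
    hE.lsmul S a x h ≫ und f = hE'.lsmul S a (x ≫ und f) (by simp [h]) := by
  refine S.eq_of_natural_d E.σ (fun a x h => hE.lsmul S a x h ≫ und f)
    (fun a x h => hE'.lsmul S a (x ≫ und f) (by simp [h])) ?_ ?_ ?_ ?_ a x h
  · intro T T' t a x h
    rw [← Category.assoc, comp_lsmul]
  · intro T T' t a x h
    rw [comp_lsmul]
    exact hE'.lsmul_congr S rfl (Category.assoc _ _ _).symm _
  · intro T a x h ha
    rw [hE.lsmul_e S a x ha, hE'.lsmul_e]
    rw [ha, Category.assoc, ← Category.assoc (und f), ButterflyDiagram.und_σ]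
  · intro T y x h hx
    rw [hE.gb_lsmul_zero S y x hx, hE'.gb_lsmul_zero S _ _ (by rw [hx, zero_comp]),
      Category.assoc, ButterflyDiagram.κ_und]

/-- The shearing morphism `(x, a) ↦ (x, x · a)`. -/
noncomputable def shear (hE : IsButterfly E) : pullback E.ρ G.c ⟶ pullback E.σ E.σ :=
  pullback.lift (pullback.fst E.ρ G.c) hE.ract hE.ract_σ.symm

theorem lift_shear (hE : IsButterfly E) {T : C} (x : T ⟶ E.X) (a : T ⟶ G.arrows)
    (h : x ≫ E.ρ = a ≫ G.c) : pullback.lift x a h ≫ hE.shear =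
      pullback.lift x (hE.rsmul x a h) (by rw [rsmul_σ]) := by
  apply pullback.hom_ext <;> simp [rsmul, shear]

/-- A butterfly is a torsor: `(x, a) ↦ (x, x · a)` identifies `E ×_{G₀} G₁` with
`E ×_{H₀} E`. -/
instance shear_isIso (hE : IsButterfly E) : IsIso hE.shear := by
  have : Mono hE.shear := by
    apply mono_of_kernel_elements
    intro U t ht
    have h₁ : t ≫ pullback.fst _ _ = 0 := by simpa [shear] using ht =≫ pullback.fst _ _
    have h₂ : t ≫ hE.ract = 0 := by simpa [shear] using ht =≫ pullback.snd _ _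
    obtain ⟨y, hy⟩ := G.exists_lift_g (t ≫ pullback.snd _ _) (by
      rw [Category.assoc, ← pullback.condition, ← Category.assoc, h₁, zero_comp])
    have h₃ : t = pullback.lift 0 (y ≫ G.g) (by simp) := by
      apply pullback.hom_ext <;> simp [h₁, hy]
    rw [h₃] at h₂
    have h₄ := (hE.zero_rsmul_g 0 y rfl (by simp)).symm.trans h₂
    apply pullback.hom_ext
    · rw [h₁, zero_comp]
    · rw [← hy, hE.eq_zero_of_ι y h₄, zero_comp, zero_comp]
  refine isIso_of_section_of_kernel_elements (pullback.fst _ _)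
    (pullback.lift (𝟙 _) (𝟙 _) rfl) (pullback.lift_fst _ _ _) _
    ⟨pullback.lift (𝟙 _) (𝟙 _ ≫ E.ρ ≫ G.e) (by simp), ?_⟩ ?_
  · exact (hE.lift_shear _ _ _).trans (pullback_lift_congr rfl (hE.rsmul_e _ _ rfl _) _)
  · intro U t ht
    obtain ⟨y, hy⟩ := hE.exists_lift_ι (t ≫ pullback.snd _ _) (by
      rw [Category.assoc, ← pullback.condition, ← Category.assoc, ht, zero_comp])
    refine ⟨pullback.lift 0 (y ≫ G.g) (by simp), (hE.lift_shear _ _ _).trans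
      ((pullback_lift_congr rfl (hE.zero_rsmul_g _ _ rfl _) _).trans ?_)⟩
    apply pullback.hom_ext <;> simp [ht, hy]

theorem exists_rsmul_eq (hE : IsButterfly E) {T : C} (x x' : T ⟶ E.X)
    (h : x ≫ E.σ = x' ≫ E.σ) :
    ∃ (a : T ⟶ G.arrows) (ha : x ≫ E.ρ = a ≫ G.c), hE.rsmul x a ha = x' := by
  obtain ⟨t, ht⟩ : ∃ t, t ≫ hE.shear = pullback.lift x x' h :=
    ⟨pullback.lift x x' h ≫ inv hE.shear, by simp⟩
  have h₁ : t ≫ pullback.fst _ _ = x := by simpa [shear] using ht =≫ pullback.fst _ _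
  have h₂ : t ≫ hE.ract = x' := by simpa [shear] using ht =≫ pullback.snd _ _
  refine ⟨t ≫ pullback.snd _ _, by rw [← h₁, Category.assoc, pullback.condition,
    Category.assoc], ?_⟩
  rw [← h₂, rsmul]
  congr 1
  apply pullback.hom_ext <;> simp [h₁]

theorem rsmul_right_injective (hE : IsButterfly E) {T : C} (x : T ⟶ E.X) (a a' : T ⟶ G.arrows)
    (h : x ≫ E.ρ = a ≫ G.c) (h' : x ≫ E.ρ = a' ≫ G.c) (haa : hE.rsmul x a h = hE.rsmul x a' h') :
    a = a' := by
  have : pullback.lift x a h = pullback.lift x a' h' := by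
    rw [← cancel_mono hE.shear, lift_shear, lift_shear]
    exact pullback_lift_congr rfl haa _
  simpa using this =≫ pullback.snd _ _

theorem isIso_und {E' : ButterflyDiagram H G} (hE : IsButterfly E) (hE' : IsButterfly E')
    (f : E ⟶ E') : IsIso (und f) := by
  have : Mono (und f) := by
    apply mono_of_kernel_elements
    intro U t ht
    obtain ⟨y, rfl⟩ := hE.exists_lift_ι t (by
      rw [← ButterflyDiagram.und_σ f, ← Category.assoc, ht, zero_comp])
    rw [hE'.eq_zero_of_ι y (by rw [← ht, Category.assoc, ButterflyDiagram.ι_und]), zero_comp]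
  have := hE.σ_isRegularEpi
  obtain ⟨T, p, hp, x, hx⟩ := exists_cover E.σ E'.σ
  obtain ⟨a, ha, hxa⟩ := hE'.exists_rsmul_eq (x ≫ und f) p (by simp [hx])
  obtain ⟨l, hl⟩ := exists_lift_of_cover p (und f) (𝟙 _)
    (hE.rsmul x a (by rw [← ha]; simp)) (by rw [rsmul_und hE hE', hxa, Category.comp_id])
  exact ⟨l, by rw [← cancel_mono (und f), Category.assoc, hl]; simp, hl⟩

/-- Every morphism between butterflies is invertible. -/
noncomputable def isoOfHom {E' : ButterflyDiagram H G} (hE : IsButterfly E)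
    (hE' : IsButterfly E') (f : E ⟶ E') : E ≅ E' :=
  have := isIso_und hE hE' f
  { hom := f
    inv :=
      { hom := inv (und f)
        κ_hom := by rw [IsIso.comp_inv_eq, ButterflyDiagram.κ_und]
        ι_hom := by rw [IsIso.comp_inv_eq, ButterflyDiagram.ι_und]
        hom_σ := by rw [IsIso.inv_comp_eq, ButterflyDiagram.und_σ]
        hom_ρ := by rw [IsIso.inv_comp_eq, ButterflyDiagram.und_ρ] }
    hom_inv_id := ButterflyDiagram.und_ext (IsIso.hom_inv_id (und f))
    inv_hom_id := ButterflyDiagram.und_ext (IsIso.inv_hom_id (und f)) }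

end IsButterfly

/-! ### Composites of butterflies -/

namespace ButterflyDiagram

variable {C : Type u} [Category.{v} C] [HasZeroMorphisms C] [SemiAbelian C]
variable {L K H G : XMod C}

theorem exists_cover_cpair (E : ButterflyDiagram H G) (F : ButterflyDiagram G K) {T : C}
    (z : T ⟶ (comp E F).X) : ∃ (T' : C) (p : T' ⟶ T) (_ : IsRegularEpi p) (x : T' ⟶ E.X)
      (y : T' ⟶ F.X) (h : x ≫ E.ρ = y ≫ F.σ), p ≫ z = cpair E F x y h := by
  have : IsRegularEpi (quot E F) := inferInstanceAs (IsRegularEpi (coequalizer.π _ _))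
  obtain ⟨T', p, hp, w, hw⟩ := exists_cover (quot E F) z
  refine ⟨T', p, hp, w ≫ pullback.fst _ _, w ≫ pullback.snd _ _, by
    rw [Category.assoc, pullback.condition, Category.assoc], ?_⟩
  rw [hw, cpair, pullback_lift_eta]

theorem cpair_zero (E : ButterflyDiagram H G) (F : ButterflyDiagram G K) {T : C}
    (x : T ⟶ E.X) (y : T ⟶ F.X) (hx : x = 0) (hy : y = 0) (h : x ≫ E.ρ = y ≫ F.σ) :
    cpair E F x y h = 0 := by
  have : pullback.lift x y h = 0 := by
    subst hx hy
    apply pullback.hom_ext <;> simp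
  rw [cpair, this, zero_comp]

theorem cpair_ι_κ (E : ButterflyDiagram H G) (F : ButterflyDiagram G K) {T : C}
    (y : T ⟶ G.top) (x : T ⟶ E.X) (x' : T ⟶ F.X) (hx : x = y ≫ E.ι) (hx' : x' = y ≫ F.κ)
    (h : x ≫ E.ρ = x' ≫ F.σ) : cpair E F x x' h = 0 := by
  subst hx hx'
  have := y ≫= mid_quot E F
  rw [mid, ← Category.assoc, comp_pullback_lift, comp_zero] at this
  exact this

theorem comp_cpair_κ (E : ButterflyDiagram H G) (F : ButterflyDiagram G K) {T : C}
    (y : T ⟶ H.top) (x : T ⟶ F.X) (hx : x = 0) (h : (y ≫ E.κ) ≫ E.ρ = x ≫ F.σ) :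
    cpair E F (y ≫ E.κ) x h = y ≫ (comp E F).κ := by
  rw [comp_κ, comp_cpair]
  exact cpair_congr E F rfl (by rw [hx, comp_zero]) _

theorem quot_isRegularEpi (E : ButterflyDiagram H G) (F : ButterflyDiagram G K) :
    IsRegularEpi (quot E F) :=
  inferInstanceAs (IsRegularEpi (coequalizer.π _ _))

end ButterflyDiagram

open ButterflyDiagram

namespace IsButterfly

variable {C : Type u} [Category.{v} C] [HasZeroMorphisms C] [SemiAbelian C]
variable {L K H G : XMod C} {E : ButterflyDiagram H G} {F : ButterflyDiagram G K}

/-- The two actions of `G₁` are identified in the composite. -/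
theorem cpair_rsmul_lsmul (S : GroupoidStr G) (hE : IsButterfly E) (hF : IsButterfly F) {T : C}
    (x : T ⟶ E.X) (y : T ⟶ F.X) (a : T ⟶ G.arrows) (hx : x ≫ E.ρ = a ≫ G.c)
    (hy : (a ≫ S.i) ≫ G.d = y ≫ F.σ) :
    cpair E F (hE.rsmul x a hx) (hF.lsmul S (a ≫ S.i) y hy)
      (by rw [rsmul_ρ, lsmul_σ, S.i_c_elt]) =
      cpair E F x y (by rw [hx, ← hy, S.i_d_elt]) := by
  have h₀ : ∀ {U : C} (p : U ⟶ pullback E.ρ F.σ) (a : U ⟶ G.arrows)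
      (_ : p ≫ pullback.fst _ _ ≫ E.ρ = a ≫ G.c),
      (p ≫ pullback.fst _ _) ≫ E.ρ = a ≫ G.c := fun p a h => by rw [Category.assoc, h]
  have h₁ : ∀ {U : C} (p : U ⟶ pullback E.ρ F.σ) (a : U ⟶ G.arrows)
      (_ : p ≫ pullback.fst _ _ ≫ E.ρ = a ≫ G.c),
      (a ≫ S.i) ≫ G.d = (p ≫ pullback.snd _ _) ≫ F.σ := fun p a h => by
    rw [S.i_d_elt, ← h, pullback.condition, Category.assoc]
  have key := G.eq_of_natural_c (pullback.fst E.ρ F.σ ≫ E.ρ)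
    (fun p a h => cpair E F (hE.rsmul (p ≫ pullback.fst _ _) a (h₀ p a h))
      (hF.lsmul S (a ≫ S.i) (p ≫ pullback.snd _ _) (h₁ p a h))
      (by rw [rsmul_ρ, lsmul_σ, S.i_c_elt]))
    (fun p a h => p ≫ quot E F)
    (fun t p a h => by
      rw [comp_cpair]
      refine cpair_congr E F ?_ ?_ _
      · rw [comp_rsmul]
        exact hE.rsmul_congr (Category.assoc _ _ _).symm rfl _
      · rw [comp_lsmul]
        exact hF.lsmul_congr S (Category.assoc _ _ _).symm (Category.assoc _ _ _).symm _)
    (fun t p a h => (Category.assoc _ _ _).symm)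
    (fun p a h ha => by
      have e₁ : p ≫ quot E F = cpair E F (p ≫ pullback.fst _ _) (p ≫ pullback.snd _ _)
          (by rw [Category.assoc, pullback.condition, Category.assoc]) := by
        rw [cpair, pullback_lift_eta]
      refine Eq.trans ?_ e₁.symm
      refine cpair_congr E F (hE.rsmul_e _ _ (by rw [ha]; simp) _)
        (hF.lsmul_e S _ _ ?_ _) _
      rw [ha]
      simp [pullback.condition_assoc])
    (fun p y h hp => by
      subst hp
      refine Eq.trans ?_ zero_comp.symm
      refine cpair_ι_κ E F y _ _ (hE.zero_rsmul_g _ _ zero_comp _) ?_ _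
      exact (hF.lsmul_congr S (Category.assoc _ _ _) zero_comp _).trans
        (hF.gb_lsmul_zero S y 0 rfl _))
    (pullback.lift x y (by rw [hx, ← hy, S.i_d_elt])) a
    (by rw [← Category.assoc, pullback.lift_fst, hx])
  refine Eq.trans (cpair_congr E F (hE.rsmul_congr (pullback.lift_fst _ _ _).symm rfl _)
    (hF.lsmul_congr S rfl (pullback.lift_snd _ _ _).symm _) _) key

/-- The morphism `⟨ι, κ'⟩` is the kernel of its cokernel. The orbits of the diagonal action of
`G₁` on `E ×_{G₀} F` form a reflexive relation, hence an effective equivalence relation, with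
`⟨ι, κ'⟩` as its class of zero. -/
theorem exists_lift_mid (S : GroupoidStr G) (hE : IsButterfly E) (hF : IsButterfly F) {T : C}
    (t : T ⟶ pullback E.ρ F.σ) (ht : t ≫ quot E F = 0) :
    ∃ y : T ⟶ G.top, t = y ≫ mid E F := by
  let r : pullback E.ρ F.σ ⟶ G.base := pullback.fst _ _ ≫ E.ρ
  let W := pullback r G.c
  have hx : (pullback.fst r G.c ≫ pullback.fst _ _) ≫ E.ρ = pullback.snd r G.c ≫ G.c := by
    rw [Category.assoc]; exact pullback.condition
  have hy : (pullback.snd r G.c ≫ S.i) ≫ G.d =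
      (pullback.fst r G.c ≫ pullback.snd _ _) ≫ F.σ := by
    rw [S.i_d_elt, ← hx]
    simp only [Category.assoc]
    rw [pullback.condition (f := E.ρ) (g := F.σ)]
  let r₂ : W ⟶ pullback E.ρ F.σ :=
    pullback.lift (hE.rsmul (pullback.fst r G.c ≫ pullback.fst _ _) (pullback.snd r G.c) hx)
      (hF.lsmul S (pullback.snd r G.c ≫ S.i) (pullback.fst r G.c ≫ pullback.snd _ _) hy)
      (by rw [rsmul_ρ, lsmul_σ, S.i_c_elt])
  have hr : ∀ {U : C} (w : U ⟶ W),
      (w ≫ r₂) ≫ pullback.fst _ _ = hE.rsmul (w ≫ pullback.fst r G.c ≫ pullback.fst _ _)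
        (w ≫ pullback.snd r G.c) (by rw [Category.assoc, hx, Category.assoc]) := by
    intro U w
    rw [Category.assoc, pullback.lift_fst, comp_rsmul]
  have hr' : ∀ {U : C} (w : U ⟶ W),
      (w ≫ r₂) ≫ pullback.snd _ _ = hF.lsmul S (w ≫ pullback.snd r G.c ≫ S.i)
        (w ≫ pullback.fst r G.c ≫ pullback.snd _ _)
        (by have := w ≫= hy; simpa only [Category.assoc] using this) := by
    intro U w
    rw [Category.assoc, pullback.lift_snd, comp_lsmul]
  have hequiv : IsEquivalenceRelation (pullback.fst r G.c) r₂ := by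
    refine isEquivalenceRelation_of_reflexive _ _ ?_
      (pullback.lift (𝟙 _) (r ≫ G.e) (by simp)) (pullback.lift_fst _ _ _) ?_
    · intro U f g h₁ h₂
      apply pullback.hom_ext h₁
      have h₃ := h₂ =≫ pullback.fst _ _
      rw [hr, hr] at h₃
      refine hE.rsmul_right_injective (f ≫ pullback.fst r G.c ≫ pullback.fst _ _) _ _ ?_ ?_
        (h₃.trans (hE.rsmul_congr ?_ rfl _))
      · have := f ≫= hx
        simpa only [Category.assoc] using this
      · have := g ≫= hx
        simpa only [Category.assoc, reassoc_of% h₁] using this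
      · rw [← Category.assoc, ← h₁, Category.assoc]
    · apply pullback.hom_ext
      · rw [hr]
        refine (hE.rsmul_e _ _ ?_ _).trans ?_
        · simp [r]
        · simp
      · rw [hr']
        refine (hF.lsmul_e S _ _ ?_ _).trans ?_
        · simp [r, pullback.condition_assoc]
        · simp
  obtain ⟨Y, f, hf⟩ := SemiAbelian.effective _ _ hequiv
  have hmid : mid E F ≫ f = 0 := by
    have h := pullback.lift (0 : G.top ⟶ pullback E.ρ F.σ) G.g (by simp) ≫= hf.w
    rw [← Category.assoc, pullback.lift_fst, zero_comp, ← Category.assoc] at h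
    rw [h]
    congr 1
    apply pullback.hom_ext
    · rw [hr, mid, pullback.lift_fst]
      refine Eq.trans ?_ ((hE.zero_rsmul_g (0 : G.top ⟶ E.X) (𝟙 _) rfl (by simp)).symm.trans
        (hE.rsmul_congr ?_ ?_ _))
      · simp
      · simp
      · simp
    · rw [hr', mid, pullback.lift_snd]
      refine Eq.trans ?_ ((hF.gb_lsmul_zero S (𝟙 _) (0 : G.top ⟶ F.X) rfl (by simp)).symm.trans
        (hF.lsmul_congr S ?_ ?_ _))
      · simp
      · simp [GroupoidStr.gb]
      · simp
  have htf : (0 : T ⟶ pullback E.ρ F.σ) ≫ f = t ≫ f := by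
    rw [← quot_desc E F f hmid, ← Category.assoc t, ht, zero_comp, zero_comp]
  obtain ⟨w, hw₁, hw₂⟩ : ∃ w : T ⟶ W, w ≫ pullback.fst r G.c = 0 ∧ w ≫ r₂ = t :=
    ⟨hf.lift _ _ htf, hf.lift_fst _ _ _, hf.lift_snd _ _ _⟩
  obtain ⟨y, hy'⟩ := G.exists_lift_g (w ≫ pullback.snd r G.c) (by
    rw [Category.assoc, ← pullback.condition, ← Category.assoc, hw₁, zero_comp])
  refine ⟨y, ?_⟩
  rw [← hw₂]
  apply pullback.hom_ext
  · rw [hr, mid]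
    refine Eq.trans ?_ ((Category.assoc _ _ _).trans (y ≫= pullback.lift_fst _ _ _)).symm
    refine (hE.rsmul_congr ?_ hy'.symm _).trans (hE.zero_rsmul_g 0 y rfl ?_)
    · rw [reassoc_of% hw₁, zero_comp]
    · simp
  · rw [hr', mid]
    refine Eq.trans ?_ ((Category.assoc _ _ _).trans (y ≫= pullback.lift_snd _ _ _)).symm
    refine (hF.lsmul_congr S ?_ ?_ _).trans (hF.gb_lsmul_zero S y 0 rfl ?_)
    · rw [← Category.assoc, ← hy', Category.assoc]; rfl
    · rw [reassoc_of% hw₁, zero_comp]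
    · simp

/-- Descent along the quotient `E ×_{G₀} F ⟶ EF`: a natural construction on generalized elements
`t` of `D` with a chosen representative of `u t` as `[x, y]` yields a morphism out of `D` as
soon as it vanishes on the representatives `(ι, κ')` of zero. -/
theorem exists_desc_cpair (S : GroupoidStr G) (hE : IsButterfly E) (hF : IsButterfly F)
    {D Z : C} (u : D ⟶ (comp E F).X)
    (Φ : ∀ {T : C} (t : T ⟶ D) (x : T ⟶ E.X) (y : T ⟶ F.X) (hxy : x ≫ E.ρ = y ≫ F.σ),
      t ≫ u = cpair E F x y hxy → (T ⟶ Z))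
    (hΦ : ∀ {T T' : C} (s : T' ⟶ T) (t : T ⟶ D) (x : T ⟶ E.X) (y : T ⟶ F.X)
      (hxy : x ≫ E.ρ = y ≫ F.σ) (h : t ≫ u = cpair E F x y hxy),
      s ≫ Φ t x y hxy h = Φ (s ≫ t) (s ≫ x) (s ≫ y) (by simp [hxy])
        (by rw [Category.assoc, h, comp_cpair]))
    (h₀ : ∀ {T : C} (y : T ⟶ G.top) (hxy : (y ≫ E.ι) ≫ E.ρ = (y ≫ F.κ) ≫ F.σ)
      (h : (0 : T ⟶ D) ≫ u = cpair E F (y ≫ E.ι) (y ≫ F.κ) hxy),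
      Φ 0 (y ≫ E.ι) (y ≫ F.κ) hxy h = 0) :
    ∃ φ : D ⟶ Z, ∀ {T : C} (t : T ⟶ D) (x : T ⟶ E.X) (y : T ⟶ F.X)
      (hxy : x ≫ E.ρ = y ≫ F.σ) (h : t ≫ u = cpair E F x y hxy), t ≫ φ = Φ t x y hxy h := by
  have := quot_isRegularEpi E F
  have hc : (pullback.snd u (quot E F) ≫ pullback.fst _ _) ≫ E.ρ =
      (pullback.snd u (quot E F) ≫ pullback.snd _ _) ≫ F.σ := by
    rw [Category.assoc, pullback.condition, Category.assoc]
  have hu : pullback.fst u (quot E F) ≫ u = cpair E F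
      (pullback.snd u (quot E F) ≫ pullback.fst _ _)
      (pullback.snd u (quot E F) ≫ pullback.snd _ _) hc := by
    rw [cpair, pullback_lift_eta, pullback.condition]
  have hcongr : ∀ {T : C} {t t' : T ⟶ D} {x x' : T ⟶ E.X} {y y' : T ⟶ F.X} (_ : t = t')
      (_ : x = x') (_ : y = y') (hxy : x ≫ E.ρ = y ≫ F.σ) (h : t ≫ u = cpair E F x y hxy)
      (hxy' : x' ≫ E.ρ = y' ≫ F.σ) (h' : t' ≫ u = cpair E F x' y' hxy'),
      Φ t x y hxy h = Φ t' x' y' hxy' h' := by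
    intro T t t' x x' y y' ht hx hy
    subst ht hx hy
    intros
    rfl
  obtain ⟨φ, hφ⟩ := exists_desc_of_isRegularEpi (pullback.fst u (quot E F))
    (Φ (pullback.fst u (quot E F)) _ _ hc hu) (by
      intro U t ht
      obtain ⟨y, hy⟩ := exists_lift_mid S hE hF (t ≫ pullback.snd _ _) (by
        rw [Category.assoc, ← pullback.condition, ← Category.assoc, ht, zero_comp])
      have e₁ : t ≫ pullback.snd u (quot E F) ≫ pullback.fst _ _ = y ≫ E.ι := by
        rw [← Category.assoc, hy, mid, Category.assoc, pullback.lift_fst]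
      have e₂ : t ≫ pullback.snd u (quot E F) ≫ pullback.snd _ _ = y ≫ F.κ := by
        rw [← Category.assoc, hy, mid, Category.assoc, pullback.lift_snd]
      rw [hΦ]
      refine (hcongr ht e₁ e₂ _ _ (by simp) ?_).trans (h₀ y (by simp) ?_)
      all_goals
        rw [zero_comp]
        exact (cpair_ι_κ E F y _ _ rfl rfl _).symm)
  refine ⟨φ, fun {T} t x y hxy h => ?_⟩
  have := pullback.lift t (pullback.lift x y hxy) (by rw [h, cpair]) ≫= hφ
  rw [hΦ] at this
  refine Eq.trans ?_ ((Category.assoc _ _ _).trans (this.trans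
    (hcongr (by simp) (by simp) (by simp) _ _ _ _)))
  rw [pullback.lift_fst]

/-- The composite of two butterflies is a butterfly. -/
theorem comp (S : GroupoidStr H) (S' : GroupoidStr G) (hE : IsButterfly E)
    (hF : IsButterfly F) : IsButterfly (ButterflyDiagram.comp E F) := by
  have hq := quot_isRegularEpi E F
  have hσE := hE.σ_isRegularEpi
  have hσF := hF.σ_isRegularEpi
  have hmono : Mono (ButterflyDiagram.comp E F).ι := by
    apply mono_of_kernel_elements
    intro U t ht
    rw [comp_ι, cpair, ← Category.assoc] at ht
    obtain ⟨y, hy⟩ := exists_lift_mid S' hE hF _ ht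
    have h₁ : y = 0 := hE.eq_zero_of_ι y (by simpa [mid] using (hy =≫ pullback.fst _ _).symm)
    refine hF.eq_zero_of_ι t ?_
    simpa [mid, h₁] using hy =≫ pullback.snd _ _
  have hσ : IsRegularEpi (ButterflyDiagram.comp E F).σ := by
    have : IsRegularEpi (quot E F ≫ (ButterflyDiagram.comp E F).σ) := by
      rw [quot_σ]
      exact isRegularEpi_comp _ _
    exact isRegularEpi_of_comp (quot E F) _
  obtain ⟨l, hl⟩ := exists_desc_cpair S' hE hF
    (pullback.snd H.d (ButterflyDiagram.comp E F).σ)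
    (fun t x y hxy h => cpair E F (hE.lsmul S (t ≫ pullback.fst _ _) x (by
      have := h =≫ (ButterflyDiagram.comp E F).σ
      rw [cpair_σ] at this
      rw [← this, Category.assoc, pullback.condition, Category.assoc])) y
      (by rw [lsmul_ρ, hxy]))
    (fun s t x y hxy h => by
      rw [comp_cpair]
      refine cpair_congr E F ?_ rfl _
      rw [comp_lsmul]
      exact hE.lsmul_congr S (Category.assoc _ _ _).symm rfl _)
    (fun y hxy h => cpair_ι_κ E F y _ _ (hE.lsmul_e S _ _ (by simp [reassoc_of% E.ι_σ]) _) rfl _)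
  obtain ⟨r, hr⟩ := exists_desc_cpair S' hE hF
    (pullback.fst (ButterflyDiagram.comp E F).ρ K.c)
    (fun t x y hxy h => cpair E F x (hF.rsmul y (t ≫ pullback.snd _ _) (by
      have := h =≫ (ButterflyDiagram.comp E F).ρ
      rw [cpair_ρ] at this
      rw [← this, Category.assoc, pullback.condition, Category.assoc])) (by rw [rsmul_σ, hxy]))
    (fun s t x y hxy h => by
      rw [comp_cpair]
      refine cpair_congr E F rfl ?_ _
      rw [comp_rsmul]
      exact hF.rsmul_congr rfl (Category.assoc _ _ _).symm _)
    (fun y hxy h => cpair_ι_κ E F y _ _ rfl (hF.rsmul_e _ _ (by simp [reassoc_of% F.κ_ρ]) _) _)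
  refine of_kernel_of_actions S hmono ?_ hσ l ?_ ?_ r ?_ ?_
  · intro T t ht
    obtain ⟨T', p, hp, x, y, hxy, hz⟩ := exists_cover_cpair E F t
    obtain ⟨w, hw⟩ := hE.exists_lift_ι x (by
      rw [← cpair_σ E F x y hxy, ← hz, Category.assoc, ht, comp_zero])
    have h₁ : (0 : T' ⟶ E.X) ≫ E.ρ = (w ≫ G.g) ≫ G.c := by simp
    have h₂ : (w ≫ G.g) ≫ G.d = y ≫ F.σ := by
      rw [← hxy, ← hw]; simp
    have h₃ : ((w ≫ G.g) ≫ S'.i) ≫ G.d = (hF.lsmul S' (w ≫ G.g) y h₂) ≫ F.σ := by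
      rw [S'.i_d_elt, lsmul_σ]
    obtain ⟨k, hk⟩ := hF.exists_lift_ι (hF.lsmul S' (w ≫ G.g) y h₂) (by simp)
    refine exists_lift_of_cover p _ t k ?_
    rw [hz, comp_ι, comp_cpair]
    have h₄ := cpair_rsmul_lsmul S' hE hF 0 (hF.lsmul S' (w ≫ G.g) y h₂) (w ≫ G.g) h₁ h₃
    refine Eq.trans (cpair_congr E F ?_ ?_ _) (h₄.trans (cpair_congr E F ?_ hk.symm _))
    · rw [← hw]
      exact (hE.zero_rsmul_g 0 w rfl h₁).symm
    · rw [hF.lsmul_lsmul S' _ _ _ h₂ (by rw [S'.i_d_elt])]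
      refine (hF.lsmul_e S' _ _ ?_ _).symm
      rw [S'.mul_inv, ← Category.assoc y, ← h₂]
      simp only [Category.assoc]
    · rw [comp_zero]
  · rw [← cancel_epi (quot E F)]
    rw [← Category.assoc, comp_pullback_lift]
    refine (hl _ (pullback.fst _ _) (pullback.snd _ _) pullback.condition ?_).trans ?_
    · simp [cpair]
    · refine Eq.trans ?_ (Category.comp_id _).symm
      refine (cpair_congr E F (hE.lsmul_e S _ _ ?_ _) rfl _).trans ?_
      · rw [pullback.lift_fst, ← Category.assoc, quot_σ, Category.assoc]
      · simp [cpair]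
  · refine (hl _ 0 0 (by simp) ?_).trans ?_
    · rw [pullback.lift_snd]
      exact (cpair_zero E F _ _ rfl rfl _).symm
    · rw [comp_κ]
      refine cpair_congr E F ?_ rfl _
      refine (hE.lsmul_congr S ?_ rfl _).trans
        ((hE.gb_lsmul_zero S (𝟙 _) 0 rfl ?_).trans (Category.id_comp _))
      · simp
      · simp
  · rw [← cancel_epi (quot E F)]
    rw [← Category.assoc, comp_pullback_lift]
    refine (hr _ (pullback.fst _ _) (pullback.snd _ _) pullback.condition ?_).trans ?_
    · simp [cpair]
    · refine Eq.trans ?_ (Category.comp_id _).symm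
      refine (cpair_congr E F rfl (hF.rsmul_e _ _ ?_ _) _).trans ?_
      · rw [pullback.lift_snd, ← Category.assoc, quot_ρ, Category.assoc]
      · simp [cpair]
  · refine (hr _ 0 0 (by simp) ?_).trans ?_
    · rw [pullback.lift_fst]
      exact (cpair_zero E F _ _ rfl rfl _).symm
    · rw [comp_ι]
      refine cpair_congr E F rfl ?_ _
      refine (hF.rsmul_congr rfl ?_ _).trans
        ((hF.zero_rsmul_g 0 (𝟙 _) rfl ?_).trans (Category.id_comp _))
      · simp
      · simp

theorem lsmul_cpair (S : GroupoidStr H) (hE : IsButterfly E)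
    (hEF : IsButterfly (ButterflyDiagram.comp E F)) {T : C} (a : T ⟶ H.arrows)
    (x : T ⟶ E.X) (y : T ⟶ F.X) (hxy : x ≫ E.ρ = y ≫ F.σ) (h : a ≫ H.d = x ≫ E.σ) :
    hEF.lsmul S a (cpair E F x y hxy) (by rw [cpair_σ, h]) =
      cpair E F (hE.lsmul S a x h) y (by rw [lsmul_ρ, hxy]) := by
  have hp : ∀ {U : C} (a : U ⟶ H.arrows) (p : U ⟶ pullback E.ρ F.σ)
      (_ : a ≫ H.d = p ≫ pullback.fst _ _ ≫ E.σ),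
      a ≫ H.d = (p ≫ quot E F) ≫ (ButterflyDiagram.comp E F).σ := fun a p h => by
    rw [Category.assoc, quot_σ, h]
  have hp' : ∀ {U : C} (a : U ⟶ H.arrows) (p : U ⟶ pullback E.ρ F.σ)
      (_ : a ≫ H.d = p ≫ pullback.fst _ _ ≫ E.σ),
      a ≫ H.d = (p ≫ pullback.fst _ _) ≫ E.σ := fun a p h => by
    rw [Category.assoc, h]
  have key := S.eq_of_natural_d (pullback.fst E.ρ F.σ ≫ E.σ)
    (fun a p h => hEF.lsmul S a (p ≫ quot E F) (hp a p h))
    (fun a p h => cpair E F (hE.lsmul S a (p ≫ pullback.fst _ _) (hp' a p h))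
      (p ≫ pullback.snd _ _) (by
        rw [lsmul_ρ, Category.assoc, pullback.condition, Category.assoc]))
    (fun t a p h => by
      rw [comp_lsmul]
      exact hEF.lsmul_congr S rfl (Category.assoc _ _ _).symm _)
    (fun t a p h => by
      rw [comp_cpair]
      refine cpair_congr E F ?_ (Category.assoc _ _ _).symm _
      rw [comp_lsmul]
      exact hE.lsmul_congr S rfl (Category.assoc _ _ _).symm _)
    (fun a p h ha => by
      have h₁ : hEF.lsmul S a (p ≫ quot E F) (hp a p h) = p ≫ quot E F :=
        hEF.lsmul_e S _ _ (by
          rw [ha, Category.assoc p (quot E F), ← Category.assoc (quot E F), quot_σ]) _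
      have h₂ : hE.lsmul S a (p ≫ pullback.fst _ _) (hp' a p h) = p ≫ pullback.fst _ _ :=
        hE.lsmul_e S _ _ (by rw [ha]; simp) _
      refine h₁.trans (Eq.trans ?_ (cpair_congr E F h₂.symm rfl (by
        rw [Category.assoc, pullback.condition, Category.assoc])))
      rw [cpair, pullback_lift_eta])
    (fun y p h h0 => by
      refine (hEF.gb_lsmul_zero S y _ (by rw [h0, zero_comp]) _).trans ?_
      rw [← comp_cpair_κ E F y 0 rfl (by simp)]
      refine cpair_congr E F ?_ ?_ _
      · exact (hE.gb_lsmul_zero S y _ (by rw [h0, zero_comp]) _).symm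
      · rw [h0, zero_comp])
    a (pullback.lift x y hxy) (by rw [← Category.assoc, pullback.lift_fst, h])
  refine key.trans (cpair_congr E F (hE.lsmul_congr S rfl (pullback.lift_fst _ _ _) _)
    (pullback.lift_snd _ _ _) _)

end IsButterfly

/-! ### Reduced composites and identity butterflies -/

namespace ButterflyDiagram

variable {C : Type u} [Category.{v} C] [HasZeroMorphisms C] [SemiAbelian C]
variable {L K H G M : XMod C}

theorem rpair_congr (Q : K ⟶ H) (E : ButterflyDiagram H G) {T : C} {k k' : T ⟶ K.base}
    {x x' : T ⟶ E.X} (hk : k = k') (hx : x = x') (h : k ≫ XModHom.base Q = x ≫ E.σ) :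
    rpair Q E k x h = rpair Q E k' x' (by rw [← hk, ← hx, h]) := by
  subst hk hx; rfl

theorem comp_rpair (Q : K ⟶ H) (E : ButterflyDiagram H G) {T T' : C} (t : T' ⟶ T)
    (k : T ⟶ K.base) (x : T ⟶ E.X) (h : k ≫ XModHom.base Q = x ≫ E.σ) :
    t ≫ rpair Q E k x h = rpair Q E (t ≫ k) (t ≫ x) (by simp [h]) :=
  comp_pullback_lift ..

theorem exists_rpair (Q : K ⟶ H) (E : ButterflyDiagram H G) {T : C} (z : T ⟶ (rc Q E).X) :
    ∃ (k : T ⟶ K.base) (x : T ⟶ E.X) (h : k ≫ XModHom.base Q = x ≫ E.σ),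
      z = rpair Q E k x h :=
  ⟨z ≫ (rc Q E).σ, z ≫ rcSnd Q E, by rw [Category.assoc, rc_condition, Category.assoc],
    rc_hom_ext (by simp) (by simp)⟩

theorem rpair_rcMap (Q : K ⟶ H) {E E' : ButterflyDiagram H G} (f : E ⟶ E') {T : C}
    (k : T ⟶ K.base) (x : T ⟶ E.X) (h : k ≫ XModHom.base Q = x ≫ E.σ) :
    rpair Q E k x h ≫ und (rcMap Q f) = rpair Q E' k (x ≫ und f) (by simp [h]) := by
  apply rc_hom_ext
  · simp
  · rw [Category.assoc, rcMap_snd, ← Category.assoc, rpair_snd, rpair_snd]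

theorem rpair_eqToHom {Q Q' : K ⟶ H} (e : Q = Q') (E : ButterflyDiagram H G) {T : C}
    (k : T ⟶ K.base) (x : T ⟶ E.X) (h : k ≫ XModHom.base Q = x ≫ E.σ) :
    rpair Q E k x h ≫ und (eqToHom (congrArg (fun N => rc N E) e)) =
      rpair Q' E k x (by rw [← e, h]) := by
  subst e
  simp

theorem rc_elements_ext {Q : K ⟶ H} {E : ButterflyDiagram H G} {Z : C} {f g : (rc Q E).X ⟶ Z}
    (hfg : ∀ {T : C} (k : T ⟶ K.base) (x : T ⟶ E.X) (h : k ≫ XModHom.base Q = x ≫ E.σ),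
      rpair Q E k x h ≫ f = rpair Q E k x h ≫ g) : f = g := by
  obtain ⟨k, x, h, e⟩ := exists_rpair Q E (𝟙 _)
  rw [← Category.id_comp f, ← Category.id_comp g, e, hfg]

theorem rc_comp_elements_ext {Q : K ⟶ H} {E : ButterflyDiagram H G} {F : ButterflyDiagram G L}
    {Z : C} {f g : (rc Q (comp E F)).X ⟶ Z}
    (hfg : ∀ {T : C} (k : T ⟶ K.base) (x : T ⟶ E.X) (y : T ⟶ F.X)
      (hkx : k ≫ XModHom.base Q = x ≫ E.σ) (hxy : x ≫ E.ρ = y ≫ F.σ),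
      rpair Q (comp E F) k (cpair E F x y hxy) (by simp [hkx]) ≫ f =
        rpair Q (comp E F) k (cpair E F x y hxy) (by simp [hkx]) ≫ g) : f = g := by
  refine rc_elements_ext fun {T} k z h => ?_
  obtain ⟨T', p, hp, x, y, hxy, e⟩ := exists_cover_cpair E F z
  have hkx : (p ≫ k) ≫ XModHom.base Q = x ≫ E.σ := by
    rw [← cpair_σ E F x y hxy, ← e, Category.assoc, Category.assoc, h]
  rw [← cancel_epi p, ← Category.assoc, ← Category.assoc, comp_rpair,
    rpair_congr Q _ rfl e, hfg _ x y hkx hxy]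

theorem comp_rc_elements_ext {Q : K ⟶ H} {E : ButterflyDiagram H G} {F : ButterflyDiagram G L}
    {Z : C} {f g : (comp (rc Q E) F).X ⟶ Z}
    (hfg : ∀ {T : C} (k : T ⟶ K.base) (x : T ⟶ E.X) (y : T ⟶ F.X)
      (hkx : k ≫ XModHom.base Q = x ≫ E.σ) (hxy : x ≫ E.ρ = y ≫ F.σ),
      cpair (rc Q E) F (rpair Q E k x hkx) y (by simp [hxy]) ≫ f =
        cpair (rc Q E) F (rpair Q E k x hkx) y (by simp [hxy]) ≫ g) : f = g := by
  refine comp_hom_ext fun {T} z y h => ?_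
  obtain ⟨k, x, hkx, rfl⟩ := exists_rpair Q E z
  exact hfg k x y hkx (by rw [← h, rpair_ρ])

theorem rc_comp_comp_elements_ext {Q : K ⟶ H} {E : ButterflyDiagram H G}
    {F : ButterflyDiagram G L} {F' : ButterflyDiagram L M}
    {Z : C} {f g : (rc Q (comp (comp E F) F')).X ⟶ Z}
    (hfg : ∀ {T : C} (k : T ⟶ K.base) (x : T ⟶ E.X) (y : T ⟶ F.X) (z : T ⟶ F'.X)
      (hkx : k ≫ XModHom.base Q = x ≫ E.σ) (hxy : x ≫ E.ρ = y ≫ F.σ)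
      (hyz : y ≫ F.ρ = z ≫ F'.σ),
      rpair Q (comp (comp E F) F') k
          (cpair (comp E F) F' (cpair E F x y hxy) z (by simp [hyz])) (by simp [hkx]) ≫ f =
        rpair Q (comp (comp E F) F') k
          (cpair (comp E F) F' (cpair E F x y hxy) z (by simp [hyz])) (by simp [hkx]) ≫ g) :
    f = g := by
  refine rc_comp_elements_ext fun {T} k w z hkw hwz => ?_
  obtain ⟨T', p, hp, x, y, hxy, e⟩ := exists_cover_cpair E F w
  have hkx : (p ≫ k) ≫ XModHom.base Q = x ≫ E.σ := by
    rw [← cpair_σ E F x y hxy, ← e, Category.assoc, Category.assoc, hkw]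
  have hyz : y ≫ F.ρ = (p ≫ z) ≫ F'.σ := by
    rw [← cpair_ρ E F x y hxy, ← e, Category.assoc, Category.assoc, hwz]
  rw [← cancel_epi p, ← Category.assoc, ← Category.assoc, comp_rpair,
    rpair_congr Q _ rfl ((comp_cpair _ _ _ _ _ _).trans (cpair_congr _ _ e rfl _)),
    hfg _ x y _ hkx hxy hyz]

/-- A morphism of butterflies out of a composite, from a morphism on `E ×_{G₀} F`. -/
noncomputable def compDesc {E : ButterflyDiagram H G} {F : ButterflyDiagram G K}
    {E' : ButterflyDiagram H K} (φ : pullback E.ρ F.σ ⟶ E'.X) (h : mid E F ≫ φ = 0)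
    (hκ : pullback.lift E.κ 0 (by simp) ≫ φ = E'.κ)
    (hι : pullback.lift 0 F.ι (by simp) ≫ φ = E'.ι)
    (hσ : φ ≫ E'.σ = pullback.fst _ _ ≫ E.σ) (hρ : φ ≫ E'.ρ = pullback.snd _ _ ≫ F.ρ) :
    comp E F ⟶ E' :=
  ButterflyHom.mk (quotDesc E F φ h)
    (by rw [comp_κ, cpair, Category.assoc, quot_desc, hκ])
    (by rw [comp_ι, cpair, Category.assoc, quot_desc, hι])
    (by rw [← cancel_epi (quot E F), ← Category.assoc, quot_desc, quot_σ, hσ])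
    (by rw [← cancel_epi (quot E F), ← Category.assoc, quot_desc, quot_ρ, hρ])

theorem cpair_compDesc {E : ButterflyDiagram H G} {F : ButterflyDiagram G K}
    {E' : ButterflyDiagram H K} (φ : pullback E.ρ F.σ ⟶ E'.X) (h : mid E F ≫ φ = 0)
    (hκ : pullback.lift E.κ 0 (by simp) ≫ φ = E'.κ)
    (hι : pullback.lift 0 F.ι (by simp) ≫ φ = E'.ι)
    (hσ : φ ≫ E'.σ = pullback.fst _ _ ≫ E.σ) (hρ : φ ≫ E'.ρ = pullback.snd _ _ ≫ F.ρ)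
    {T : C} (x : T ⟶ E.X) (y : T ⟶ F.X) (hxy : x ≫ E.ρ = y ≫ F.σ) :
    cpair E F x y hxy ≫ und (compDesc φ h hκ hι hσ hρ) = pullback.lift x y hxy ≫ φ := by
  rw [cpair, Category.assoc]
  exact congrArg _ (quot_desc E F φ h)

end ButterflyDiagram

namespace IsButterfly

variable {C : Type u} [Category.{v} C] [HasZeroMorphisms C] [SemiAbelian C]
variable {L K H G : XMod C} {E : ButterflyDiagram H G}

/-- The reduced composite of a butterfly with a morphism of crossed modules is a butterfly, with
actions `b · (k, x) = (c b, q₁ b · x)` and `(k, x) · a = (k, x · a)`. -/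
theorem rc (S : GroupoidStr K) (S' : GroupoidStr H) (Q : K ⟶ H) (hE : IsButterfly E) :
    IsButterfly (ButterflyDiagram.rc Q E) := by
  have := hE.σ_isRegularEpi
  refine of_kernel_of_actions S ?_ ?_ ?_
    (rpair Q E (pullback.fst _ _ ≫ K.c)
      (hE.lsmul S' (pullback.fst _ _ ≫ XModHom.arrows Q) (pullback.snd _ _ ≫ rcSnd Q E) (by
        rw [Category.assoc, XModHom.arrows_d, ← Category.assoc, pullback.condition,
          Category.assoc, Category.assoc, rc_condition])) (by
        rw [lsmul_σ, Category.assoc, Category.assoc, XModHom.arrows_c])) ?_ ?_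
    (rpair Q E (pullback.fst _ _ ≫ (ButterflyDiagram.rc Q E).σ)
      (hE.rsmul (pullback.fst _ _ ≫ rcSnd Q E) (pullback.snd _ _) (by
        rw [Category.assoc]; exact pullback.condition)) (by
        rw [rsmul_σ, Category.assoc, Category.assoc, rc_condition])) ?_ ?_
  · apply mono_of_kernel_elements
    intro U t ht
    refine hE.eq_zero_of_ι t ?_
    rw [← rc_ι_snd Q E, ← Category.assoc, ht, zero_comp]
  · intro T t ht
    obtain ⟨y, hy⟩ := hE.exists_lift_ι (t ≫ rcSnd Q E) (by
      rw [Category.assoc, ← rc_condition, ← Category.assoc, ht, zero_comp])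
    refine ⟨y, rc_hom_ext ?_ ?_⟩
    · rw [ht, Category.assoc, ButterflyDiagram.ι_σ, comp_zero]
    · rw [Category.assoc, rc_ι_snd, hy]
  · exact inferInstanceAs (IsRegularEpi (pullback.fst (XModHom.base Q) E.σ))
  · rw [comp_rpair]
    apply rc_hom_ext
    · simp
    · rw [rpair_snd, comp_lsmul]
      refine (hE.lsmul_e S' _ _ ?_ _).trans (by simp)
      simp only [pullback.lift_fst_assoc, pullback.lift_snd_assoc, Category.assoc,
        XModHom.e_arrows, Category.id_comp]
      rw [← Category.assoc, rc_condition, Category.assoc]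
  · rw [comp_rpair]
    apply rc_hom_ext
    · simp
    · rw [rpair_snd, comp_lsmul, rc_κ_snd]
      refine Eq.trans (hE.lsmul_congr S' ?_ ?_ _)
        (hE.gb_lsmul_zero S' (XModHom.top Q) 0 rfl (by simp))
      · rw [pullback.lift_fst_assoc, S'.gb_arrows S]
      · simp
  · rw [comp_rpair]
    apply rc_hom_ext
    · simp
    · rw [rpair_snd, comp_rsmul]
      refine (hE.rsmul_e _ _ ?_ _).trans (by simp)
      simp only [pullback.lift_snd, pullback.lift_fst_assoc, Category.id_comp]
      rw [rc_ρ, Category.assoc]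
  · rw [comp_rpair]
    apply rc_hom_ext
    · simp
    · rw [rpair_snd, comp_rsmul, rc_ι_snd]
      refine Eq.trans (hE.rsmul_congr ?_ ?_ _)
        ((hE.zero_rsmul_g 0 (𝟙 _) rfl (by simp)).trans (Category.id_comp _))
      · simp
      · simp

theorem lsmul_rcSnd (S : GroupoidStr K) (S' : GroupoidStr H) (Q : K ⟶ H) (hE : IsButterfly E)
    (hQE : IsButterfly (ButterflyDiagram.rc Q E)) {T : C} (b : T ⟶ K.arrows)
    (z : T ⟶ (ButterflyDiagram.rc Q E).X)
    (h : b ≫ K.d = z ≫ (ButterflyDiagram.rc Q E).σ) :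
    hQE.lsmul S b z h ≫ rcSnd Q E =
      hE.lsmul S' (b ≫ XModHom.arrows Q) (z ≫ rcSnd Q E) (by
        rw [Category.assoc, XModHom.arrows_d, ← Category.assoc, h, Category.assoc, rc_condition,
          Category.assoc]) := by
  refine S.eq_of_natural_d (ButterflyDiagram.rc Q E).σ
    (fun b z h => hQE.lsmul S b z h ≫ rcSnd Q E)
    (fun b z h => hE.lsmul S' (b ≫ XModHom.arrows Q) (z ≫ rcSnd Q E) (by
        rw [Category.assoc, XModHom.arrows_d, ← Category.assoc, h, Category.assoc, rc_condition,
          Category.assoc])) ?_ ?_ ?_ ?_ b z h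
  · intro T T' t b z h
    rw [← Category.assoc, comp_lsmul]
  · intro T T' t b z h
    rw [comp_lsmul]
    exact hE.lsmul_congr S' (Category.assoc _ _ _).symm (Category.assoc _ _ _).symm _
  · intro T b z h hb
    rw [hQE.lsmul_e S b z hb]
    refine (hE.lsmul_e S' _ _ ?_ _).symm
    rw [hb]
    simp only [Category.assoc, XModHom.e_arrows]
    rw [← Category.assoc (ButterflyDiagram.rc Q E).σ, rc_condition, Category.assoc]
  · intro T y z h hz
    subst hz
    rw [hQE.gb_lsmul_zero S y 0 rfl, Category.assoc, rc_κ_snd, ← Category.assoc]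
    refine Eq.trans (hE.gb_lsmul_zero S' (y ≫ XModHom.top Q) 0 rfl (by simp)).symm
      (hE.lsmul_congr S' ?_ zero_comp.symm _)
    rw [Category.assoc, Category.assoc, S'.gb_arrows S]

theorem rsmul_rcSnd (Q : K ⟶ H) (hE : IsButterfly E)
    (hQE : IsButterfly (ButterflyDiagram.rc Q E)) {T : C}
    (z : T ⟶ (ButterflyDiagram.rc Q E).X) (a : T ⟶ G.arrows)
    (h : z ≫ (ButterflyDiagram.rc Q E).ρ = a ≫ G.c) :
    hQE.rsmul z a h ≫ rcSnd Q E = hE.rsmul (z ≫ rcSnd Q E) a (by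
      rw [Category.assoc, ← rc_ρ, h]) := by
  refine G.eq_of_natural_c (ButterflyDiagram.rc Q E).ρ
    (fun z a h => hQE.rsmul z a h ≫ rcSnd Q E)
    (fun z a h => hE.rsmul (z ≫ rcSnd Q E) a (by rw [Category.assoc, ← rc_ρ, h]))
    ?_ ?_ ?_ ?_ z a h
  · intro T T' t z a h
    rw [← Category.assoc, comp_rsmul]
  · intro T T' t z a h
    rw [comp_rsmul]
    exact hE.rsmul_congr (Category.assoc _ _ _).symm rfl _
  · intro T z a h ha
    rw [hQE.rsmul_e z a ha]
    refine (hE.rsmul_e _ _ ?_ _).symm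
    rw [ha, rc_ρ]
    simp only [Category.assoc]
  · intro T z y h hz
    subst hz
    rw [hQE.zero_rsmul_g 0 y rfl, Category.assoc, rc_ι_snd]
    exact (hE.zero_rsmul_g _ y zero_comp _).symm

theorem lsmul_rpair (S : GroupoidStr K) (S' : GroupoidStr H) (Q : K ⟶ H) (hE : IsButterfly E)
    (hQE : IsButterfly (ButterflyDiagram.rc Q E)) {T : C} (b : T ⟶ K.arrows)
    (k : T ⟶ K.base) (x : T ⟶ E.X) (hkx : k ≫ XModHom.base Q = x ≫ E.σ) (h : b ≫ K.d = k) :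
    hQE.lsmul S b (rpair Q E k x hkx) (by rw [h, rpair_σ]) =
      rpair Q E (b ≫ K.c) (hE.lsmul S' (b ≫ XModHom.arrows Q) x (by
        rw [← hkx, ← h, Category.assoc, Category.assoc, XModHom.arrows_d])) (by
        rw [lsmul_σ, Category.assoc, Category.assoc, XModHom.arrows_c]) := by
  apply rc_hom_ext
  · rw [lsmul_σ, rpair_σ]
  · rw [lsmul_rcSnd S S' Q hE]
    exact (hE.lsmul_congr S' rfl (rpair_snd ..) _).trans (rpair_snd ..).symm

theorem rsmul_rpair (Q : K ⟶ H) (hE : IsButterfly E)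
    (hQE : IsButterfly (ButterflyDiagram.rc Q E)) {T : C}
    (k : T ⟶ K.base) (x : T ⟶ E.X) (a : T ⟶ G.arrows)
    (hkx : k ≫ XModHom.base Q = x ≫ E.σ) (h : x ≫ E.ρ = a ≫ G.c) :
    hQE.rsmul (rpair Q E k x hkx) a (by rw [rpair_ρ, h]) =
      rpair Q E k (hE.rsmul x a h) (by rw [rsmul_σ, hkx]) := by
  apply rc_hom_ext
  · rw [rsmul_σ, rpair_σ, rpair_σ]
  · rw [rsmul_rcSnd Q hE]
    exact (hE.rsmul_congr (rpair_snd ..) rfl _).trans (rpair_snd ..).symm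

/-- The identity butterfly is a butterfly, with actions given by composition in `G₁`. -/
theorem idB (S : GroupoidStr G) : IsButterfly (ButterflyDiagram.idB S) := by
  refine of_kernel_of_actions S G.g_mono (fun t ht => G.exists_lift_g t ht) ?_
    (S.mul (pullback.snd _ _) (pullback.fst _ _) pullback.condition.symm) ?_ ?_
    (S.mul (pullback.snd _ _) (pullback.fst _ _) pullback.condition.symm) ?_ ?_
  · exact isRegularEpi_of_factors _ fun n _ e he => by
      have : (G.e ≫ e) ≫ n = 𝟙 _ := by rw [Category.assoc, he]; exact G.e_c
      exact ⟨G.e ≫ e, by rw [← cancel_mono n, Category.assoc, this]; simp, this⟩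
  · rw [S.comp_mul]
    exact (S.mul_e _ _ (by simp) _).trans (by simp)
  · rw [S.comp_mul]
    exact (S.e_mul _ _ (by simp [reassoc_of% S.gb_d]) _).trans (by simp)
  · rw [S.comp_mul]
    exact (S.e_mul _ _ (by simp) _).trans (by simp)
  · rw [S.comp_mul]
    exact (S.mul_e _ _ (by simp) _).trans (by simp)

theorem lsmul_idB (S : GroupoidStr G) (hI : IsButterfly (ButterflyDiagram.idB S)) {T : C}
    (a x : T ⟶ G.arrows) (h : a ≫ G.d = x ≫ G.c) : hI.lsmul S a x h = S.mul x a h.symm := by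
  refine S.eq_of_natural_d G.c (fun a x h => hI.lsmul S a x h)
    (fun a x h => S.mul x a h.symm) ?_ ?_ ?_ ?_ a x h
  · intro T T' t a x h
    rw [comp_lsmul]
  · intro T T' t a x h
    rw [S.comp_mul]
  · intro T a x h ha
    rw [hI.lsmul_e S a x ha, S.mul_e x a ha]
  · intro T y x h hx
    rw [hI.gb_lsmul_zero S y x hx]
    exact (S.e_mul _ _ (by simp [hx, reassoc_of% S.gb_d]) _).symm

end IsButterfly

/-! ### The structural isomorphisms -/

namespace IsButterfly

variable {C : Type u} [Category.{v} C] [HasZeroMorphisms C] [SemiAbelian C]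
variable {M L K H G : XMod C} {E : ButterflyDiagram H G} {F : ButterflyDiagram G K}
variable {F' : ButterflyDiagram K L}

/-- `[[x, y], z] ↦ [x, [y, z]]` as a morphism on `EF ×_{K₀} F'`. -/
theorem exists_assocHom (S : GroupoidStr G) (hE : IsButterfly E) (hF : IsButterfly F)
    (F' : ButterflyDiagram K L) :
    ∃ φ : pullback (ButterflyDiagram.comp E F).ρ F'.σ ⟶
        (ButterflyDiagram.comp E (ButterflyDiagram.comp F F')).X,
      ∀ {T : C} (w : T ⟶ (ButterflyDiagram.comp E F).X) (x : T ⟶ E.X) (y : T ⟶ F.X)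
        (z : T ⟶ F'.X) (hxy : x ≫ E.ρ = y ≫ F.σ) (hyz : y ≫ F.ρ = z ≫ F'.σ)
        (hw : w = cpair E F x y hxy),
        pullback.lift w z (by rw [hw, cpair_ρ, hyz]) ≫ φ =
          cpair E (ButterflyDiagram.comp F F') x (cpair F F' y z hyz)
            (by rw [cpair_σ, hxy]) := by
  have hz : ∀ {T : C} (t : T ⟶ pullback (ButterflyDiagram.comp E F).ρ F'.σ) (x : T ⟶ E.X)
      (y : T ⟶ F.X) (hxy : x ≫ E.ρ = y ≫ F.σ)
      (_ : t ≫ pullback.fst _ _ = cpair E F x y hxy),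
      y ≫ F.ρ = (t ≫ pullback.snd _ _) ≫ F'.σ := by
    intro T t x y hxy h
    have := h =≫ (ButterflyDiagram.comp E F).ρ
    rw [cpair_ρ] at this
    rw [← this, Category.assoc, pullback.condition, Category.assoc]
  obtain ⟨φ, hφ⟩ := exists_desc_cpair S hE hF
    (pullback.fst (ButterflyDiagram.comp E F).ρ F'.σ)
    (fun t x y hxy h => cpair E (ButterflyDiagram.comp F F') x
      (cpair F F' y (t ≫ pullback.snd _ _) (hz t x y hxy h)) (by rw [cpair_σ, hxy]))
    (fun s t x y hxy h => by
      rw [comp_cpair]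
      refine cpair_congr _ _ rfl ?_ _
      rw [comp_cpair]
      exact cpair_congr _ _ rfl (Category.assoc _ _ _).symm _)
    (fun y hxy h => by
      refine cpair_ι_κ E (ButterflyDiagram.comp F F') y _ _ rfl ?_ _
      exact comp_cpair_κ F F' y _ zero_comp _)
  refine ⟨φ, fun w x y z hxy hyz hw => ?_⟩
  refine (hφ _ x y hxy (by rw [pullback.lift_fst, hw])).trans ?_
  exact cpair_congr _ _ rfl (cpair_congr _ _ rfl (pullback.lift_snd _ _ _) _) _

theorem pullback_comp_elements_ext {E : ButterflyDiagram H G} {F : ButterflyDiagram G K}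
    {F' : ButterflyDiagram K L} {Z : C} {f g : pullback (ButterflyDiagram.comp E F).ρ F'.σ ⟶ Z}
    (h : ∀ {T : C} (w : T ⟶ (ButterflyDiagram.comp E F).X) (x : T ⟶ E.X) (y : T ⟶ F.X)
      (z : T ⟶ F'.X) (hxy : x ≫ E.ρ = y ≫ F.σ) (_ : y ≫ F.ρ = z ≫ F'.σ)
      (_ : w = cpair E F x y hxy) (hwz : w ≫ (ButterflyDiagram.comp E F).ρ = z ≫ F'.σ),
      pullback.lift w z hwz ≫ f = pullback.lift w z hwz ≫ g) : f = g := by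
  obtain ⟨T', p, hp, x, y, hxy, e⟩ := exists_cover_cpair E F
    (pullback.fst (ButterflyDiagram.comp E F).ρ F'.σ)
  have hwz : (p ≫ pullback.fst (ButterflyDiagram.comp E F).ρ F'.σ) ≫
      (ButterflyDiagram.comp E F).ρ = (p ≫ pullback.snd _ _) ≫ F'.σ := by
    rw [Category.assoc, pullback.condition, Category.assoc]
  have := h _ x y _ hxy (by rw [← hwz, e, cpair_ρ]) e hwz
  rwa [pullback_lift_eta, cancel_epi] at this

/-- The comparison `(EF)F' ⟶ E(FF')`. -/
noncomputable def assocHom (S : GroupoidStr G) (hE : IsButterfly E) (hF : IsButterfly F)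
    (F' : ButterflyDiagram K L) :
    ButterflyDiagram.comp (ButterflyDiagram.comp E F) F' ⟶
      ButterflyDiagram.comp E (ButterflyDiagram.comp F F') :=
  have hφ {T : C} := (exists_assocHom S hE hF F').choose_spec (T := T)
  compDesc (exists_assocHom S hE hF F').choose
    (by
      rw [mid]
      refine (hφ _ 0 F.ι F'.κ (by simp) (by simp) (comp_ι E F)).trans ?_
      refine cpair_zero _ _ _ _ rfl ?_ _
      exact cpair_ι_κ F F' (𝟙 _) _ _ (Category.id_comp _).symm (Category.id_comp _).symm _)
    (by
      refine (hφ _ E.κ 0 0 (by simp) (by simp) (comp_κ E F)).trans ?_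
      rw [comp_κ]
      exact cpair_congr _ _ rfl (cpair_zero _ _ _ _ rfl rfl _) _)
    (by
      refine (hφ _ 0 0 F'.ι (by simp) (by simp) (cpair_zero _ _ _ _ rfl rfl _).symm).trans ?_
      rw [comp_ι]
      exact cpair_congr _ _ rfl (comp_ι F F').symm _)
    (by
      apply pullback_comp_elements_ext
      intro T w x y z hxy hyz hw hwz
      rw [← Category.assoc, hφ w x y z hxy hyz hw, cpair_σ, pullback.lift_fst_assoc, hw, cpair_σ])
    (by
      apply pullback_comp_elements_ext
      intro T w x y z hxy hyz hw hwz
      rw [← Category.assoc, hφ w x y z hxy hyz hw, cpair_ρ, cpair_ρ, pullback.lift_snd_assoc])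

theorem cpair_assocHom (S : GroupoidStr G) (hE : IsButterfly E) (hF : IsButterfly F)
    (F' : ButterflyDiagram K L) {T : C} (x : T ⟶ E.X) (y : T ⟶ F.X)
    (z : T ⟶ F'.X) (hxy : x ≫ E.ρ = y ≫ F.σ) (hyz : y ≫ F.ρ = z ≫ F'.σ) :
    cpair (ButterflyDiagram.comp E F) F' (cpair E F x y hxy) z (by rw [cpair_ρ, hyz]) ≫
        und (assocHom S hE hF F') =
      cpair E (ButterflyDiagram.comp F F') x (cpair F F' y z hyz) (by rw [cpair_σ, hxy]) := by
  rw [assocHom, cpair_compDesc]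
  exact (exists_assocHom S hE hF F').choose_spec _ x y z hxy hyz rfl

/-- The morphism `IE ⟶ E` given by the action of `H₁`. -/
noncomputable def lunitHom (S : GroupoidStr H) (hE : IsButterfly E) :
    ButterflyDiagram.comp (ButterflyDiagram.idB S) E ⟶ E :=
  compDesc (hE.lact S)
    (by
      refine Eq.trans ?_ (hE.g_lsmul_κ S (𝟙 _) (by simp))
      exact congrArg (· ≫ hE.lact S)
        (pullback_lift_congr (Category.id_comp _).symm (Category.id_comp _).symm _))
    (hE.lact_κ S)
    (hE.lsmul_e S 0 E.ι (by simp [reassoc_of% E.ι_σ]) (by simp))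
    (hE.lact_σ S) (hE.lact_ρ S)

theorem cpair_lunitHom (S : GroupoidStr H) (hE : IsButterfly E) {T : C} (a : T ⟶ H.arrows)
    (x : T ⟶ E.X) (h : a ≫ H.d = x ≫ E.σ) :
    cpair (ButterflyDiagram.idB S) E a x h ≫ und (lunitHom S hE) = hE.lsmul S a x h :=
  cpair_compDesc ..

/-- The morphism `EI ⟶ E` given by the action of `G₁`. -/
noncomputable def runitHom (S : GroupoidStr G) (hE : IsButterfly E) :
    ButterflyDiagram.comp E (ButterflyDiagram.idB S) ⟶ E :=
  compDesc hE.ract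
    (by
      refine Eq.trans ?_ (hE.ι_rsmul_gb S (𝟙 _) (by simp))
      exact congrArg (· ≫ hE.ract)
        (pullback_lift_congr (Category.id_comp _).symm (Category.id_comp _).symm _))
    (hE.rsmul_e E.κ 0 (by simp [reassoc_of% E.κ_ρ]) (by simp))
    hE.ract_ι hE.ract_σ hE.ract_ρ

theorem cpair_runitHom (S : GroupoidStr G) (hE : IsButterfly E) {T : C} (x : T ⟶ E.X)
    (a : T ⟶ G.arrows) (h : x ≫ E.ρ = a ≫ G.c) :
    cpair E (ButterflyDiagram.idB S) x a h ≫ und (runitHom S hE) = hE.rsmul x a h :=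
  cpair_compDesc ..

/-- The morphism `E_Q E ⟶ Q ·_rc E`, `[(k, a), x] ↦ (k, a · x)`. -/
noncomputable def agreeHom (S : GroupoidStr H) (Q : M ⟶ H) (hE : IsButterfly E) :
    ButterflyDiagram.comp (ButterflyDiagram.rc Q (ButterflyDiagram.idB S)) E ⟶
      ButterflyDiagram.rc Q E :=
  have hax : (pullback.fst (ButterflyDiagram.rc Q (ButterflyDiagram.idB S)).ρ E.σ ≫
      rcSnd Q (ButterflyDiagram.idB S)) ≫ H.d = pullback.snd _ _ ≫ E.σ := by
    rw [Category.assoc]; exact pullback.condition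
  compDesc (rpair Q E (pullback.fst _ _ ≫ (ButterflyDiagram.rc Q (ButterflyDiagram.idB S)).σ)
      (hE.lsmul S (pullback.fst _ _ ≫ rcSnd Q (ButterflyDiagram.idB S)) (pullback.snd _ _) hax)
      (by rw [lsmul_σ, Category.assoc, Category.assoc, rc_condition]))
    (by
      rw [comp_rpair]
      apply rc_hom_ext
      · simp [mid]
      · rw [rpair_snd, zero_comp, comp_lsmul]
        refine Eq.trans (hE.lsmul_congr S ?_ ?_ _) (hE.g_lsmul_κ S (𝟙 _) (by simp))
        · rw [mid, pullback.lift_fst_assoc, rc_ι_snd, Category.id_comp]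
        · rw [mid, pullback.lift_snd, Category.id_comp])
    (by
      rw [comp_rpair]
      apply rc_hom_ext
      · simp
      · rw [rpair_snd, rc_κ_snd, comp_lsmul]
        refine Eq.trans (hE.lsmul_congr S ?_ ?_ _)
          (hE.gb_lsmul_zero S (XModHom.top Q) 0 rfl (by simp))
        · rw [pullback.lift_fst_assoc, rc_κ_snd]
        · rw [pullback.lift_snd])
    (by
      rw [comp_rpair]
      apply rc_hom_ext
      · simp
      · rw [rpair_snd, rc_ι_snd, comp_lsmul]
        refine Eq.trans (hE.lsmul_congr S ?_ ?_ _)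
          (hE.lsmul_e S 0 E.ι (by simp [reassoc_of% E.ι_σ]) (by simp))
        · rw [pullback.lift_fst_assoc, zero_comp]
        · rw [pullback.lift_snd])
    (by rw [rpair_σ])
    (by rw [rpair_ρ, lsmul_ρ])

theorem cpair_agreeHom (S : GroupoidStr H) (Q : M ⟶ H) (hE : IsButterfly E) {T : C}
    (k : T ⟶ M.base) (a : T ⟶ H.arrows) (x : T ⟶ E.X)
    (hka : k ≫ XModHom.base Q = a ≫ H.c) (hax : a ≫ H.d = x ≫ E.σ) :
    cpair (ButterflyDiagram.rc Q (ButterflyDiagram.idB S)) E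
        (rpair Q (ButterflyDiagram.idB S) k a hka) x (by rw [rpair_ρ]; exact hax) ≫
        und (agreeHom S Q hE) =
      rpair Q E k (hE.lsmul S a x hax) (by rw [lsmul_σ, hka]) := by
  rw [agreeHom, cpair_compDesc, comp_rpair]
  refine rpair_congr Q E ?_ ?_ _
  · rw [pullback.lift_fst_assoc, rpair_σ]
  · rw [comp_lsmul]
    refine hE.lsmul_congr S ?_ (pullback.lift_snd _ _ _) _
    rw [pullback.lift_fst_assoc, rpair_snd]

end IsButterfly

namespace ButterflyDiagram

variable {C : Type u} [Category.{v} C] [HasZeroMorphisms C] [SemiAbelian C]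
variable {M L K H G : XMod C}

/-- The morphism `(Q ·_rc E)F ⟶ Q ·_rc EF`, `[(k, x), y] ↦ (k, [x, y])`. -/
noncomputable def rcCompHom (Q : M ⟶ H) (E : ButterflyDiagram H G) (F : ButterflyDiagram G K) :
    comp (rc Q E) F ⟶ rc Q (comp E F) :=
  have hxy : (pullback.fst (rc Q E).ρ F.σ ≫ rcSnd Q E) ≫ E.ρ = pullback.snd _ _ ≫ F.σ := by
    rw [Category.assoc]; exact pullback.condition
  compDesc (rpair Q (comp E F) (pullback.fst _ _ ≫ (rc Q E).σ)
      (cpair E F (pullback.fst _ _ ≫ rcSnd Q E) (pullback.snd _ _) hxy)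
      (by rw [cpair_σ, Category.assoc, Category.assoc, rc_condition]))
    (by
      rw [comp_rpair]
      apply rc_hom_ext
      · simp [mid]
      · rw [rpair_snd, zero_comp, comp_cpair]
        refine cpair_ι_κ E F (𝟙 _) _ _ ?_ ?_ _
        · rw [mid, pullback.lift_fst_assoc, rc_ι_snd, Category.id_comp]
        · rw [mid, pullback.lift_snd, Category.id_comp])
    (by
      rw [comp_rpair]
      apply rc_hom_ext
      · simp
      · rw [rpair_snd, rc_κ_snd, comp_cpair]
        refine Eq.trans (cpair_congr E F ?_ ?_ _)
          (comp_cpair_κ E F (XModHom.top Q) 0 rfl (by simp))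
        · rw [pullback.lift_fst_assoc, rc_κ_snd]
        · rw [pullback.lift_snd])
    (by
      rw [comp_rpair]
      apply rc_hom_ext
      · simp
      · rw [rpair_snd, rc_ι_snd, comp_cpair, comp_ι]
        refine cpair_congr E F ?_ ?_ _
        · rw [pullback.lift_fst_assoc, zero_comp]
        · rw [pullback.lift_snd])
    (by rw [rpair_σ])
    (by rw [rpair_ρ, cpair_ρ])

theorem cpair_rcCompHom (Q : M ⟶ H) (E : ButterflyDiagram H G) (F : ButterflyDiagram G K)
    {T : C} (k : T ⟶ M.base) (x : T ⟶ E.X) (y : T ⟶ F.X)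
    (hkx : k ≫ XModHom.base Q = x ≫ E.σ) (hxy : x ≫ E.ρ = y ≫ F.σ) :
    cpair (rc Q E) F (rpair Q E k x hkx) y (by rw [rpair_ρ, hxy]) ≫ und (rcCompHom Q E F) =
      rpair Q (comp E F) k (cpair E F x y hxy) (by rw [cpair_σ, hkx]) := by
  rw [rcCompHom, cpair_compDesc, comp_rpair]
  refine rpair_congr Q _ ?_ ?_ _
  · rw [pullback.lift_fst_assoc, rpair_σ]
  · rw [comp_cpair]
    refine cpair_congr E F ?_ (pullback.lift_snd _ _ _) _
    rw [pullback.lift_fst_assoc, rpair_snd]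

/-- The morphism `PQ ·_rc E ⟶ P ·_rc (Q ·_rc E)`, `(l, x) ↦ (l, (p₀ l, x))`. -/
noncomputable def rcRcHom (P : M ⟶ K) (Q : K ⟶ H) (E : ButterflyDiagram H G) :
    rc (P ≫ Q) E ⟶ rc P (rc Q E) :=
  ButterflyHom.mk
    (rpair P (rc Q E) (rc (P ≫ Q) E).σ
      (rpair Q E ((rc (P ≫ Q) E).σ ≫ XModHom.base P) (rcSnd (P ≫ Q) E)
        (by rw [Category.assoc, ← rc_condition]; rfl))
      (by rw [rpair_σ]))
    (by
      rw [comp_rpair]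
      refine rc_hom_ext (by simp) ?_
      rw [rpair_snd, comp_rpair]
      refine rc_hom_ext ?_ (by simp)
      simp [reassoc_of% (rc (P ≫ Q) E).κ_σ, XModHom.comm])
    (by
      rw [comp_rpair]
      refine rc_hom_ext (by simp) ?_
      rw [rpair_snd, comp_rpair]
      refine rc_hom_ext ?_ (by simp)
      simp [reassoc_of% (rc (P ≫ Q) E).ι_σ])
    (by rw [rpair_σ])
    (by rw [rpair_ρ, rpair_ρ, rc_ρ])

theorem rpair_rcRcHom (P : M ⟶ K) (Q : K ⟶ H) (E : ButterflyDiagram H G) {T : C}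
    (l : T ⟶ M.base) (x : T ⟶ E.X) (h : l ≫ XModHom.base (P ≫ Q) = x ≫ E.σ) :
    rpair (P ≫ Q) E l x h ≫ und (rcRcHom P Q E) =
      rpair P (rc Q E) l (rpair Q E (l ≫ XModHom.base P) x (by simpa using h))
        (by rw [rpair_σ]) := by
  refine (comp_rpair ..).trans (rpair_congr _ _ (rpair_σ ..) ?_ _)
  rw [comp_rpair]
  refine rpair_congr _ _ ?_ (rpair_snd ..) _
  rw [← Category.assoc, rpair_σ]

/-- The projection `I ·_rc E ⟶ E` as a morphism of butterflies. -/
noncomputable def rcIdHom (E : ButterflyDiagram H G) : rc (𝟙 H) E ⟶ E :=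
  ButterflyHom.mk (rcSnd (𝟙 H) E) (by rw [rc_κ_snd, XModHom.id_top, Category.id_comp])
    (rc_ι_snd ..) (by rw [← rc_condition, XModHom.id_base, Category.comp_id]) rfl

theorem rpair_rcIdHom (E : ButterflyDiagram H G) {T : C} (h : T ⟶ H.base) (x : T ⟶ E.X)
    (hx : h ≫ XModHom.base (𝟙 H) = x ≫ E.σ) :
    rpair (𝟙 H) E h x hx ≫ und (rcIdHom E) = x := rpair_snd ..

end ButterflyDiagram

namespace TwoCell

variable {C : Type u} [Category.{v} C] [HasZeroMorphisms C] [SemiAbelian C]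
variable {H G : XMod C}

/-- Naturality of `α : P ⟹ Q` in terms of `g•`. -/
theorem gb_mul {S : GroupoidStr G} {P Q : H ⟶ G} (α : TwoCell S P Q) :
    S.mul (XModHom.top P ≫ S.gb) (H.del ≫ α.app)
      (by rw [Category.assoc, S.gb_c, Category.assoc, α.app_d, XModHom.comm]) =
      XModHom.top Q ≫ S.gb := by
  have h₁ : (XModHom.top P ≫ S.gb) ≫ G.c = (H.del ≫ α.app) ≫ G.d := by
    rw [Category.assoc, S.gb_c, Category.assoc, α.app_d, XModHom.comm]
  have h₂ : (H.del ≫ α.app) ≫ G.c = (XModHom.top Q ≫ G.g) ≫ G.d := by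
    rw [Category.assoc, α.app_c, XModHom.comm, Category.assoc, G.g_d]
  refine (S.eq_inv_of_mul_eq _ (XModHom.top Q ≫ G.g) ((S.mul_c _ _ _).trans h₂) ?_).trans ?_
  · rw [S.mul_mul _ _ _ h₁ h₂]
    refine (S.mul_congr ?_ α.nat _).trans ((S.inv_mul (XModHom.top P ≫ G.g)).trans ?_)
    · rw [GroupoidStr.gb, Category.assoc]
    · rw [← Category.assoc (S.mul _ _ _), S.mul_d]
      simp
  · rw [GroupoidStr.gb, Category.assoc]

end TwoCell

namespace IsButterfly

variable {C : Type u} [Category.{v} C] [HasZeroMorphisms C] [SemiAbelian C]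
variable {K H G : XMod C} {E : ButterflyDiagram H G}

/-- The morphism `P ·_rc E ⟶ Q ·_rc E`, `(k, x) ↦ (k, α(k) · x)`, induced by `α : P ⟹ Q`. -/
noncomputable def rcTwoCellHom (S : GroupoidStr H) {P Q : K ⟶ H} (α : TwoCell S P Q)
    (hE : IsButterfly E) : ButterflyDiagram.rc P E ⟶ ButterflyDiagram.rc Q E :=
  ButterflyHom.mk
    (rpair Q E (ButterflyDiagram.rc P E).σ
      (hE.lsmul S ((ButterflyDiagram.rc P E).σ ≫ α.app) (rcSnd P E)
        (by rw [Category.assoc, α.app_d, rc_condition]))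
      (by rw [lsmul_σ, Category.assoc, α.app_c]))
    (by
      rw [comp_rpair]
      refine rc_hom_ext (by simp) ?_
      have h₁ : (XModHom.top P ≫ S.gb) ≫ H.d = (0 : K.top ⟶ E.X) ≫ E.σ := by simp
      have h₂ : (XModHom.top P ≫ S.gb) ≫ H.c = (K.del ≫ α.app) ≫ H.d := by
        rw [Category.assoc, S.gb_c, Category.assoc, α.app_d, XModHom.comm]
      rw [rpair_snd, rc_κ_snd, comp_lsmul]
      refine (hE.lsmul_congr S ?_ ?_ _).trans ((hE.lsmul_lsmul S _ (K.del ≫ α.app) _ h₁ h₂).trans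
        ((hE.lsmul_congr S α.gb_mul rfl _).trans
          (hE.gb_lsmul_zero S (XModHom.top Q) 0 rfl (by simp))))
      · rw [← Category.assoc, ButterflyDiagram.κ_σ]
      · rw [rc_κ_snd]
        exact (hE.gb_lsmul_zero S (XModHom.top P) 0 rfl h₁).symm)
    (by
      rw [comp_rpair]
      refine rc_hom_ext (by simp) ?_
      rw [rpair_snd, rc_ι_snd, comp_lsmul]
      refine (hE.lsmul_e S _ _ ?_ _).trans (rc_ι_snd ..)
      rw [← Category.assoc, ButterflyDiagram.ι_σ, ← Category.assoc, rc_ι_snd, zero_comp,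
        ButterflyDiagram.ι_σ, zero_comp])
    (by rw [rpair_σ])
    (by rw [rpair_ρ, lsmul_ρ, rc_ρ])

theorem rcTwoCellHom_snd (S : GroupoidStr H) {P Q : K ⟶ H} (α : TwoCell S P Q)
    (hE : IsButterfly E) : und (rcTwoCellHom S α hE) ≫ rcSnd Q E =
      hE.lsmul S ((ButterflyDiagram.rc P E).σ ≫ α.app) (rcSnd P E)
        (by rw [Category.assoc, α.app_d, rc_condition]) := rpair_snd ..

theorem rpair_rcTwoCellHom (S : GroupoidStr H) {P Q : K ⟶ H} (α : TwoCell S P Q)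
    (hE : IsButterfly E) {T : C} (k : T ⟶ K.base) (x : T ⟶ E.X)
    (h : k ≫ XModHom.base P = x ≫ E.σ) :
    rpair P E k x h ≫ und (rcTwoCellHom S α hE) =
      rpair Q E k (hE.lsmul S (k ≫ α.app) x (by rw [Category.assoc, α.app_d, h]))
        (by rw [lsmul_σ, Category.assoc, α.app_c]) := by
  refine (comp_rpair ..).trans (rpair_congr _ _ (rpair_σ ..) ?_ _)
  rw [comp_lsmul]
  refine hE.lsmul_congr S ?_ (rpair_snd ..) _
  rw [← Category.assoc, rpair_σ]

end IsButterfly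

/-! ### Coherence -/

section Coherence

variable {C : Type u} [Category.{v} C] [HasZeroMorphisms C] [SemiAbelian C]

/-- The bicategorical structure of butterflies. Every structural isomorphism is invertible because
it is a morphism of butterflies. -/
noncomputable def butterflyConstraints (S : ∀ G : XMod C, GroupoidStr G) :
    ButterflyConstraints S where
  idB_isButterfly G := .idB (S G)
  comp_isButterfly hE hF := .comp (S _) (S _) hE hF
  assoc hE hF hF' := IsButterfly.isoOfHom (.comp (S _) (S _) (.comp (S _) (S _) hE hF) hF')
    (.comp (S _) (S _) hE (.comp (S _) (S _) hF hF')) (IsButterfly.assocHom (S _) hE hF _)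
  assoc_spec hE hF _ _ x y z hxy hyz := IsButterfly.cpair_assocHom (S _) hE hF _ x y z hxy hyz
  lact hE := hE.lact (S _)
  lact_e hE := hE.lact_e (S _)
  lact_κ hE := hE.lact_κ (S _)
  ract hE := hE.ract
  ract_e hE := hE.ract_e
  ract_ι hE := hE.ract_ι
  lunit hE := IsButterfly.isoOfHom (.comp (S _) (S _) (.idB (S _)) hE) hE
    (IsButterfly.lunitHom (S _) hE)
  lunit_spec hE _ a x h := IsButterfly.cpair_lunitHom (S _) hE a x h
  runit hE := IsButterfly.isoOfHom (.comp (S _) (S _) hE (.idB (S _))) hE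
    (IsButterfly.runitHom (S _) hE)
  runit_spec hE _ x a h := IsButterfly.cpair_runitHom (S _) hE x a h

theorem comp_und_comp {H G : XMod C} {E E' E'' : ButterflyDiagram H G} {T : C} (t : T ⟶ E.X)
    (f : E ⟶ E') (g : E' ⟶ E'') : t ≫ und (f ≫ g) = (t ≫ und f) ≫ und g :=
  (Category.assoc _ _ _).symm

theorem comp_und_comp_eq {H G : XMod C} {E E' E'' : ButterflyDiagram H G} {f : E ⟶ E'}
    {g : E' ⟶ E''} {T : C} {x : T ⟶ E.X} {y : T ⟶ E'.X} {z : T ⟶ E''.X} (hf : x ≫ und f = y)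
    (hg : y ≫ und g = z) : x ≫ und (f ≫ g) = z := by
  rw [comp_und_comp, hf, hg]

/-- A1 is the inverse of `[(k, x), y] ↦ (k, [x, y])`. -/
noncomputable def rcCompIso (S : ∀ G : XMod C, GroupoidStr G) {K H G L : XMod C} (Q : K ⟶ H)
    {E : ButterflyDiagram H G} {F : ButterflyDiagram G L} (hE : IsButterfly E)
    (hF : IsButterfly F) : rc Q (comp E F) ≅ comp (rc Q E) F :=
  (IsButterfly.isoOfHom (.comp (S _) (S _) (.rc (S _) (S _) Q hE) hF)
    (.rc (S _) (S _) Q (.comp (S _) (S _) hE hF)) (rcCompHom Q E F)).symm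

theorem rpair_rcCompIso (S : ∀ G : XMod C, GroupoidStr G) {K H G L : XMod C} (Q : K ⟶ H)
    {E : ButterflyDiagram H G} {F : ButterflyDiagram G L} (hE : IsButterfly E)
    (hF : IsButterfly F) {T : C} (k : T ⟶ K.base) (x : T ⟶ E.X) (y : T ⟶ F.X)
    (hkx : k ≫ XModHom.base Q = x ≫ E.σ) (hxy : x ≫ E.ρ = y ≫ F.σ) :
    rpair Q (comp E F) k (cpair E F x y hxy) (by rw [cpair_σ, hkx]) ≫
        und (rcCompIso S Q hE hF).hom =
      cpair (rc Q E) F (rpair Q E k x hkx) y (by rw [rpair_ρ, hxy]) := by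
  have h : und (rcCompHom Q E F) ≫ und (rcCompIso S Q hE hF).hom = 𝟙 _ :=
    congrArg und (rcCompIso S Q hE hF).inv_hom_id
  rw [← cpair_rcCompHom, Category.assoc, h, Category.comp_id]

theorem rpair_rcTwoCellHom_rcMap {K H G : XMod C} (S : GroupoidStr H) {P Q : K ⟶ H}
    (α : TwoCell S P Q) {E E' : ButterflyDiagram H G} (hE : IsButterfly E) (f : E ⟶ E') {T : C}
    (k : T ⟶ K.base) (x : T ⟶ E.X) (h : k ≫ XModHom.base P = x ≫ E.σ) :
    rpair P E k x h ≫ und (IsButterfly.rcTwoCellHom S α hE ≫ rcMap Q f) =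
      rpair Q E' k (hE.lsmul S (k ≫ α.app) x (by rw [Category.assoc, α.app_d, h]) ≫ und f)
        (by rw [Category.assoc, und_σ, IsButterfly.lsmul_σ, Category.assoc, α.app_c]) := by
  rw [comp_und_comp, IsButterfly.rpair_rcTwoCellHom, rpair_rcMap]

/-- A1 is natural in `Q`, `E` and `F`. -/
theorem rcCompIso_naturality (S : ∀ G : XMod C, GroupoidStr G) {K H G L : XMod C} {Q Q' : K ⟶ H}
    (α : TwoCell (S H) Q Q') {E E' : ButterflyDiagram H G} {F F' : ButterflyDiagram G L}
    (hE : IsButterfly E) (hE' : IsButterfly E') (hF : IsButterfly F) (hF' : IsButterfly F')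
    (hEF : IsButterfly (comp E F)) (f : E ⟶ E') (g : F ⟶ F') :
    (IsButterfly.rcTwoCellHom (S H) α hEF ≫ rcMap Q' (compMap f g)) ≫
        (rcCompIso S Q' hE' hF').hom =
      (rcCompIso S Q hE hF).hom ≫
        compMap (IsButterfly.rcTwoCellHom (S H) α hE ≫ rcMap Q' f) g := by
  refine und_ext (rc_comp_elements_ext fun {T} k x y hkx hxy => ?_)
  have ha : (k ≫ α.app) ≫ H.d = x ≫ E.σ := by rw [Category.assoc, α.app_d, hkx]
  rw [comp_und_comp, rpair_rcTwoCellHom_rcMap, comp_und_comp,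
    rpair_rcCompIso S Q hE hF k x y hkx hxy, cpair_compMap]
  have e : hEF.lsmul (S H) (k ≫ α.app) (cpair E F x y hxy) (by rw [cpair_σ, ha]) ≫
      und (compMap f g) =
        cpair E' F' (hE.lsmul (S H) (k ≫ α.app) x ha ≫ und f) (y ≫ und g)
          (by rw [Category.assoc, und_ρ, IsButterfly.lsmul_ρ, Category.assoc, und_σ, hxy]) := by
    rw [hE.lsmul_cpair (S H) hEF _ x y hxy ha, cpair_compMap]
  rw [rpair_congr Q' _ rfl e, rpair_rcCompIso S Q' hE' hF' k _ _ (by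
    rw [Category.assoc, und_σ, IsButterfly.lsmul_σ, Category.assoc, α.app_c])]
  exact cpair_congr _ _ (rpair_rcTwoCellHom_rcMap (S H) α hE f k x hkx).symm rfl _

/-- A2 is natural in `P`, `Q` and `E`. -/
theorem rcRcHom_naturality (S : ∀ G : XMod C, GroupoidStr G) {L K H G : XMod C} {P P' : L ⟶ K}
    (α : TwoCell (S K) P P') {Q Q' : K ⟶ H} (β : TwoCell (S H) Q Q')
    (γ : TwoCell (S H) (P ≫ Q) (P' ≫ Q'))
    (hαβ : (α.app ≫ XModHom.arrows Q) ≫ H.c = (XModHom.base P' ≫ β.app) ≫ H.d)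
    (hγ : γ.app = (S H).mul (α.app ≫ XModHom.arrows Q) (XModHom.base P' ≫ β.app) hαβ)
    {E E' : ButterflyDiagram H G} (hE : IsButterfly E) (hQE : IsButterfly (rc Q E))
    (f : E ⟶ E') :
    (IsButterfly.rcTwoCellHom (S H) γ hE ≫ rcMap (P' ≫ Q') f) ≫ rcRcHom P' Q' E' =
      rcRcHom P Q E ≫ IsButterfly.rcTwoCellHom (S K) α hQE ≫
        rcMap P' (IsButterfly.rcTwoCellHom (S H) β hE ≫ rcMap Q' f) := by
  refine und_ext (rc_elements_ext fun {T} l x h => ?_)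
  have hx : (l ≫ XModHom.base P) ≫ XModHom.base Q = x ≫ E.σ := by
    rw [← h, Category.assoc, XModHom.comp_base]
  have hd : (l ≫ α.app) ≫ K.d = l ≫ XModHom.base P := by rw [Category.assoc, α.app_d]
  have hc : (l ≫ α.app) ≫ K.c = l ≫ XModHom.base P' := by rw [Category.assoc, α.app_c]
  have h₁ : ((l ≫ α.app) ≫ XModHom.arrows Q) ≫ H.d = x ≫ E.σ := by
    rw [← hx, ← hd, Category.assoc, Category.assoc (l ≫ α.app), XModHom.arrows_d]
  have h₂ : ((l ≫ α.app) ≫ XModHom.arrows Q) ≫ H.c = (((l ≫ α.app) ≫ K.c) ≫ β.app) ≫ H.d := by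
    rw [Category.assoc, XModHom.arrows_c, Category.assoc _ β.app, β.app_d,
      Category.assoc (l ≫ α.app)]
  refine (comp_und_comp_eq (rpair_rcTwoCellHom_rcMap (S H) γ hE f l x h)
    (rpair_rcRcHom P' Q' E' l _ _)).trans (Eq.trans ?_ (comp_und_comp_eq
      (rpair_rcRcHom P Q E l x h) (rpair_rcTwoCellHom_rcMap (S K) α hQE _ l _ _)).symm)
  refine rpair_congr P' _ rfl (Eq.trans ?_ (congrArg (· ≫ _)
    (IsButterfly.lsmul_rpair (S K) (S H) Q hE hQE _ _ x hx hd)).symm) _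
  refine Eq.trans ?_ (rpair_rcTwoCellHom_rcMap (S H) β hE f _ _ _).symm
  refine rpair_congr Q' _ hc.symm (congrArg (· ≫ und f) ?_) _
  rw [hE.lsmul_lsmul (S H) _ _ _ h₁ h₂]
  refine hE.lsmul_congr (S H) ?_ rfl _
  rw [hγ, GroupoidStr.comp_mul]
  exact (S H).mul_congr (Category.assoc _ _ _).symm (by rw [hc, Category.assoc]) _

/-- A1 is compatible with the associativity of composition of butterflies. -/
theorem rcCompIso_assocHom (S : ∀ G : XMod C, GroupoidStr G) {K H G L M : XMod C} (Q : K ⟶ H)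
    {E : ButterflyDiagram H G} {F : ButterflyDiagram G L} {F' : ButterflyDiagram L M}
    (hE : IsButterfly E) (hF : IsButterfly F) (hF' : IsButterfly F')
    (hQE : IsButterfly (rc Q E)) (hEF : IsButterfly (comp E F))
    (hFF' : IsButterfly (comp F F')) :
    rcMap Q (IsButterfly.assocHom (S G) hE hF F') ≫ (rcCompIso S Q hE hFF').hom =
      (rcCompIso S Q hEF hF').hom ≫ compMap (rcCompIso S Q hE hF).hom (𝟙 F') ≫
        IsButterfly.assocHom (S G) hQE hF F' := by
  refine und_ext (rc_comp_comp_elements_ext fun {T} k x y z hkx hxy hyz => ?_)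
  rw [comp_und_comp, rpair_rcMap,
    rpair_congr Q _ rfl (IsButterfly.cpair_assocHom (S G) hE hF F' x y z hxy hyz),
    rpair_rcCompIso S Q hE hFF' k x _ hkx, comp_und_comp,
    rpair_rcCompIso S Q hEF hF' k _ z (by rw [cpair_σ, hkx]), comp_und_comp, cpair_compMap,
    cpair_congr _ _ (rpair_rcCompIso S Q hE hF k x y hkx hxy)
      (show z ≫ und (𝟙 F') = z from Category.comp_id z)]
  exact (IsButterfly.cpair_assocHom (S G) hQE hF F' _ y z _ hyz).symm

/-- The isomorphism `E_Q E ≅ Q ·_rc E` is natural in `Q` and `E`. -/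
theorem agreeHom_naturality (S : ∀ G : XMod C, GroupoidStr G) {K H G : XMod C}
    {Q Q' : K ⟶ H} (α : TwoCell (S H) Q Q') {E E' : ButterflyDiagram H G} (hE : IsButterfly E)
    (hE' : IsButterfly E') (hI : IsButterfly (idB (S H))) (f : E ⟶ E') :
    IsButterfly.agreeHom (S H) Q hE ≫ IsButterfly.rcTwoCellHom (S H) α hE ≫ rcMap Q' f =
      compMap (IsButterfly.rcTwoCellHom (S H) α hI) f ≫
        IsButterfly.agreeHom (S H) Q' hE' := by
  refine und_ext (comp_rc_elements_ext fun {T} k a x hka hax => ?_)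
  have ha : (k ≫ α.app) ≫ H.d = a ≫ H.c := by rw [Category.assoc, α.app_d, hka]
  have e : rpair Q (idB (S H)) k a hka ≫ und (IsButterfly.rcTwoCellHom (S H) α hI) =
      rpair Q' (idB (S H)) k ((S H).mul a (k ≫ α.app) ha.symm) (by
        rw [GroupoidStr.mul_c, Category.assoc, α.app_c]) :=
    (IsButterfly.rpair_rcTwoCellHom (S H) α hI k a hka).trans
      (rpair_congr _ _ rfl (hI.lsmul_idB (S H) _ _ ha) _)
  have hm : (S H).mul a (k ≫ α.app) ha.symm ≫ H.d = x ≫ E.σ := by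
    rw [GroupoidStr.mul_d]; exact hax
  rw [comp_und_comp, IsButterfly.cpair_agreeHom (S H) Q hE k a x hka hax,
    rpair_rcTwoCellHom_rcMap, comp_und_comp, cpair_compMap, cpair_congr _ _ e rfl,
    IsButterfly.cpair_agreeHom (S H) Q' hE' k _ (x ≫ und f) _ (by
      rw [hm, Category.assoc, und_σ])]
  refine rpair_congr _ _ rfl ?_ _
  rw [hE.lsmul_lsmul (S H) a (k ≫ α.app) x hax ha.symm, hE.lsmul_und (S H) hE' f _ x hm]

/-- A1 is compatible with the left unit isomorphism, through `E_Q E ≅ Q ·_rc E`. -/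
theorem rcCompIso_agreeHom (S : ∀ G : XMod C, GroupoidStr G) {K H G : XMod C} (Q : K ⟶ H)
    {E : ButterflyDiagram H G} (hI : IsButterfly (idB (S H))) (hE : IsButterfly E) :
    (rcCompIso S Q hI hE).hom ≫ IsButterfly.agreeHom (S H) Q hE =
      rcMap Q (IsButterfly.lunitHom (S H) hE) := by
  refine und_ext (rc_comp_elements_ext fun {T} k a x hka hax => ?_)
  rw [comp_und_comp, rpair_rcCompIso S Q hI hE k a x hka hax,
    IsButterfly.cpair_agreeHom (S H) Q hE k a x hka hax, rpair_rcMap]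
  exact rpair_congr _ _ rfl (IsButterfly.cpair_lunitHom (S H) hE a x hax).symm _

/-- A1 is compatible with the right unit isomorphism. -/
theorem rcCompIso_runitHom (S : ∀ G : XMod C, GroupoidStr G) {K H G : XMod C} (Q : K ⟶ H)
    {E : ButterflyDiagram H G} (hE : IsButterfly E) (hQE : IsButterfly (rc Q E))
    (hI : IsButterfly (idB (S G))) :
    (rcCompIso S Q hE hI).hom ≫ IsButterfly.runitHom (S G) hQE =
      rcMap Q (IsButterfly.runitHom (S G) hE) := by
  refine und_ext (rc_comp_elements_ext fun {T} k x a hkx hxa => ?_)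
  rw [comp_und_comp, rpair_rcCompIso S Q hE hI k x a hkx hxa,
    IsButterfly.cpair_runitHom (S G) hQE _ a (by rw [rpair_ρ]; exact hxa), rpair_rcMap,
    IsButterfly.rsmul_rpair Q hE hQE k x a hkx hxa]
  exact rpair_congr _ _ rfl (IsButterfly.cpair_runitHom (S G) hE x a hxa).symm _

/-- A1 is compatible with A2. -/
theorem rcRcHom_rcCompIso (S : ∀ G : XMod C, GroupoidStr G) {L K H G M : XMod C} (P : L ⟶ K)
    (Q : K ⟶ H) {E : ButterflyDiagram H G} {F : ButterflyDiagram G M} (hE : IsButterfly E)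
    (hF : IsButterfly F) (hQE : IsButterfly (rc Q E)) :
    rcRcHom P Q (comp E F) ≫ rcMap P (rcCompIso S Q hE hF).hom ≫ (rcCompIso S P hQE hF).hom =
      (rcCompIso S (P ≫ Q) hE hF).hom ≫ compMap (rcRcHom P Q E) (𝟙 F) := by
  refine und_ext (rc_comp_elements_ext fun {T} l x y hlx hxy => ?_)
  have hx : (l ≫ XModHom.base P) ≫ XModHom.base Q = x ≫ E.σ := by
    rw [← hlx, Category.assoc, XModHom.comp_base]
  rw [comp_und_comp, rpair_rcRcHom, comp_und_comp, rpair_rcMap,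
    rpair_congr P _ rfl (rpair_rcCompIso S Q hE hF _ x y hx hxy),
    rpair_rcCompIso S P hQE hF l _ y (by rw [rpair_σ]) (by rw [rpair_ρ, hxy]), comp_und_comp,
    rpair_rcCompIso S (P ≫ Q) hE hF l x y hlx hxy, cpair_compMap]
  exact cpair_congr _ _ (rpair_rcRcHom P Q E l x hlx).symm (Category.comp_id y).symm _

/-- A1 is compatible with A3. -/
theorem rcCompIso_rcIdHom (S : ∀ G : XMod C, GroupoidStr G) {H G L : XMod C}
    {E : ButterflyDiagram H G} {F : ButterflyDiagram G L} (hE : IsButterfly E)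
    (hF : IsButterfly F) :
    (rcCompIso S (𝟙 H) hE hF).hom ≫ compMap (rcIdHom E) (𝟙 F) = rcIdHom (comp E F) := by
  refine und_ext (rc_comp_elements_ext fun {T} h x y hx hxy => ?_)
  rw [comp_und_comp, rpair_rcCompIso S (𝟙 H) hE hF h x y hx hxy, cpair_compMap,
    rpair_rcIdHom (comp E F) h]
  exact cpair_congr _ _ (rpair_rcIdHom E h x hx) (Category.comp_id y) _

/-- The associativity diagram for A2. -/
theorem rcRcHom_rcRcHom {M L K H G : XMod C} (P : M ⟶ L) (Q : L ⟶ K) (R : K ⟶ H)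
    (E : ButterflyDiagram H G) :
    rcRcHom (P ≫ Q) R E ≫ rcRcHom P Q (rc R E) =
      eqToHom (congrArg (fun N => rc N E) (Category.assoc P Q R)) ≫
        rcRcHom P (Q ≫ R) E ≫ rcMap P (rcRcHom Q R E) := by
  refine und_ext (rc_elements_ext fun {T} m x hx => ?_)
  have h₂ : (m ≫ XModHom.base P) ≫ XModHom.base (Q ≫ R) = x ≫ E.σ := by
    rw [← hx]; simp
  rw [comp_und_comp, rpair_rcRcHom, rpair_rcRcHom, comp_und_comp,
    rpair_eqToHom (Category.assoc P Q R), comp_und_comp,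
    rpair_rcRcHom, rpair_rcMap]
  refine rpair_congr _ _ rfl (Eq.trans ?_ (rpair_rcRcHom Q R E _ x h₂).symm) _
  exact rpair_congr _ _ rfl (rpair_congr _ _ (Category.assoc _ _ _).symm rfl _) _

/-- The unit diagram relating A2 and A3 for the identity on the left. -/
theorem rcRcHom_rcIdHom {K H G : XMod C} (Q : K ⟶ H) (E : ButterflyDiagram H G) :
    rcRcHom (𝟙 K) Q E ≫ rcIdHom (rc Q E) =
      eqToHom (congrArg (fun N => rc N E) (Category.id_comp Q)) := by
  refine und_ext (rc_elements_ext fun {T} k x hx => ?_)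
  rw [comp_und_comp, rpair_rcRcHom, rpair_rcIdHom, rpair_eqToHom (Category.id_comp Q)]
  exact rpair_congr _ _ (Category.comp_id k) rfl _

/-- The unit diagram relating A2 and A3 for the identity on the right. -/
theorem rcRcHom_rcMap_rcIdHom {K H G : XMod C} (Q : K ⟶ H) (E : ButterflyDiagram H G) :
    rcRcHom Q (𝟙 H) E ≫ rcMap Q (rcIdHom E) =
      eqToHom (congrArg (fun N => rc N E) (Category.comp_id Q)) := by
  refine und_ext (rc_elements_ext fun {T} k x hx => ?_)
  rw [comp_und_comp, rpair_rcRcHom, rpair_rcMap, rpair_eqToHom (Category.comp_id Q)]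
  exact rpair_congr _ _ rfl (rpair_rcIdHom E _ x _) _

/-- Reduced composition is a coherent action on butterflies. -/
noncomputable def reducedCompositionAction (S : ∀ G : XMod C, GroupoidStr G) :
    ReducedCompositionAction S where
  toButterflyConstraints := butterflyConstraints S
  rc_isButterfly Q _ hE := .rc (S _) (S _) Q hE
  split_isButterfly Q := .rc (S _) (S _) Q (.idB (S _))
  rcTwoCell α _ hE := IsButterfly.rcTwoCellHom (S _) α hE
  rcTwoCell_spec α _ hE := IsButterfly.rcTwoCellHom_snd (S _) α hE
  rcTwoCell_id Q E hE := und_ext <| rc_elements_ext fun {T} k x hx => by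
    rw [IsButterfly.rpair_rcTwoCellHom, und_id, Category.comp_id]
    refine rpair_congr _ _ rfl (hE.lsmul_e (S _) _ _ ?_ _) _
    rw [TwoCell.id, ← Category.assoc, hx, Category.assoc]
  rcTwoCell_vcomp α β E hE := und_ext <| rc_elements_ext fun {T} k x hx => by
    rw [IsButterfly.rpair_rcTwoCellHom, comp_und_comp, IsButterfly.rpair_rcTwoCellHom,
      IsButterfly.rpair_rcTwoCellHom]
    refine rpair_congr _ _ rfl ?_ _
    rw [hE.lsmul_lsmul (S _) _ _ _ (by rw [Category.assoc, α.app_d, hx])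
      (by rw [Category.assoc, α.app_c, Category.assoc, β.app_d])]
    exact hE.lsmul_congr (S _) ((S _).comp_mul _ _ _ _) rfl _
  rcTwoCell_naturality α E E' hE hE' f := und_ext <| rc_elements_ext fun {T} k x hx => by
    rw [rpair_rcTwoCellHom_rcMap, comp_und_comp, rpair_rcMap, IsButterfly.rpair_rcTwoCellHom]
    exact rpair_congr _ _ rfl (hE.lsmul_und (S _) hE' f _ x _) _
  a1 Q _ _ hE hF := rcCompIso S Q hE hF
  a1_spec Q _ _ hE hF _ k x y hkx hxy := rpair_rcCompIso S Q hE hF k x y hkx hxy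
  a2 P Q _ hE := IsButterfly.isoOfHom (.rc (S _) (S _) (P ≫ Q) hE)
    (.rc (S _) (S _) P (.rc (S _) (S _) Q hE)) (rcRcHom P Q _)
  a2_spec P Q _ _ _ l x h := rpair_rcRcHom P Q _ l x h
  a3 hE := IsButterfly.isoOfHom (.rc (S _) (S _) (𝟙 _) hE) hE (rcIdHom _)
  a3_spec _ := rfl
  a1_naturality α _ _ _ _ hE hE' hF hF' f g :=
    rcCompIso_naturality S α hE hE' hF hF' (.comp (S _) (S _) hE hF) f g
  a2_naturality α _ _ β _ _ hE _ f := rcRcHom_naturality S α β _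
    (((α.whiskerRight (S _) _).app_c).trans ((TwoCell.whiskerLeft _ β).app_d).symm) rfl hE
    (.rc (S _) (S _) _ hE) f
  a3_naturality _ _ f := und_ext (rcMap_snd _ f)
  a2_a2 P Q R _ _ := rcRcHom_rcRcHom P Q R _
  a2_a3 Q _ _ := rcRcHom_rcIdHom Q _
  a3_a2 Q _ _ := rcRcHom_rcMap_rcIdHom Q _
  a1_a2 P Q _ _ hE hF := rcRcHom_rcCompIso S P Q hE hF (.rc (S _) (S _) Q hE)
  a1_a3 hE hF := rcCompIso_rcIdHom S hE hF
  a1_assoc Q _ _ _ hE hF hF' := rcCompIso_assocHom S Q hE hF hF' (.rc (S _) (S _) Q hE)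
    (.comp (S _) (S _) hE hF) (.comp (S _) (S _) hF hF')
  a1_runit Q _ hE := rcCompIso_runitHom S Q hE (.rc (S _) (S _) Q hE) (.idB (S _))
  agree Q _ hE := IsButterfly.isoOfHom
    (.comp (S _) (S _) (.rc (S _) (S _) Q (.idB (S _))) hE) (.rc (S _) (S _) Q hE)
    (IsButterfly.agreeHom (S _) Q hE)
  agree_spec Q _ hE _ k a x hka hax := by
    refine (Category.assoc _ _ _).symm.trans ?_
    exact (congrArg (· ≫ rcSnd Q _)
      (IsButterfly.cpair_agreeHom (S _) Q hE k a x hka hax)).trans (rpair_snd ..)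
  agree_naturality {K H G Q Q'} α E E' hE hE' f := by
    have h := agreeHom_naturality S α hE hE' (.idB (S H)) f
    refine h.trans (congrArg (· ≫ _) (congrArg (fun z => compMap z f) ?_))
    refine und_ext ?_
    exact ((Category.id_comp _).trans (Category.comp_id _)).symm
  a1_agree {K H G} Q E hE := by
    refine Eq.trans (congrArg _ ?_) (rcCompIso_agreeHom S Q (.idB (S H)) hE)
    refine (congrArg (· ≫ _) ?_).trans (Category.id_comp _)
    exact (compFunctor K H G).map_id (split (S H) Q, E)

end Coherence

end InternalButterfly

theorem mainTheorem9 {C : Type u} [Category.{v} C] [HasZeroMorphisms C] [SemiAbelian C]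
    [HuqSmith C] :
    (∀ G : XMod C, Nonempty (Unique (GroupoidStr G))) ∧
      ∀ S : (∀ G : XMod C, GroupoidStr G), Nonempty (ReducedCompositionAction S) :=
  ⟨nonempty_unique_groupoidStr, fun S => ⟨reducedCompositionAction S⟩⟩
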